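/- Let $n\ge 2$ and let $b_1,b_2\in C^1([0,\infty))\cap L^1([0,\infty))$ be nonnegative. Let $p,q>1$ satisfy $$\max\left\{\frac{p+2+q^{-1}}{pq-1},\frac{q+2+p^{-1}}{pq-1}\right\}=\frac{n-1}{2}.$$ Let $R>0$, and let $u_0,v_0\in H^1(\mathbb R^n)$, $u_1,v_1\in L^2(\mathbb R^n)$ be nonnegative and supported in $B_R=\{x\in\mathbb R^n:|x|\le R\}$, with $(u_0,u_1)\neq(0,0)$ and $(v_0,v_1)\neq(0,0)$. For $\varepsilon>0$ consider the Cauchy problem $$u_{tt}-\Delta u+b_1(t)u_t=|v|^p,\qquad v_{tt}-\Delta v+b_2(t)v_t=|u|^q,\qquad (u,u_t,v,v_t)(0,\cdot)=\varepsilon\,(u_0,u_1,v_0,v_1)\qquad (\ast)$$ for $x\in\mathbb R^n$, $t>0$. For $0<T\le\infty$, an energy solution of $(\ast)$ on $[0,T)$ is a pair $(u,v)$ with $$u\in C([0,T),H^1(\mathbb R^n))\cap C^1([0,T),L^2(\mathbb R^n))\cap L^q_{\mathrm{loc}}([0,T)\times\mathbb R^n),$$ $$v\in C([0,T),H^1(\mathbb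 R^n))\cap C^1([0,T),L^2(\mathbb R^n))\cap L^p_{\mathrm{loc}}([0,T)\times\mathbb R^n),$$ with $u(0)=\varepsilon u_0$, $v(0)=\varepsilon v_0$ in $H^1(\mathbb R^n)$, such that for every $\phi\in C_0^\infty([0,T)\times\mathbb R^n)$ and every $t\in[0,T)$ $$\int_{\mathbb R^n} u_t(t,x)\phi(t,x)\,dx-\int_{\mathbb R^n}\varepsilon u_1(x)\phi(0,x)\,dx-\int_0^t\!\!\int_{\mathbb R^n} u_t\phi_s\,dx\,ds+\int_0^t\!\!\int_{\mathbb R^n}\nabla u\cdot\nabla\phi\,dx\,ds+\int_0^t\!\!\int_{\mathbb R^n} b_1(s)u_t\phi\,dx\,ds=\int_0^t\!\!\int_{\mathbb R^n}|v|^p\phi\,dx\,ds,$$ and the same identity holds with $(u,u_1,b_1,v,p)$ replaced by $(v,v_1,b_2,u,q)$. Then there exist $\varepsilon_0>0$ and $C>0$, depending only on $n,p,q,b_1,b_2,u_0,u_1,v_0,v_1,R$, such that for every $\varepsilon\in(0,\varepsilon_0]$, every $T\in(0,\infty]$ and every energy solution $(u,v)$ of $(\ast)$ on $[0,T)$ with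 $$\operatorname{supp}u,\ \operatorname{supp}v\subset\{(t,x)\in[0,T)\times\mathbb R^n:|x|\le t+R\},$$ one has $T<\infty$ and $$T\le\begin{cases}\exp\big(C\varepsilon^{-\min\{q(pq-1),\,p(pq-1)\}}\big)&\text{if }p\ne q,\\ \exp\big(C\varepsilon^{-p(p-1)}\big)&\text{if }p=q.\end{cases}$$ In particular, every such solution blows up in finite time, in the sense that its lifespan $T(\varepsilon)$ (the supremum of the times up to which it exists) is finite and satisfies this bound. -/

import Mathlib

open MeasureTheory Set
open scoped ContDiff

namespace DampedWave

noncomputable section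

/-- Euclidean space `ℝⁿ`. -/
abbrev Space (n : ℕ) := EuclideanSpace ℝ (Fin n)

/-- The real Lebesgue space `L²(ℝⁿ)`. -/
abbrev L2 (n : ℕ) := Lp ℝ 2 (volume : Measure (Space n))

/-- The Lebesgue space `L²(ℝⁿ; ℝⁿ)` of vector fields. -/
abbrev L2Vec (n : ℕ) := Lp (Space n) 2 (volume : Measure (Space n))

/-- `g` is the weak (distributional) gradient of `f`: for every `φ ∈ C_c^∞(ℝⁿ)` and every
direction `w`, `∫ f ∂_w φ = - ∫ (g · w) φ`. -/
def IsWeakGradient {n : ℕ} (f : L2 n) (g : L2Vec n) : Prop :=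
  ∀ φ : Space n → ℝ, ContDiff ℝ ∞ φ → HasCompactSupport φ → ∀ w : Space n,
    ∫ x, f x * fderiv ℝ φ x w = - ∫ x, inner ℝ (g x) w * φ x

theorem integrable_mul_fderiv {n : ℕ} (f : L2 n) {φ : Space n → ℝ} (hφ : ContDiff ℝ ∞ φ)
    (hc : HasCompactSupport φ) (w : Space n) :
    Integrable (fun x => f x * fderiv ℝ φ x w) := by
  have h1 : Continuous (fun x => fderiv ℝ φ x w) :=
    (hφ.continuous_fderiv (by simp)).clm_apply continuous_const
  have h2 : HasCompactSupport (fun x => fderiv ℝ φ x w) := hc.fderiv_apply ℝ w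
  exact (Lp.memLp f).integrable_mul (q := 2) (h1.memLp_of_hasCompactSupport h2)

theorem integrable_inner_mul {n : ℕ} (g : L2Vec n) {φ : Space n → ℝ} (hφ : ContDiff ℝ ∞ φ)
    (hc : HasCompactSupport φ) (w : Space n) :
    Integrable (fun x => inner ℝ (g x) w * φ x) :=
  ((Lp.memLp g).inner_const w).integrable_mul (q := 2)
    (hφ.continuous.memLp_of_hasCompactSupport hc)

/-- The Sobolev space `H¹(ℝⁿ)`: the functions `f ∈ L²` with a weak gradient in `L²`, realized as
the space of pairs `(f, ∇f)`. It carries the norm `max ‖f‖ ‖∇f‖`, which is equivalent to the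
usual Hilbert norm and so gives the topology of `H¹`. -/
def H1 (n : ℕ) : Submodule ℝ (L2 n × L2Vec n) where
  carrier := {z | IsWeakGradient z.1 z.2}
  zero_mem' := by
    intro φ _ _ w
    have h1 : ∫ x, ((0 : L2 n) : Space n → ℝ) x * fderiv ℝ φ x w = 0 := by
      rw [integral_eq_zero_of_ae]
      filter_upwards [Lp.coeFn_zero ℝ 2 (volume : Measure (Space n))] with x hx
      simp
    have h2 : ∫ x, inner ℝ (((0 : L2Vec n) : Space n → Space n) x) w * φ x = 0 := by
      rw [integral_eq_zero_of_ae]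
      filter_upwards [Lp.coeFn_zero (Space n) 2 (volume : Measure (Space n))] with x hx
      simp
    simp only [Prod.fst_zero, Prod.snd_zero]
    rw [h1, h2, neg_zero]
  add_mem' := by
    intro a b ha hb φ hφ hc w
    have h1 : ∫ x, (a + b).1 x * fderiv ℝ φ x w
        = ∫ x, (a.1 x * fderiv ℝ φ x w + b.1 x * fderiv ℝ φ x w) := by
      refine integral_congr_ae ?_
      filter_upwards [Lp.coeFn_add a.1 b.1] with x hx
      change (a.1 + b.1 : L2 n) x * _ = _
      rw [hx, Pi.add_apply, add_mul]
    have h2 : ∫ x, inner ℝ ((a + b).2 x) w * φ x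
        = ∫ x, (inner ℝ (a.2 x) w * φ x + inner ℝ (b.2 x) w * φ x) := by
      refine integral_congr_ae ?_
      filter_upwards [Lp.coeFn_add a.2 b.2] with x hx
      change inner ℝ ((a.2 + b.2 : L2Vec n) x) w * _ = _
      rw [hx, Pi.add_apply, inner_add_left, add_mul]
    rw [h1, h2, integral_add (integrable_mul_fderiv _ hφ hc w) (integrable_mul_fderiv _ hφ hc w),
      integral_add (integrable_inner_mul _ hφ hc w) (integrable_inner_mul _ hφ hc w),
      ha φ hφ hc w, hb φ hφ hc w]
    ring
  smul_mem' := by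
    intro c a ha φ hφ hc w
    have h1 : ∫ x, (c • a).1 x * fderiv ℝ φ x w = ∫ x, c * (a.1 x * fderiv ℝ φ x w) := by
      refine integral_congr_ae ?_
      filter_upwards [Lp.coeFn_smul c a.1] with x hx
      change (c • a.1 : L2 n) x * _ = _
      rw [hx, Pi.smul_apply, smul_eq_mul, mul_assoc]
    have h2 : ∫ x, inner ℝ ((c • a).2 x) w * φ x
        = ∫ x, c * (inner ℝ (a.2 x) w * φ x) := by
      refine integral_congr_ae ?_
      filter_upwards [Lp.coeFn_smul c a.2] with x hx
      change inner ℝ ((c • a.2 : L2Vec n) x) w * _ = _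
      rw [hx, Pi.smul_apply, real_inner_smul_left, mul_assoc]
    rw [h1, h2, integral_const_mul, integral_const_mul, ha φ hφ hc w]
    ring

/-- The underlying `L²` function of an element of `H¹`. -/
def toL2 {n : ℕ} (f : H1 n) : L2 n := f.1.1

/-- The gradient of an element of `H¹`. -/
def weakGrad {n : ℕ} (f : H1 n) : L2Vec n := f.1.2

/-- The time interval `[0, T)`, where `T` may be `∞`. -/
def timeInterval (T : EReal) : Set ℝ := {t | 0 ≤ t ∧ (t : EReal) < T}

/-- `u ∈ C([0,T), H¹(ℝⁿ)) ∩ C¹([0,T), L²(ℝⁿ)) ∩ L^r_loc([0,T) × ℝⁿ)`. The last condition says that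
`u`, seen as a function of `(t, x)`, agrees almost everywhere with a measurable function `w`
whose `r`-th power is locally integrable up to `t = 0`. -/
structure MemEnergyClass {n : ℕ} (T : EReal) (r : ℝ) (u : ℝ → H1 n) : Prop where
  continuousOn_H1 : ContinuousOn u (timeInterval T)
  contDiffOn_L2 : ContDiffOn ℝ 1 (fun t => toL2 (u t)) (timeInterval T)
  memLpLoc : ∃ w : ℝ × Space n → ℝ,
    AEStronglyMeasurable w (volume.restrict (timeInterval T ×ˢ univ)) ∧
    LocallyIntegrableOn (fun z => |w z| ^ r) (timeInterval T ×ˢ univ) volume ∧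
    ∀ᵐ t ∂(volume.restrict (timeInterval T)), ∀ᵐ x, w (t, x) = toL2 (u t) x

/-- The time derivative `∂ₜ u(t) ∈ L²(ℝⁿ)` of a curve on `[0, T)` (one-sided at `t = 0`). -/
def timeDeriv {n : ℕ} (T : EReal) (u : ℝ → H1 n) (t : ℝ) : L2 n :=
  derivWithin (fun τ => toL2 (u τ)) (timeInterval T) t

/-- Test functions `φ ∈ C_0^∞([0,T) × ℝⁿ)`, as restrictions to `t ≥ 0` of smooth functions with
compact support in `(-∞, T) × ℝⁿ`; they need not vanish at `t = 0`. -/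
structure IsTestFunction {n : ℕ} (T : EReal) (φ : ℝ × Space n → ℝ) : Prop where
  smooth : ContDiff ℝ ∞ φ
  compactSupport : HasCompactSupport φ
  support_lt : ∀ z ∈ tsupport φ, (z.1 : EReal) < T

/-- The integral form on `[0, T)` of the equation
`u_tt - Δu + b(t) u_t = |v|^p` with initial velocity `ε u₁`. -/
def WeakEquation {n : ℕ} (T : EReal) (p ε : ℝ) (b : ℝ → ℝ) (u₁ : L2 n) (u v : ℝ → H1 n) :
    Prop :=
  ∀ φ : ℝ × Space n → ℝ, IsTestFunction T φ → ∀ t ∈ timeInterval T,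
    (∫ x, timeDeriv T u t x * φ (t, x)) - (∫ x, ε * u₁ x * φ (0, x))
      - (∫ s in (0 : ℝ)..t, ∫ x, timeDeriv T u s x * deriv (fun τ => φ (τ, x)) s)
      + (∫ s in (0 : ℝ)..t, ∫ x, inner ℝ (weakGrad (u s) x) (gradient (fun y => φ (s, y)) x))
      + (∫ s in (0 : ℝ)..t, ∫ x, b s * timeDeriv T u s x * φ (s, x))
    = ∫ s in (0 : ℝ)..t, ∫ x, |toL2 (v s) x| ^ p * φ (s, x)

/-- `(u, v)` is an energy solution on `[0, T)`, `0 < T ≤ ∞`, of the weakly coupled system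
`u_tt - Δu + b₁(t) u_t = |v|^p`, `v_tt - Δv + b₂(t) v_t = |u|^q`,
`(u, u_t, v, v_t)(0) = (ε u₀, ε u₁, ε v₀, ε v₁)`. -/
structure IsEnergySolution {n : ℕ} (T : EReal) (p q ε : ℝ) (b₁ b₂ : ℝ → ℝ)
    (u₀ : H1 n) (u₁ : L2 n) (v₀ : H1 n) (v₁ : L2 n) (u v : ℝ → H1 n) : Prop where
  pos : 0 < T
  mem_u : MemEnergyClass T q u
  mem_v : MemEnergyClass T p v
  init_u : u 0 = ε • u₀
  init_v : v 0 = ε • v₀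
  eq_u : WeakEquation T p ε b₁ u₁ u v
  eq_v : WeakEquation T q ε b₂ v₁ v u

/-- `f` is nonnegative and supported in the closed ball of radius `R` about the origin. -/
def NonnegSupportedInBall {n : ℕ} (R : ℝ) (f : L2 n) : Prop :=
  (∀ᵐ x, 0 ≤ f x) ∧ ∀ᵐ x, R < ‖x‖ → f x = 0

/-- `supp u ⊆ {(t, x) ∈ [0, T) × ℝⁿ : |x| ≤ t + R}`. -/
def SupportedInCone {n : ℕ} (T : EReal) (R : ℝ) (u : ℝ → H1 n) : Prop :=
  ∀ t ∈ timeInterval T, ∀ᵐ x, t + R < ‖x‖ → toL2 (u t) x = 0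

end

end DampedWave

namespace DampedWave

open Topology Filter Metric

/-! Write N = (n-1)/2. Since Δ e^{l⟨x,θ⟩} = l² e^{l⟨x,θ⟩} for a unit vector θ and u(t) has bounded
support, the pairing U(t) = ∫ u e^{l⟨x,θ⟩} solves U'' + b₁U' = l²U + ∫ |v|^p e^{l⟨x,θ⟩}. Nonnegative
damping, data and source keep U nonnegative; once U ≥ 0, the damping costs at most the factor
e^{-∫b₁}. This is where integrability of b₁ enters: up to a constant, U dominates Duhamel's formula
for the undamped equation (`planeWave_lower_bound`).

Average this inequality over all directions θ and over l > 0 with weight l^a e^{-l(t+2R)}. The side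
with u becomes ∫ |u| K_a(t+2R, ·), and for a > N-1 the kernel satisfies K_a(T,x) ≤ C T^{-N}
(T-|x|)^{N-1-a} (`waveKernel_le`). The other side is at least cε for t ≥ 1, and at least c ∫₀ᵗ
(t-s)/(t+2R) (s+2R)^{-a} ∫ |v|^p dx ds (`exists_iteration_frame`). Hölder's inequality against the
kernel bounds ∫ |v|^p below by the p-th power of the functional of v with another weight a'
(`waveFunctional_rpow_le`). Its cost is governed by ∫_R^{s+2R} z^{-κ} dz with κ = (1+a'-N)p/(p-1),
which is bounded, logarithmic or a power of s+2R according as a' is above, at or below N-1/p.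

The functionals of u and v thus satisfy two coupled integral inequalities, and the critical relation
between n, p, q makes the powers of s+2R combine to ds/(s+2R), that is dτ for the logarithmic time τ
= log((s+2R)/R). If p = q, both functionals carry the critical weight N-1/p and each inequality has
a factor τ^{-(p-1)}. If q < p, the functional of u carries N-1/q, so that only one inequality has a
logarithm; v carries any weight in (N-1, N-1/p), and the power (t+2R)^γ in the lower bound for its
functional cancels in the next step.

Iterate on the shrinking ranges τ ≥ 2L - L/2^j. The data enter through the weight a+1, for which the
Hölder step loses no logarithm, and give a first bound M₀ on τ ≥ L, with a factor L gained from the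
length of the range. Each round replaces a bound M by K B^{-j} M^ρ with ρ > 1
(`superlinear_iteration`), and the bounds grow geometrically once K M₀^{ρ-1} is large, which amounts
to L ≥ Cε^{-p(p-1)}, respectively L ≥ Cε^{-q(pq-1)} (`exists_blowup_symmetric`,
`exists_blowup_asymmetric`). Then the functional is infinite at τ = 2L. For an energy solution it is
finite (`waveFunctional_lt_top`), so the solution cannot reach that time. -/

/-- Monotonicity of an absolutely continuous function from a lower bound on its derivative. -/
theorem integral_le_sub_of_ae_hasDerivAt {f f' g : ℝ → ℝ} {a b : ℝ} (hab : a ≤ b)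
    (hf : AbsolutelyContinuousOnInterval f a b)
    (hf' : ∀ᵐ x, x ∈ Icc a b → HasDerivAt f (f' x) x)
    (hg : IntervalIntegrable g volume a b) (hgf : ∀ x ∈ Icc a b, g x ≤ f' x) :
    ∫ x in a..b, g x ≤ f b - f a := by
  rw [← hf.integral_deriv_eq_sub]
  refine intervalIntegral.integral_mono_ae_restrict hab hg hf.intervalIntegrable_deriv ?_
  refine (ae_restrict_iff' measurableSet_Icc).2 ?_
  filter_upwards [hf'] with x hx hxI
  rw [(hx hxI).deriv]
  exact hgf x hxI

theorem hasDerivAt_integral_of_continuous {f : ℝ → ℝ} (hf : Continuous f) (t : ℝ) :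
    HasDerivAt (fun t => ∫ s in (0 : ℝ)..t, f s) (f t) t :=
  intervalIntegral.integral_hasDerivAt_right (hf.intervalIntegrable _ _)
    (hf.stronglyMeasurableAtFilter _ _) hf.continuousAt

theorem contDiff_one_of_hasDerivAt {f f' : ℝ → ℝ} (h : ∀ t, HasDerivAt f (f' t) t)
    (hc : Continuous f') : ContDiff ℝ 1 f := by
  rw [contDiff_one_iff_deriv]
  refine ⟨fun t => (h t).differentiableAt, ?_⟩
  rwa [funext fun t => (h t).deriv]

theorem absolutelyContinuous_of_contDiff {f : ℝ → ℝ} (h : ContDiff ℝ 1 f) (a b : ℝ) :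
    AbsolutelyContinuousOnInterval f a b :=
  h.contDiffOn.absolutelyContinuousOnInterval

/-! ### Comparison for the damped equation U'' + bU' = l²U + h -/

section ODE

variable {U V b h : ℝ → ℝ} {t₁ l V₀ : ℝ}

/-- Solutions of `U'' + b U' = l² U + h` with nonnegative damping, source and data stay
nonnegative. -/
theorem nonneg_of_damped_integral_equation (ht : 0 ≤ t₁) (hb : Continuous b) (hV : Continuous V)
    (hb0 : ∀ t, 0 ≤ b t) (hU : ∀ t, HasDerivAt U (V t) t)
    (hh : IntervalIntegrable h volume 0 t₁) (hh0 : ∀ t, 0 ≤ h t)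
    (hVeq : ∀ t ∈ Icc 0 t₁, V t = V₀ + l ^ 2 * (∫ s in (0 : ℝ)..t, U s)
      - (∫ s in (0 : ℝ)..t, b s * V s) + ∫ s in (0 : ℝ)..t, h s)
    (hU0 : 0 ≤ U 0) (hV0 : 0 ≤ V₀) : ∀ t ∈ Icc 0 t₁, 0 ≤ U t := by
  have hUc : Continuous U := continuous_iff_continuousAt.2 fun t => (hU t).continuousAt
  set B : ℝ → ℝ := fun t => ∫ s in (0 : ℝ)..t, b s with hB
  have hBd : ∀ t, HasDerivAt B (b t) t := hasDerivAt_integral_of_continuous hb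
  have hBc : Continuous B := continuous_iff_continuousAt.2 fun t => (hBd t).continuousAt
  have hBmono : Monotone B := monotone_of_hasDerivAt_nonneg hBd hb0
  -- The aim is I' = U⁻ ≤ l² t₁ I for the integral I of the negative part, with I(0) = 0; Grönwall
  -- then gives I = 0.
  set Um : ℝ → ℝ := fun t => max (-U t) 0 with hUm
  have hUmc : Continuous Um := hUc.neg.max continuous_const
  have hUm0 : ∀ t, 0 ≤ Um t := fun t => le_max_right _ _
  set I : ℝ → ℝ := fun t => ∫ s in (0 : ℝ)..t, Um s with hI
  have hId : ∀ t, HasDerivAt I (Um t) t := hasDerivAt_integral_of_continuous hUmc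
  have hIc : Continuous I := continuous_iff_continuousAt.2 fun t => (hId t).continuousAt
  have hImono : Monotone I := monotone_of_hasDerivAt_nonneg hId hUm0
  have hI0 : I 0 = 0 := by simp [hI]
  -- the velocity is bounded below by the negative part
  have hVlow : ∀ t ∈ Icc 0 t₁, -(l ^ 2 * I t) ≤ V t := by
    intro t htI
    have hh' : IntervalIntegrable h volume 0 t := hh.mono_set (by
      rw [uIcc_of_le htI.1, uIcc_of_le ht]; exact Icc_subset_Icc le_rfl htI.2)
    -- W is the right-hand side of the integral equation, taken on the whole line. As h is only
    -- integrable, W is absolutely continuous and differentiable almost everywhere; V is known to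
    -- agree with it only on [0, t₁], so the derivative is taken of W.
    set W : ℝ → ℝ := fun t => V₀ + l ^ 2 * (∫ s in (0 : ℝ)..t, U s)
      - (∫ s in (0 : ℝ)..t, b s * V s) + ∫ s in (0 : ℝ)..t, h s with hW
    set E : ℝ → ℝ := fun s => Real.exp (B s) with hE
    have hEd : ∀ s, HasDerivAt E (Real.exp (B s) * b s) s := fun s => (hBd s).exp
    have hEC : ContDiff ℝ 1 E :=
      contDiff_one_of_hasDerivAt hEd ((Real.continuous_exp.comp hBc).mul hb)
    have hUI := hasDerivAt_integral_of_continuous hUc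
    have hbVI := hasDerivAt_integral_of_continuous (hb.mul hV)
    have hWC : ContDiff ℝ 1 (fun t => V₀ + l ^ 2 * (∫ s in (0 : ℝ)..t, U s)
      - (∫ s in (0 : ℝ)..t, b s * V s)) :=
      contDiff_one_of_hasDerivAt (fun s => (((hUI s).const_mul (l ^ 2)).const_add V₀).sub (hbVI s))
        ((continuous_const.mul hUc).sub (hb.mul hV))
    have hHac : AbsolutelyContinuousOnInterval (fun t => ∫ s in (0 : ℝ)..t, h s) 0 t :=
      hh'.absolutelyContinuousOnInterval_intervalIntegral (c := 0) (by simp)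
    have hWac : AbsolutelyContinuousOnInterval W 0 t :=
      (absolutelyContinuous_of_contDiff hWC 0 t).add hHac
    have hQac : AbsolutelyContinuousOnInterval (fun s => E s * W s) 0 t :=
      (absolutelyContinuous_of_contDiff hEC 0 t).fun_mul hWac
    have hQd : ∀ᵐ s, s ∈ Icc 0 t → HasDerivAt (fun s => E s * W s)
        (Real.exp (B s) * (l ^ 2 * U s + h s)) s := by
      filter_upwards [hh'.ae_hasDerivAt_integral] with s hs hsI
      have h1 := hs (by rwa [uIcc_of_le htI.1]) 0 (by simp)
      have h2 : HasDerivAt W (l ^ 2 * U s - b s * V s + h s) s :=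
        ((((hUI s).const_mul (l ^ 2)).const_add V₀).sub (hbVI s)).add h1
      have h3 := (hEd s).mul h2
      have h4 : W s = V s := (hVeq s ⟨hsI.1, hsI.2.trans htI.2⟩).symm
      refine h3.congr_deriv ?_
      rw [h4]; simp only [hE]; ring
    have key := integral_le_sub_of_ae_hasDerivAt
      (g := fun s => -(Real.exp (B t) * (l ^ 2 * Um s))) htI.1 hQac hQd
      ((by fun_prop : Continuous fun s => -(Real.exp (B t) * (l ^ 2 * Um s))).intervalIntegrable _ _)
      (by
        intro s hs
        have h1 : Real.exp (B s) ≤ Real.exp (B t) := Real.exp_le_exp.2 (hBmono hs.2)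
        have h2 : -Um s ≤ U s := by
          have := le_max_left (-U s) 0
          simp only [hUm]; linarith
        have h3 : Real.exp (B s) * (l ^ 2 * Um s) ≤ Real.exp (B t) * (l ^ 2 * Um s) :=
          mul_le_mul_of_nonneg_right h1 (mul_nonneg (sq_nonneg _) (hUm0 s))
        have h4 : Real.exp (B s) * (l ^ 2 * (-Um s)) ≤ Real.exp (B s) * (l ^ 2 * U s + h s) := by
          refine mul_le_mul_of_nonneg_left ?_ (Real.exp_pos _).le
          have := mul_le_mul_of_nonneg_left h2 (sq_nonneg l)
          linarith [hh0 s]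
        linarith)
    rw [intervalIntegral.integral_neg, intervalIntegral.integral_const_mul,
      intervalIntegral.integral_const_mul] at key
    have h5 : W t = V t := (hVeq t htI).symm
    have h6 : 0 ≤ E 0 * W 0 := by
      refine mul_nonneg (Real.exp_pos _).le ?_
      simp [hW, hV0]
    have h7 : Real.exp (B t) * -(l ^ 2 * I t) ≤ Real.exp (B t) * V t := by
      rw [← h5]
      change _ ≤ E t * W t
      have : Real.exp (B t) * (l ^ 2 * ∫ x in (0 : ℝ)..t, Um x) = Real.exp (B t) * (l ^ 2 * I t) :=
        rfl
      linarith
    exact le_of_mul_le_mul_left h7 (Real.exp_pos _)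
  have hUlow : ∀ t ∈ Icc 0 t₁, -(l ^ 2 * t₁ * I t) ≤ U t := by
    intro t htI
    have h1 : ∫ s in (0 : ℝ)..t, V s = U t - U 0 :=
      intervalIntegral.integral_eq_sub_of_hasDerivAt (fun s _ => hU s) (hV.intervalIntegrable _ _)
    have h2 : ∫ s in (0 : ℝ)..t, -(l ^ 2 * I t) ≤ ∫ s in (0 : ℝ)..t, V s := by
      refine intervalIntegral.integral_mono_on htI.1 (by simp) (hV.intervalIntegrable _ _) ?_
      intro s hs
      refine le_trans ?_ (hVlow s ⟨hs.1, hs.2.trans htI.2⟩)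
      have := mul_le_mul_of_nonneg_left (hImono hs.2) (sq_nonneg l)
      linarith
    rw [intervalIntegral.integral_const, h1, smul_eq_mul, sub_zero] at h2
    have h3 : 0 ≤ I t := hI0 ▸ hImono htI.1
    have h4 : t * (l ^ 2 * I t) ≤ t₁ * (l ^ 2 * I t) :=
      mul_le_mul_of_nonneg_right htI.2 (mul_nonneg (sq_nonneg _) h3)
    linarith
  have hIz : ∀ t ∈ Icc 0 t₁, I t = 0 := by
    refine eq_zero_of_abs_deriv_le_mul_abs_self_of_eq_zero_right (f' := Um) (K := l ^ 2 * t₁)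
      hIc.continuousOn (fun t _ => (hId t).hasDerivWithinAt) hI0 ?_
    intro t htI
    have h3 : 0 ≤ I t := hI0 ▸ hImono htI.1
    rw [Real.norm_of_nonneg (hUm0 t), Real.norm_of_nonneg h3]
    have := hUlow t ⟨htI.1, htI.2.le⟩
    exact max_le (by linarith) (by positivity)
  intro t htI
  have := hUlow t htI
  rw [hIz t htI] at this
  linarith

/-- Comparison with the undamped equation: a nonnegative damping costs at most the factor
`e^{-∫ b}`. -/
theorem damped_duhamel_lower_bound (ht : 0 ≤ t₁) (hl : 0 < l) (hb : Continuous b)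
    (hV : Continuous V) (hb0 : ∀ t, 0 ≤ b t) (hU : ∀ t, HasDerivAt U (V t) t)
    (hh : IntervalIntegrable h volume 0 t₁) (hh0 : ∀ t, 0 ≤ h t)
    (hVeq : ∀ t ∈ Icc 0 t₁, V t = V₀ + l ^ 2 * (∫ s in (0 : ℝ)..t, U s)
      - (∫ s in (0 : ℝ)..t, b s * V s) + ∫ s in (0 : ℝ)..t, h s)
    (hU0 : 0 ≤ U 0) (hV0 : 0 ≤ V₀) :
    U 0 * Real.cosh (l * t₁) + V₀ * (Real.sinh (l * t₁) / l)
        + ∫ s in (0 : ℝ)..t₁, h s * (Real.sinh (l * (t₁ - s)) / l)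
      ≤ Real.exp (∫ s in (0 : ℝ)..t₁, b s) * U t₁ := by
  have hUpos := nonneg_of_damped_integral_equation ht hb hV hb0 hU hh hh0 hVeq hU0 hV0
  have hUc : Continuous U := continuous_iff_continuousAt.2 fun t => (hU t).continuousAt
  set B : ℝ → ℝ := fun t => ∫ s in (0 : ℝ)..t, b s with hB
  have hBd : ∀ t, HasDerivAt B (b t) t := hasDerivAt_integral_of_continuous hb
  have hBc : Continuous B := continuous_iff_continuousAt.2 fun t => (hBd t).continuousAt
  have hBmono : Monotone B := monotone_of_hasDerivAt_nonneg hBd hb0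
  have hB0 : B 0 = 0 := by simp [hB]
  set W : ℝ → ℝ := fun t => V₀ + l ^ 2 * (∫ s in (0 : ℝ)..t, U s)
    - (∫ s in (0 : ℝ)..t, b s * V s) + ∫ s in (0 : ℝ)..t, h s with hW
  set E : ℝ → ℝ := fun s => Real.exp (B s) with hE
  -- The pair (y, z) solves the backward adjoint system y' = -z, z' = -l²y with y(t₁) = 0, z(t₁) =
  -- 1. In the derivative of e^B (Wy + Uz) everything cancels except e^B (hy + bUz), and bUz ≥ 0
  -- because U ≥ 0.
  set y : ℝ → ℝ := fun s => Real.sinh (l * (t₁ - s)) / l with hy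
  set z : ℝ → ℝ := fun s => Real.cosh (l * (t₁ - s)) with hz
  have hlin : ∀ s, HasDerivAt (fun s => l * (t₁ - s)) (l * -1) s := fun s =>
    ((hasDerivAt_id s).const_sub t₁).const_mul l
  have hyd : ∀ s, HasDerivAt y (-z s) s := by
    intro s
    refine (((hlin s).sinh).div_const l).congr_deriv ?_
    simp only [hz]; field_simp
  have hzd : ∀ s, HasDerivAt z (-(l ^ 2 * y s)) s := by
    intro s
    refine ((hlin s).cosh).congr_deriv ?_
    simp only [hy]; field_simp
  have hyc : Continuous y := continuous_iff_continuousAt.2 fun t => (hyd t).continuousAt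
  have hzc : Continuous z := continuous_iff_continuousAt.2 fun t => (hzd t).continuousAt
  have hEd : ∀ s, HasDerivAt E (Real.exp (B s) * b s) s := fun s => (hBd s).exp
  have hEC : ContDiff ℝ 1 E :=
    contDiff_one_of_hasDerivAt hEd ((Real.continuous_exp.comp hBc).mul hb)
  have hyC : ContDiff ℝ 1 y := contDiff_one_of_hasDerivAt hyd hzc.neg
  have hzC : ContDiff ℝ 1 z := contDiff_one_of_hasDerivAt hzd (continuous_const.mul hyc).neg
  have hUC : ContDiff ℝ 1 U := contDiff_one_of_hasDerivAt hU hV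
  have hUI := hasDerivAt_integral_of_continuous hUc
  have hbVI := hasDerivAt_integral_of_continuous (hb.mul hV)
  have hWC : ContDiff ℝ 1 (fun t => V₀ + l ^ 2 * (∫ s in (0 : ℝ)..t, U s)
    - (∫ s in (0 : ℝ)..t, b s * V s)) :=
    contDiff_one_of_hasDerivAt (fun s => (((hUI s).const_mul (l ^ 2)).const_add V₀).sub (hbVI s))
      ((continuous_const.mul hUc).sub (hb.mul hV))
  have hHac : AbsolutelyContinuousOnInterval (fun t => ∫ s in (0 : ℝ)..t, h s) 0 t₁ :=
    hh.absolutelyContinuousOnInterval_intervalIntegral (c := 0) (by simp)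
  have hWac : AbsolutelyContinuousOnInterval W 0 t₁ :=
    (absolutelyContinuous_of_contDiff hWC 0 t₁).add hHac
  have hQac : AbsolutelyContinuousOnInterval (fun s => E s * (W s * y s + U s * z s)) 0 t₁ :=
    (absolutelyContinuous_of_contDiff hEC 0 t₁).fun_mul
      ((hWac.fun_mul (absolutelyContinuous_of_contDiff hyC 0 t₁)).add
        (absolutelyContinuous_of_contDiff (hUC.mul hzC) 0 t₁))
  have hQd : ∀ᵐ s, s ∈ Icc 0 t₁ → HasDerivAt (fun s => E s * (W s * y s + U s * z s))
      (Real.exp (B s) * (h s * y s + b s * U s * z s)) s := by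
    filter_upwards [hh.ae_hasDerivAt_integral] with s hs hsI
    have h1 := hs (by rwa [uIcc_of_le ht]) 0 (by simp)
    have h2 : HasDerivAt W (l ^ 2 * U s - b s * V s + h s) s :=
      ((((hUI s).const_mul (l ^ 2)).const_add V₀).sub (hbVI s)).add h1
    have h3 := (hEd s).mul ((h2.mul (hyd s)).add ((hU s).mul (hzd s)))
    have h4 : W s = V s := (hVeq s hsI).symm
    refine h3.congr_deriv ?_
    rw [show (W * y + U * z) s = W s * y s + U s * z s from rfl, h4]; simp only [hE]; ring
  have hy0 : ∀ s ∈ Icc 0 t₁, 0 ≤ y s := fun s hs =>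
    div_nonneg (Real.sinh_nonneg_iff.2 (mul_nonneg hl.le (sub_nonneg.2 hs.2))) hl.le
  have key := integral_le_sub_of_ae_hasDerivAt (g := fun s => h s * y s) ht hQac hQd
    (hh.mul_continuousOn hyc.continuousOn)
    (by
      intro s hs
      have h1 : 1 ≤ Real.exp (B s) := Real.one_le_exp (hB0 ▸ hBmono hs.1)
      have h2 : 0 ≤ h s * y s := mul_nonneg (hh0 s) (hy0 s hs)
      have h3 : 0 ≤ b s * U s * z s :=
        mul_nonneg (mul_nonneg (hb0 s) (hUpos s hs)) (Real.cosh_pos _).le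
      nlinarith)
  have e1 : E t₁ * (W t₁ * y t₁ + U t₁ * z t₁) = Real.exp (∫ s in (0 : ℝ)..t₁, b s) * U t₁ := by
    simp [hE, hy, hz, hB]
  have e2 : E 0 * (W 0 * y 0 + U 0 * z 0)
      = U 0 * Real.cosh (l * t₁) + V₀ * (Real.sinh (l * t₁) / l) := by
    simp [hE, hB0, hW, hy, hz]; ring
  rw [e1, e2] at key
  linarith

end ODE

/-! ### Plane waves as eigenfunctions of the Laplacian -/

section PlaneWave

variable {n : ℕ}

/-- A plane wave `e^{l ⟨x, θ⟩}`, cut off outside a ball. -/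
theorem exists_planeWave_cutoff (θ : Space n) (l : ℝ) {ρ : ℝ} (hρ : 0 < ρ) :
    ∃ ψ : Space n → ℝ, ContDiff ℝ ∞ ψ ∧ HasCompactSupport ψ ∧ (∀ x, 0 ≤ ψ x) ∧
      (∀ x, ψ x ≤ Real.exp (l * inner ℝ x θ)) ∧
      ∀ x, ‖x‖ ≤ ρ → ψ x = Real.exp (l * inner ℝ x θ) := by
  let χ : ContDiffBump (0 : Space n) := ⟨ρ, ρ + 1, hρ, by linarith⟩
  refine ⟨fun x => χ x * Real.exp (l * inner ℝ x θ), ?_, χ.hasCompactSupport.mul_right, ?_, ?_, ?_⟩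
  · exact χ.contDiff.mul (Real.contDiff_exp.comp (contDiff_const.mul
      (contDiff_id.inner ℝ contDiff_const)))
  · exact fun x => mul_nonneg χ.nonneg (Real.exp_pos _).le
  · exact fun x => mul_le_of_le_one_left (Real.exp_pos _).le χ.le_one
  · intro x hx
    simp only [χ.one_of_mem_closedBall (show x ∈ Metric.closedBall 0 ρ by simpa using hx), one_mul]

theorem fderiv_planeWave (θ : Space n) (l : ℝ) (x e : Space n) :
    fderiv ℝ (fun y : Space n => Real.exp (l * inner ℝ y θ)) x e
      = l * inner ℝ e θ * Real.exp (l * inner ℝ x θ) := by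
  have h1 : HasFDerivAt (fun y : Space n => inner ℝ y θ) (innerSL ℝ θ) x := by
    have := (innerSL ℝ θ).hasFDerivAt (x := x)
    refine this.congr_of_eventuallyEq (Eventually.of_forall fun y => ?_)
    simp [real_inner_comm]
  rw [((h1.const_mul l).exp).fderiv]
  simp [real_inner_comm]; ring

/-- The Laplacian, as the sum of the pure second derivatives. -/
noncomputable def laplace (ψ : Space n → ℝ) (x : Space n) : ℝ :=
  ∑ i : Fin n, fderiv ℝ (fun y => fderiv ℝ ψ y (EuclideanSpace.single i 1)) x
    (EuclideanSpace.single i 1)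

/-- Near a point with ‖x‖ < ρ the cutoff is locally equal to the plane wave, and the squared
components of θ sum to 1. -/
theorem laplace_planeWave_cutoff {θ : Space n} (hθ : ‖θ‖ = 1) {l ρ : ℝ} {ψ : Space n → ℝ}
    (h : ∀ x, ‖x‖ ≤ ρ → ψ x = Real.exp (l * inner ℝ x θ)) {x : Space n} (hx : ‖x‖ < ρ) :
    laplace ψ x = l ^ 2 * ψ x := by
  have hev : ∀ z : Space n, ‖z‖ < ρ →
      ψ =ᶠ[𝓝 z] fun y => Real.exp (l * inner ℝ y θ) := by
    intro z hz
    filter_upwards [(isOpen_lt continuous_norm continuous_const).mem_nhds hz] with y hy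
    exact h y (le_of_lt hy)
  have h1 : ∀ e : Space n, fderiv ℝ (fun y => fderiv ℝ ψ y e) x e
      = l ^ 2 * inner ℝ e θ ^ 2 * Real.exp (l * inner ℝ x θ) := by
    intro e
    have h2 : (fun y => fderiv ℝ ψ y e) =ᶠ[𝓝 x]
        fun y => l * inner ℝ e θ * Real.exp (l * inner ℝ y θ) := by
      filter_upwards [(isOpen_lt continuous_norm continuous_const).mem_nhds hx] with y hy
      rw [(hev y hy).fderiv_eq, fderiv_planeWave]
    rw [h2.fderiv_eq, fderiv_const_mul, smul_apply, fderiv_planeWave,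
      smul_eq_mul]
    · ring
    · have := (Real.contDiff_exp.comp (contDiff_const.mul
        (contDiff_id.inner ℝ contDiff_const)) : ContDiff ℝ 1
          (fun y : Space n => Real.exp (l * inner ℝ y θ)))
      exact this.differentiable (by simp) x
  have h3 : ∑ i : Fin n, (inner ℝ (EuclideanSpace.single i (1 : ℝ)) θ) ^ 2 = 1 := by
    have := EuclideanSpace.real_norm_sq_eq θ
    rw [hθ] at this
    simp only [EuclideanSpace.inner_single_left]
    simpa using this.symm
  rw [laplace, Finset.sum_congr rfl fun i _ => h1 _, ← Finset.sum_mul, ← Finset.mul_sum, h3,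
    h x hx.le]
  ring

/-- Expand the inner product in the standard basis and use the definition of the weak gradient with
∂ᵢψ as test function in direction i. -/
theorem integral_inner_weakGrad_gradient (f : H1 n) {ψ : Space n → ℝ} (hψ : ContDiff ℝ ∞ ψ)
    (hc : HasCompactSupport ψ) :
    ∫ x, inner ℝ (weakGrad f x) (gradient ψ x) = - ∫ x, toL2 f x * laplace ψ x := by
  have hd : ∀ e : Space n, ContDiff ℝ ∞ (fun y => fderiv ℝ ψ y e) := fun e =>
    (hψ.fderiv_right (by simp)).clm_apply contDiff_const
  have hdc : ∀ e : Space n, HasCompactSupport (fun y => fderiv ℝ ψ y e) := fun e =>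
    hc.fderiv_apply ℝ e
  have h1 : ∀ x, inner ℝ (weakGrad f x) (gradient ψ x)
      = ∑ i : Fin n, inner ℝ (weakGrad f x) (EuclideanSpace.single i (1 : ℝ))
        * fderiv ℝ ψ x (EuclideanSpace.single i 1) := by
    intro x
    rw [← (EuclideanSpace.basisFun (Fin n) ℝ).sum_inner_mul_inner]
    refine Finset.sum_congr rfl fun i _ => ?_
    rw [EuclideanSpace.basisFun_apply, real_inner_comm (gradient ψ x), gradient,
      InnerProductSpace.toDual_symm_apply]
  have h2 : ∀ x, toL2 f x * laplace ψ x = ∑ i : Fin n, toL2 f x *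
      fderiv ℝ (fun y => fderiv ℝ ψ y (EuclideanSpace.single i 1)) x
        (EuclideanSpace.single i 1) := fun x => by rw [laplace, Finset.mul_sum]
  simp_rw [h1, h2]
  rw [integral_finsetSum _ fun i _ => integrable_inner_mul _ (hd _) (hdc _) _,
    integral_finsetSum _ fun i _ => integrable_mul_fderiv _ (hd _) (hdc _) _,
    ← Finset.sum_neg_distrib]
  refine Finset.sum_congr rfl fun i _ => ?_
  have := f.2 _ (hd (EuclideanSpace.single i 1)) (hdc _) (EuclideanSpace.single i 1)
  simp only [toL2, weakGrad]
  rw [this, neg_neg]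

/-- The eigenvalue relation `Δ e^{l⟨x, θ⟩} = l² e^{l⟨x, θ⟩}` in weak form. -/
theorem integral_inner_weakGrad_planeWave {θ : Space n} (hθ : ‖θ‖ = 1) {l ρ : ℝ}
    {ψ : Space n → ℝ} (hψ : ContDiff ℝ ∞ ψ) (hc : HasCompactSupport ψ)
    (h : ∀ x, ‖x‖ ≤ ρ → ψ x = Real.exp (l * inner ℝ x θ)) {r : ℝ} (hr : r < ρ) (f : H1 n)
    (hf : ∀ᵐ x, r < ‖x‖ → toL2 f x = 0) :
    ∫ x, inner ℝ (weakGrad f x) (gradient ψ x) = - (l ^ 2 * ∫ x, toL2 f x * ψ x) := by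
  rw [integral_inner_weakGrad_gradient f hψ hc, ← integral_const_mul]
  congr 1
  refine integral_congr_ae ?_
  filter_upwards [hf] with x hx
  rcases lt_or_ge r ‖x‖ with h1 | h1
  · simp [hx h1]
  · rw [laplace_planeWave_cutoff hθ h (h1.trans_lt hr)]; ring

/-- Integration against a fixed continuous compactly supported function, as a functional on `L²`. -/
noncomputable def pairing (ψ : Space n → ℝ) (hψ : MemLp ψ 2 volume) : L2 n →L[ℝ] ℝ :=
  innerSL ℝ hψ.toLp

theorem pairing_apply {ψ : Space n → ℝ} (hψ : MemLp ψ 2 volume) (f : L2 n) :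
    pairing ψ hψ f = ∫ x, f x * ψ x := by
  rw [pairing, innerSL_apply_apply, L2.inner_def]
  refine integral_congr_ae ?_
  filter_upwards [hψ.coeFn_toLp] with x hx
  rw [hx]; simp

end PlaneWave

/-! ### The weak equation tested with plane waves -/

section TimeInterval

theorem Icc_subset_timeInterval {T : EReal} {t₁ : ℝ} (h : t₁ ∈ timeInterval T) :
    Icc 0 t₁ ⊆ timeInterval T := fun _ hs =>
  ⟨hs.1, lt_of_le_of_lt (EReal.coe_le_coe_iff.2 hs.2) h.2⟩

theorem uniqueDiffOn_timeInterval {T : EReal} (hT : 0 < T) : UniqueDiffOn ℝ (timeInterval T) := by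
  have hoc : OrdConnected (timeInterval T) := ⟨fun x hx y hy z hz =>
    ⟨hx.1.trans hz.1, lt_of_le_of_lt (EReal.coe_le_coe_iff.2 hz.2) hy.2⟩⟩
  refine uniqueDiffOn_convex hoc.convex ?_
  obtain ⟨r, hr0, hrT⟩ := EReal.lt_iff_exists_real_btwn.1 hT
  have hr0' : 0 < r := by exact_mod_cast hr0
  refine ⟨r / 2, mem_interior.2 ⟨Ioo 0 r, fun s hs => ⟨hs.1.le, ?_⟩, isOpen_Ioo,
    by constructor <;> linarith⟩⟩
  exact lt_trans (EReal.coe_lt_coe_iff.2 hs.2) hrT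

end TimeInterval

variable {n : ℕ}

/-- A measurable representative of the nonlinearity: `w` is jointly measurable, `|w|^r` is locally
integrable on `[0, T) × ℝⁿ`, and `w(t, ·) = u(t)` for almost every `t`. -/
structure IsRepresentative (T : EReal) (r : ℝ) (u : ℝ → H1 n) (w : ℝ × Space n → ℝ) : Prop where
  measurable : Measurable w
  locallyIntegrableOn :
    LocallyIntegrableOn (fun z => |w z| ^ r) (timeInterval T ×ˢ univ) volume
  ae_eq : ∀ᵐ t ∂(volume.restrict (timeInterval T)), ∀ᵐ x, w (t, x) = toL2 (u t) x

theorem volume_restrict_timeInterval_prod (T : EReal) :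
    (volume : Measure (ℝ × Space n)).restrict (timeInterval T ×ˢ univ)
      = (volume.restrict (timeInterval T)).prod (volume : Measure (Space n)) := by
  rw [Measure.volume_eq_prod, ← Measure.prod_restrict, Measure.restrict_univ]

/-- Joint measurability is what later permits Tonelli's theorem on the source term; passing to a
strictly measurable version changes w only on a null set, hence on a null set of x for almost every
t. -/
theorem MemEnergyClass.exists_isRepresentative {T : EReal} {r : ℝ} {u : ℝ → H1 n}
    (h : MemEnergyClass T r u) : ∃ w, IsRepresentative T r u w := by
  obtain ⟨w, hw, hloc, hae⟩ := h.memLpLoc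
  obtain ⟨w', hw', heq⟩ := hw
  refine ⟨w', hw'.measurable, ?_, ?_⟩
  · intro z hz
    obtain ⟨s, hs, hint⟩ := hloc z hz
    refine ⟨s ∩ (timeInterval T ×ˢ univ), inter_mem hs self_mem_nhdsWithin, ?_⟩
    have h1 : ∀ᵐ z ∂(volume.restrict (s ∩ (timeInterval T ×ˢ univ))), w z = w' z :=
      ae_mono (Measure.restrict_mono inter_subset_right le_rfl) heq
    refine (hint.mono_set inter_subset_left).congr ?_
    filter_upwards [h1] with z hz
    rw [hz]
  · rw [volume_restrict_timeInterval_prod] at heq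
    filter_upwards [hae, Measure.ae_ae_of_ae_prod heq] with t h1 h2
    filter_upwards [h1, h2] with x h3 h4
    rw [← h4, h3]

/-- The product of `|w|^r` with a spatial cutoff is integrable on `[0, t₁] × ℝⁿ`. -/
theorem IsRepresentative.integrable_mul {T : EReal} {r : ℝ} {u : ℝ → H1 n}
    {w : ℝ × Space n → ℝ} (hw : IsRepresentative T r u w) {t₁ : ℝ} (ht : t₁ ∈ timeInterval T)
    {ψ : Space n → ℝ} (hψ : Continuous ψ) (hc : HasCompactSupport ψ) :
    Integrable (fun z : ℝ × Space n => |w z| ^ r * ψ z.2)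
      ((volume.restrict (Icc 0 t₁)).prod volume) := by
  have h1 : IntegrableOn (fun z => |w z| ^ r) (Icc 0 t₁ ×ˢ tsupport ψ) :=
    hw.locallyIntegrableOn.integrableOn_compact_subset
      (prod_mono (Icc_subset_timeInterval ht) (subset_univ _)) (isCompact_Icc.prod hc)
  have h2 : IntegrableOn (fun z : ℝ × Space n => |w z| ^ r * ψ z.2) (Icc 0 t₁ ×ˢ tsupport ψ) :=
    h1.mul_continuousOn (hψ.comp continuous_snd).continuousOn (isCompact_Icc.prod hc)
  have h3 : IntegrableOn (fun z : ℝ × Space n => |w z| ^ r * ψ z.2) (Icc 0 t₁ ×ˢ univ) := by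
    refine h2.of_forall_sdiff_eq_zero (measurableSet_Icc.prod MeasurableSet.univ) ?_
    rintro ⟨s, x⟩ ⟨hs, hx⟩
    have : x ∉ tsupport ψ := fun h => hx ⟨hs.1, h⟩
    simp [image_eq_zero_of_notMem_tsupport this]
  rwa [IntegrableOn, Measure.volume_eq_prod, ← Measure.prod_restrict, Measure.restrict_univ] at h3

/-- A test function of product form, constant in time on `[0, t₁]`. -/
theorem exists_time_cutoff {T : EReal} {t₁ : ℝ} (ht : t₁ ∈ timeInterval T) :
    ∃ χ : ℝ → ℝ, ContDiff ℝ ∞ χ ∧ (∀ s ∈ Icc 0 t₁, χ =ᶠ[𝓝 s] fun _ => 1) ∧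
      ∀ ψ : Space n → ℝ, ContDiff ℝ ∞ ψ → HasCompactSupport ψ →
        IsTestFunction T (fun z => χ z.1 * ψ z.2) := by
  obtain ⟨t₂, h12, h2T⟩ := EReal.lt_iff_exists_real_btwn.1 ht.2
  obtain ⟨t₃, h23, h3T⟩ := EReal.lt_iff_exists_real_btwn.1 h2T
  have h12' : t₁ < t₂ := by exact_mod_cast h12
  have h23' : t₂ < t₃ := by exact_mod_cast h23
  have h0 : 0 < t₂ := ht.1.trans_lt h12'
  let χ : ContDiffBump (0 : ℝ) := ⟨t₂, t₃, h0, h23'⟩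
  refine ⟨χ, χ.contDiff, ?_, ?_⟩
  · intro s hs
    refine χ.eventuallyEq_one_of_mem_ball ?_
    rw [mem_ball_zero_iff, Real.norm_of_nonneg hs.1]
    exact hs.2.trans_lt h12'
  · intro ψ hψ hc
    have hsub : tsupport (fun z : ℝ × Space n => χ z.1 * ψ z.2)
        ⊆ Metric.closedBall 0 t₃ ×ˢ tsupport ψ := by
      refine closure_minimal ?_ (Metric.isClosed_closedBall.prod (isClosed_tsupport _))
      rintro ⟨s, x⟩ hz
      have hz' : χ s * ψ x ≠ 0 := hz
      refine ⟨?_, subset_tsupport _ (right_ne_zero_of_mul hz')⟩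
      have : s ∈ tsupport χ := subset_tsupport _ (left_ne_zero_of_mul hz')
      rwa [χ.tsupport_eq] at this
    refine ⟨(χ.contDiff.comp contDiff_fst).mul (hψ.comp contDiff_snd), ?_, ?_⟩
    · exact ((isCompact_closedBall _ _).prod hc).of_isClosed_subset (isClosed_tsupport _) hsub
    · rintro ⟨s, x⟩ hz
      have h4 := (hsub hz).1
      rw [mem_closedBall_zero_iff] at h4
      have h5 : s ≤ t₃ := (le_abs_self s).trans h4
      exact lt_of_le_of_lt (EReal.coe_le_coe_iff.2 h5) h3T

/-- The weak equation tested with a function of `x` only. -/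
theorem WeakEquation.velocity_identity {T : EReal} {p ε : ℝ} {b : ℝ → ℝ} {u₁ : L2 n}
    {u v : ℝ → H1 n} (h : WeakEquation T p ε b u₁ u v) {t₁ : ℝ} (ht : t₁ ∈ timeInterval T)
    {ψ : Space n → ℝ} (hψ : ContDiff ℝ ∞ ψ) (hc : HasCompactSupport ψ) :
    ∫ x, timeDeriv T u t₁ x * ψ x = ε * (∫ x, u₁ x * ψ x)
      - (∫ s in (0 : ℝ)..t₁, ∫ x, inner ℝ (weakGrad (u s) x) (gradient ψ x))
      - (∫ s in (0 : ℝ)..t₁, b s * ∫ x, timeDeriv T u s x * ψ x)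
      + ∫ s in (0 : ℝ)..t₁, ∫ x, |toL2 (v s) x| ^ p * ψ x := by
  obtain ⟨χ, -, hχ1, hχ⟩ := exists_time_cutoff (n := n) ht
  have key := h _ (hχ ψ hψ hc) t₁ ht
  -- The time cutoff equals 1 on a neighbourhood of each point of [0, t₁], so it disappears from
  -- every term and its time derivative vanishes there.
  have hone : ∀ s ∈ Icc 0 t₁, χ s = 1 := fun s hs => (hχ1 s hs).eq_of_nhds
  have e0 : ∫ x, ε * u₁ x * (χ 0 * ψ x) = ε * ∫ x, u₁ x * ψ x := by
    rw [hone 0 ⟨le_rfl, ht.1⟩, ← integral_const_mul]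
    exact integral_congr_ae (Eventually.of_forall fun x => by simp [mul_assoc])
  have e1 : ∫ x, timeDeriv T u t₁ x * (χ t₁ * ψ x) = ∫ x, timeDeriv T u t₁ x * ψ x := by
    rw [hone t₁ ⟨ht.1, le_rfl⟩]; simp
  have e2 : ∫ s in (0 : ℝ)..t₁, ∫ x, timeDeriv T u s x * deriv (fun τ => χ τ * ψ x) s = 0 := by
    rw [intervalIntegral.integral_congr (g := fun _ => (0 : ℝ))]
    · simp
    · intro s hs
      rw [uIcc_of_le ht.1] at hs
      have h0 : ∀ x, deriv (fun τ => χ τ * ψ x) s = 0 := by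
        intro x
        have : (fun τ => χ τ * ψ x) =ᶠ[𝓝 s] fun _ => ψ x := by
          filter_upwards [hχ1 s hs] with τ hτ
          rw [hτ, one_mul]
        rw [this.deriv_eq, deriv_const]
      simp [h0]
  have e3 : ∫ s in (0 : ℝ)..t₁, ∫ x, inner ℝ (weakGrad (u s) x)
        (gradient (fun y => χ s * ψ y) x)
      = ∫ s in (0 : ℝ)..t₁, ∫ x, inner ℝ (weakGrad (u s) x) (gradient ψ x) := by
    refine intervalIntegral.integral_congr fun s hs => ?_
    rw [uIcc_of_le ht.1] at hs
    simp only [hone s hs, one_mul]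
  have e4 : ∫ s in (0 : ℝ)..t₁, ∫ x, b s * timeDeriv T u s x * (χ s * ψ x)
      = ∫ s in (0 : ℝ)..t₁, b s * ∫ x, timeDeriv T u s x * ψ x := by
    refine intervalIntegral.integral_congr fun s hs => ?_
    rw [uIcc_of_le ht.1] at hs
    simp only [hone s hs, one_mul, mul_assoc, integral_const_mul]
  have e5 : ∫ s in (0 : ℝ)..t₁, ∫ x, |toL2 (v s) x| ^ p * (χ s * ψ x)
      = ∫ s in (0 : ℝ)..t₁, ∫ x, |toL2 (v s) x| ^ p * ψ x := by
    refine intervalIntegral.integral_congr fun s hs => ?_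
    rw [uIcc_of_le ht.1] at hs
    simp only [hone s hs, one_mul]
  rw [e0, e1, e2, e3, e4, e5] at key
  linarith

theorem integral_mul_planeWave_cutoff {θ : Space n} {l ρ R : ℝ} {ψ : Space n → ℝ}
    (h : ∀ x, ‖x‖ ≤ ρ → ψ x = Real.exp (l * inner ℝ x θ)) (hR : R ≤ ρ) {f : Space n → ℝ}
    (hf : ∀ᵐ x, R < ‖x‖ → f x = 0) :
    ∫ x, f x * ψ x = ∫ x, f x * Real.exp (l * inner ℝ x θ) := by
  refine integral_congr_ae ?_
  filter_upwards [hf] with x hx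
  rcases lt_or_ge R ‖x‖ with h1 | h1
  · simp [hx h1]
  · rw [h x (h1.trans hR)]

set_option maxHeartbeats 1000000 in
/-- The pairing of a solution with the plane wave `e^{l⟨x, θ⟩}` dominates, up to the factor
`e^{-∫ b}`, Duhamel's formula for the undamped equation `U'' = l² U + h`. -/
theorem planeWave_lower_bound {T : EReal} {p q ε R : ℝ} {b : ℝ → ℝ} {u₀ : H1 n} {u₁ : L2 n}
    {u v : ℝ → H1 n} {w : ℝ × Space n → ℝ} (hp : 0 < p) (hε : 0 ≤ ε) (hR : 0 < R) (hT : 0 < T)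
    (hb : ContinuousOn b (Ici 0)) (hbi : IntegrableOn b (Ici 0)) (hb0 : ∀ t, 0 ≤ t → 0 ≤ b t)
    (hu₀ : NonnegSupportedInBall R (toL2 u₀)) (hu₁ : NonnegSupportedInBall R u₁)
    (hu : MemEnergyClass T q u) (h0 : u 0 = ε • u₀) (heq : WeakEquation T p ε b u₁ u v)
    (hsu : SupportedInCone T R u) (hsv : SupportedInCone T R v) (hw : IsRepresentative T p v w)
    {t₁ : ℝ} (ht : t₁ ∈ timeInterval T) {θ : Space n} (hθ : ‖θ‖ = 1) {l : ℝ} (hl : 0 < l) :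
    ENNReal.ofReal (ε * ((∫ x, toL2 u₀ x * Real.exp (l * inner ℝ x θ)) * Real.cosh (l * t₁)
        + (∫ x, u₁ x * Real.exp (l * inner ℝ x θ)) * (Real.sinh (l * t₁) / l)))
      + ∫⁻ s in Icc 0 t₁, (∫⁻ x, ENNReal.ofReal (|w (s, x)| ^ p * Real.exp (l * inner ℝ x θ)))
          * ENNReal.ofReal (Real.sinh (l * (t₁ - s)) / l)
      ≤ ENNReal.ofReal (Real.exp (∫ s in Ici 0, b s))
          * ∫⁻ x, ‖toL2 (u t₁) x‖ₑ * ENNReal.ofReal (Real.exp (l * inner ℝ x θ)) := by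
  have ht0 := ht.1
  -- Up to time t₁ the solution lives in |x| ≤ t₁ + R; the extra 1 keeps the cutoff equal to the
  -- plane wave on a neighbourhood of that ball.
  obtain ⟨ψ, hψ, hc, hψ0, hψle, hψe⟩ :=
    exists_planeWave_cutoff θ l (show 0 < t₁ + R + 1 by linarith)
  have hψm : MemLp ψ 2 volume := hψ.continuous.memLp_of_hasCompactSupport hc
  let U : ℝ → ℝ := fun s => ∫ x, toL2 (u s) x * ψ x
  let V : ℝ → ℝ := fun s => ∫ x, timeDeriv T u s x * ψ x
  let h : ℝ → ℝ := fun s => ∫ x, |toL2 (v s) x| ^ p * ψ x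
  have hUL : U = fun s => pairing ψ hψm (toL2 (u s)) := funext fun s => (pairing_apply _ _).symm
  have hVL : V = fun s => pairing ψ hψm (timeDeriv T u s) :=
    funext fun s => (pairing_apply _ _).symm
  have hud := uniqueDiffOn_timeInterval hT
  have hIcc := Icc_subset_timeInterval ht
  have hUder : ∀ s ∈ timeInterval T, HasDerivWithinAt U (V s) (timeInterval T) s := by
    intro s hs
    have h1 := ((hu.contDiffOn_L2.differentiableOn one_ne_zero) s hs).hasDerivWithinAt
    rw [hUL, hVL]
    exact (pairing ψ hψm).hasFDerivAt.comp_hasDerivWithinAt s h1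
  have hVc : ContinuousOn V (timeInterval T) := by
    rw [hVL]
    exact (pairing ψ hψm).continuous.comp_continuousOn
      (hu.contDiffOn_L2.continuousOn_derivWithin hud le_rfl)
  have hh0 : ∀ s, 0 ≤ h s := fun s =>
    integral_nonneg fun x => mul_nonneg (Real.rpow_nonneg (abs_nonneg _) _) (hψ0 x)
  -- the source term
  have hprod := hw.integrable_mul ht hψ.continuous hc
  have hwv : ∀ᵐ s ∂(volume.restrict (Icc 0 t₁)), ∀ᵐ x, w (s, x) = toL2 (v s) x :=
    ae_mono (Measure.restrict_mono hIcc le_rfl) hw.ae_eq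
  have hhae : ∀ᵐ s ∂(volume.restrict (Icc 0 t₁)), ∫ x, |w (s, x)| ^ p * ψ x = h s := by
    filter_upwards [hwv] with s hs
    refine integral_congr_ae ?_
    filter_upwards [hs] with x hx
    rw [hx]
  have hhint : IntegrableOn h (Icc 0 t₁) := by
    refine hprod.integral_prod_left.congr ?_
    filter_upwards [hhae] with s hs
    exact hs
  have hhII : IntervalIntegrable h volume 0 t₁ :=
    (intervalIntegrable_iff_integrableOn_Icc_of_le ht0).2 hhint
  have hhlint : ∀ᵐ s ∂(volume.restrict (Icc 0 t₁)), ENNReal.ofReal (h s)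
      = ∫⁻ x, ENNReal.ofReal (|w (s, x)| ^ p * Real.exp (l * inner ℝ x θ)) := by
    filter_upwards [hhae, hwv, hprod.prod_right_ae, ae_restrict_mem measurableSet_Icc]
      with s h1 h2 h3 h4
    rw [← h1, ofReal_integral_eq_lintegral_ofReal h3 (Eventually.of_forall fun x =>
      mul_nonneg (Real.rpow_nonneg (abs_nonneg _) _) (hψ0 x))]
    refine lintegral_congr_ae ?_
    filter_upwards [h2, hsv s (hIcc h4)] with x h5 h6
    rcases lt_or_ge (s + R) ‖x‖ with h7 | h7
    · simp [h5, h6 h7, Real.zero_rpow hp.ne']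
    · rw [hψe x (by linarith [h4.2])]
  -- extension of the coefficients to the line
  let pr : ℝ → ℝ := fun s => max 0 (min s t₁)
  have hprc : Continuous pr := by fun_prop
  have hprm : ∀ s, pr s ∈ Icc 0 t₁ := fun s => ⟨le_max_left _ _, max_le ht0 (min_le_right _ _)⟩
  have hpre : ∀ s ∈ Icc 0 t₁, pr s = s := fun s hs => by simp [pr, hs.1, hs.2]
  have hVec : Continuous (fun s => V (pr s)) :=
    hVc.comp_continuous hprc fun s => hIcc (hprm s)
  have hbec : Continuous (fun s => b (pr s)) := hb.comp_continuous hprc fun s => (hprm s).1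
  let Ue : ℝ → ℝ := fun t => U 0 + ∫ s in (0 : ℝ)..t, V (pr s)
  have hUed : ∀ t, HasDerivAt Ue (V (pr t)) t := fun t =>
    (hasDerivAt_integral_of_continuous hVec t).const_add _
  have hUeU : ∀ t ∈ Icc 0 t₁, Ue t = U t := by
    intro t htI
    have hsub : Icc 0 t ⊆ timeInterval T := (Icc_subset_Icc le_rfl htI.2).trans hIcc
    have h1 : ∫ s in (0 : ℝ)..t, V s = U t - U 0 := by
      refine intervalIntegral.integral_eq_sub_of_hasDeriv_right_of_le htI.1
        (fun s hs => ((hUder s (hsub hs)).continuousWithinAt).mono hsub) (fun s hs => ?_)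
        ((hVc.mono hsub).intervalIntegrable_of_Icc htI.1)
      refine (hUder s (hsub ⟨hs.1.le, hs.2.le⟩)).mono_of_mem_nhdsWithin ?_
      exact mem_of_superset (Ioc_mem_nhdsGT hs.2)
        (fun r hr => hsub ⟨hs.1.le.trans hr.1.le, hr.2⟩)
    have h2 : ∫ s in (0 : ℝ)..t, V (pr s) = ∫ s in (0 : ℝ)..t, V s := by
      refine intervalIntegral.integral_congr fun s hs => ?_
      rw [uIcc_of_le htI.1] at hs
      simp only [hpre s ⟨hs.1, hs.2.trans htI.2⟩]
    simp only [Ue]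
    rw [h2, h1]; ring
  have hVeq : ∀ t ∈ Icc 0 t₁, V (pr t) = ε * (∫ x, u₁ x * ψ x)
      + l ^ 2 * (∫ s in (0 : ℝ)..t, Ue s)
      - (∫ s in (0 : ℝ)..t, b (pr s) * V (pr s)) + ∫ s in (0 : ℝ)..t, h s := by
    intro t htI
    have key := heq.velocity_identity (hIcc htI) hψ hc
    have e1 : ∫ s in (0 : ℝ)..t, ∫ x, inner ℝ (weakGrad (u s) x) (gradient ψ x)
        = -(l ^ 2 * ∫ s in (0 : ℝ)..t, Ue s) := by
      rw [← intervalIntegral.integral_const_mul, ← intervalIntegral.integral_neg]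
      refine intervalIntegral.integral_congr fun s hs => ?_
      rw [uIcc_of_le htI.1] at hs
      have hs' : s ∈ Icc 0 t₁ := ⟨hs.1, hs.2.trans htI.2⟩
      rw [hUeU s hs']
      exact integral_inner_weakGrad_planeWave hθ hψ hc hψe (by linarith [hs'.2]) (u s)
        (hsu s (hIcc hs'))
    have e2 : ∫ s in (0 : ℝ)..t, b (pr s) * V (pr s)
        = ∫ s in (0 : ℝ)..t, b s * ∫ x, timeDeriv T u s x * ψ x := by
      refine intervalIntegral.integral_congr fun s hs => ?_
      rw [uIcc_of_le htI.1] at hs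
      simp only [hpre s ⟨hs.1, hs.2.trans htI.2⟩, V]
    rw [hpre t htI, e2]
    rw [e1] at key
    simp only [V, h]
    linarith
  have hU0 : Ue 0 = ε * ∫ x, toL2 u₀ x * ψ x := by
    have h1 : Ue 0 = U 0 := hUeU 0 ⟨le_rfl, ht0⟩
    have h2 : toL2 (ε • u₀) = ε • toL2 u₀ := rfl
    rw [h1, hUL]
    simp only [h0, h2, map_smul, pairing_apply, smul_eq_mul]
  have hnn : ∀ f : L2 n, NonnegSupportedInBall R f → 0 ≤ ε * ∫ x, f x * ψ x := fun f hf =>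
    mul_nonneg hε (integral_nonneg_of_ae (by
      filter_upwards [hf.1] with x hx
      exact mul_nonneg hx (hψ0 x)))
  have main := damped_duhamel_lower_bound ht0 hl hbec hVec (fun s => hb0 _ (hprm s).1) hUed hhII
    hh0 hVeq (by rw [hU0]; exact hnn _ hu₀) (hnn _ hu₁)
  rw [hUeU t₁ ⟨ht0, le_rfl⟩, hU0, integral_mul_planeWave_cutoff hψe (by linarith) hu₀.2,
    integral_mul_planeWave_cutoff hψe (by linarith) hu₁.2] at main
  -- upper bound of the right-hand side
  have hUabs : ENNReal.ofReal (U t₁)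
      ≤ ∫⁻ x, ‖toL2 (u t₁) x‖ₑ * ENNReal.ofReal (Real.exp (l * inner ℝ x θ)) := by
    calc ENNReal.ofReal (U t₁) ≤ ‖U t₁‖ₑ := Real.ofReal_le_enorm _
      _ ≤ ∫⁻ x, ‖toL2 (u t₁) x * ψ x‖ₑ := enorm_integral_le_lintegral_enorm _
      _ ≤ _ := by
        refine lintegral_mono fun x => ?_
        rw [enorm_mul]
        gcongr
        rw [Real.enorm_of_nonneg (hψ0 x)]
        exact ENNReal.ofReal_le_ofReal (hψle x)
  have hbint : ∫ s in (0 : ℝ)..t₁, b (pr s) ≤ ∫ s in Ici 0, b s := by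
    have e1 : ∫ s in (0 : ℝ)..t₁, b (pr s) = ∫ s in Ioc 0 t₁, b s := by
      rw [intervalIntegral.integral_of_le ht0]
      refine setIntegral_congr_fun measurableSet_Ioc fun s hs => ?_
      simp only [hpre s ⟨hs.1.le, hs.2⟩]
    rw [e1]
    refine setIntegral_mono_set hbi ?_ (LE.le.eventuallyLE fun s hs => hs.1.le)
    exact (ae_restrict_iff' measurableSet_Ici).2 (Eventually.of_forall fun s hs => hb0 s hs)
  have hsrc : ∫⁻ s in Icc 0 t₁, (∫⁻ x, ENNReal.ofReal
        (|w (s, x)| ^ p * Real.exp (l * inner ℝ x θ))) * ENNReal.ofReal (Real.sinh (l * (t₁ - s)) / l)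
      = ENNReal.ofReal (∫ s in (0 : ℝ)..t₁, h s * (Real.sinh (l * (t₁ - s)) / l)) := by
    have hy : Continuous fun s => Real.sinh (l * (t₁ - s)) / l := by fun_prop
    have hI : IntegrableOn (fun s => h s * (Real.sinh (l * (t₁ - s)) / l)) (Icc 0 t₁) :=
      hhint.mul_continuousOn hy.continuousOn isCompact_Icc
    rw [intervalIntegral.integral_of_le ht0, ← integral_Icc_eq_integral_Ioc,
      ofReal_integral_eq_lintegral_ofReal hI]
    · refine lintegral_congr_ae ?_
      filter_upwards [hhlint] with s hs
      rw [← hs, ENNReal.ofReal_mul (hh0 s)]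
    · refine (ae_restrict_iff' measurableSet_Icc).2 (Eventually.of_forall fun s hs => ?_)
      exact mul_nonneg (hh0 s)
        (div_nonneg (Real.sinh_nonneg_iff.2 (mul_nonneg hl.le (sub_nonneg.2 hs.2))) hl.le)
  have hUt : 0 ≤ U t₁ := by
    have := nonneg_of_damped_integral_equation ht0 hbec hVec (fun s => hb0 _ (hprm s).1) hUed hhII
      hh0 hVeq (by rw [hU0]; exact hnn _ hu₀) (hnn _ hu₁) t₁ ⟨ht0, le_rfl⟩
    rwa [hUeU t₁ ⟨ht0, le_rfl⟩] at this
  rw [hsrc]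
  have hsrc0 : 0 ≤ ∫ s in (0 : ℝ)..t₁, h s * (Real.sinh (l * (t₁ - s)) / l) :=
    intervalIntegral.integral_nonneg ht0 fun s hs => mul_nonneg (hh0 s)
      (div_nonneg (Real.sinh_nonneg_iff.2 (mul_nonneg hl.le (sub_nonneg.2 hs.2))) hl.le)
  have hdat0 : ∀ f : L2 n, NonnegSupportedInBall R f →
      0 ≤ ∫ x, f x * Real.exp (l * inner ℝ x θ) := fun f hf => integral_nonneg_of_ae (by
    filter_upwards [hf.1] with x hx
    exact mul_nonneg hx (Real.exp_pos _).le)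
  rw [← ENNReal.ofReal_add _ hsrc0]
  · refine le_trans ?_ (mul_le_mul_right hUabs _)
    rw [← ENNReal.ofReal_mul (Real.exp_pos _).le]
    refine ENNReal.ofReal_le_ofReal ?_
    have h1 := mul_le_mul_of_nonneg_right (Real.exp_le_exp.2 hbint) hUt
    refine le_trans (le_of_eq ?_) (main.trans h1)
    ring
  · exact mul_nonneg hε (add_nonneg (mul_nonneg (hdat0 _ hu₀) (Real.cosh_pos _).le)
      (mul_nonneg (hdat0 _ hu₁) (div_nonneg (Real.sinh_nonneg_iff.2 (mul_nonneg hl.le ht0)) hl.le)))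

/-! ### Elementary integrals and inequalities on the half-line -/

section OneDimensional

theorem lintegral_Ioi_rpow {s c : ℝ} (hs : s < -1) (hc : 0 < c) :
    ∫⁻ z in Ioi c, ENNReal.ofReal (z ^ s) = ENNReal.ofReal (c ^ (s + 1) / (-(s + 1))) := by
  rw [← ofReal_integral_eq_lintegral_ofReal (integrableOn_Ioi_rpow_of_lt hs hc),
    integral_Ioi_rpow_of_lt hs hc, neg_div, div_neg]
  exact (ae_restrict_iff' measurableSet_Ioi).2
    (Eventually.of_forall fun z hz => Real.rpow_nonneg (hc.trans hz).le _)

theorem lintegral_Ioi_add_rpow {s k y : ℝ} (hs : s < -1) (hk : 0 < k + y) :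
    ∫⁻ z in Ioi y, ENNReal.ofReal ((k + z) ^ s)
      = ENNReal.ofReal ((k + y) ^ (s + 1) / (-(s + 1))) := by
  rw [← lintegral_Ioi_rpow hs hk, ← lintegral_indicator measurableSet_Ioi,
    ← lintegral_indicator measurableSet_Ioi,
    ← lintegral_add_left_eq_self ((Ioi (k + y)).indicator fun z => ENNReal.ofReal (z ^ s)) k]
  refine lintegral_congr fun z => ?_
  simp only [indicator, mem_Ioi, add_lt_add_iff_left]

theorem lintegral_rpow_mul_exp_neg {a k : ℝ} (ha : -1 < a) (hk : 0 < k) :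
    ∫⁻ l in Ioi (0 : ℝ), ENNReal.ofReal (l ^ a * Real.exp (-(k * l)))
      = ENNReal.ofReal (Real.Gamma (a + 1) * k ^ (-(a + 1))) := by
  have h1 := Real.integral_rpow_mul_exp_neg_mul_Ioi (a := a + 1) (r := k) (by linarith) hk
  rw [add_sub_cancel_right] at h1
  have h2 : (1 / k) ^ (a + 1) * Real.Gamma (a + 1) = Real.Gamma (a + 1) * k ^ (-(a + 1)) := by
    rw [one_div, Real.inv_rpow hk.le, Real.rpow_neg hk.le, mul_comm]
  have h3 : Integrable (fun l : ℝ => l ^ a * Real.exp (-(k * l))) (volume.restrict (Ioi 0)) := by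
    refine Integrable.of_integral_ne_zero ?_
    rw [h1, h2]
    exact (mul_pos (Real.Gamma_pos_of_pos (by linarith)) (Real.rpow_pos_of_pos hk _)).ne'
  rw [← h2, ← h1, ofReal_integral_eq_lintegral_ofReal h3]
  exact (ae_restrict_iff' measurableSet_Ioi).2
    (Eventually.of_forall fun z hz => mul_nonneg (Real.rpow_nonneg (le_of_lt hz) _)
      (Real.exp_pos _).le)

theorem one_sub_exp_neg_ge {y : ℝ} (hy : 0 ≤ y) : y / (1 + y) ≤ 1 - Real.exp (-y) := by
  have h1 : 1 + y ≤ Real.exp y := by linarith [Real.add_one_le_exp y]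
  have h2 : Real.exp (-y) ≤ (1 + y)⁻¹ := by
    rw [Real.exp_neg]
    exact inv_anti₀ (by linarith) h1
  have h3 : y / (1 + y) = 1 - (1 + y)⁻¹ := by field_simp; ring
  linarith

end OneDimensional

/-! ### The kernel obtained by superposing plane waves over directions and frequencies -/

/-- The unit vector in the direction of `ξ`. -/
noncomputable def dir (ξ : Space n) : Space n := ‖ξ‖⁻¹ • ξ

theorem norm_dir {ξ : Space n} (h : ξ ≠ 0) : ‖dir ξ‖ = 1 := by
  rw [dir, norm_smul, norm_inv, norm_norm, inv_mul_cancel₀ (norm_ne_zero_iff.2 h)]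

theorem norm_dir_le (ξ : Space n) : ‖dir ξ‖ ≤ 1 := by
  by_cases h : ξ = 0
  · simp [h, dir]
  · exact (norm_dir h).le

theorem dir_neg (ξ : Space n) : dir (-ξ) = -dir ξ := by simp [dir]

theorem norm_smul_dir (ξ : Space n) : ‖ξ‖ • dir ξ = ξ := by
  by_cases h : ξ = 0
  · simp [h]
  · rw [dir, smul_smul, mul_inv_cancel₀ (norm_ne_zero_iff.2 h), one_smul]

@[fun_prop]
theorem measurable_dir : Measurable (dir : Space n → Space n) := by
  unfold dir; fun_prop

/-- Averaging over the sphere is done by averaging `dir ξ` over the unit ball; the point 0, where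
`dir` is not a unit vector, is negligible. -/
theorem ae_ne_zero (hn : 2 ≤ n) : ∀ᵐ ξ ∂(volume.restrict (ball (0 : Space n) 1)), ξ ≠ 0 := by
  have : Nonempty (Fin n) := ⟨⟨0, by omega⟩⟩
  exact ae_restrict_of_ae (Measure.ae_ne volume 0)

/-- The part of the unit ball in a cone of aperture `ρ` is covered by balls of radius `2ρ` along
the axis, hence has volume `O(ρ^{n-1})`. -/
theorem volume_cap_le (hn : 2 ≤ n) {e : Space n} (he : ‖e‖ = 1) {ρ : ℝ} (hρ : 0 < ρ) :
    volume (ball (0 : Space n) 1 ∩ {ξ | ‖dir ξ - e‖ ≤ ρ})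
      ≤ ENNReal.ofReal (3 * 2 ^ n * ρ ^ (n - 1)) * volume (ball (0 : Space n) 1) := by
  have hne : Nonempty (Fin n) := ⟨⟨0, by omega⟩⟩
  rcases le_or_gt 1 ρ with h1 | h1
  · refine (measure_mono inter_subset_left).trans ?_
    refine le_mul_of_one_le_left' ?_
    rw [ENNReal.one_le_ofReal]
    have h2 : (1 : ℝ) ≤ ρ ^ (n - 1) := one_le_pow₀ h1
    have h3 : (1 : ℝ) ≤ 2 ^ n := one_le_pow₀ (by norm_num)
    nlinarith
  · set m : ℕ := ⌈ρ⁻¹⌉₊ with hm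
    have hmpos : 0 < m := Nat.ceil_pos.2 (inv_pos.2 hρ)
    have hm0 : (0 : ℝ) < m := by exact_mod_cast hmpos
    have hminv : ρ⁻¹ ≤ m := Nat.le_ceil _
    have hmle : (m : ℝ) < ρ⁻¹ + 1 := Nat.ceil_lt_add_one (inv_pos.2 hρ).le
    have hmρ : (1 : ℝ) / m ≤ ρ := by
      rw [div_le_iff₀ hm0]
      have := mul_le_mul_of_nonneg_left hminv hρ.le
      rwa [mul_inv_cancel₀ hρ.ne'] at this
    have hcov : ball (0 : Space n) 1 ∩ {ξ | ‖dir ξ - e‖ ≤ ρ}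
        ⊆ ⋃ i ∈ Finset.range (m + 1), closedBall (((i : ℝ) / m) • e) (2 * ρ) := by
      rintro ξ ⟨hξ1, hξ2⟩
      rw [mem_ball_zero_iff] at hξ1
      have h0 : 0 ≤ (m : ℝ) * ‖ξ‖ := by positivity
      refine mem_biUnion (x := ⌊(m : ℝ) * ‖ξ‖⌋₊) ?_ ?_
      · have : ⌊(m : ℝ) * ‖ξ‖⌋₊ ≤ m := Nat.floor_le_of_le (by nlinarith)
        simp only [Finset.coe_range, mem_Iio]; omega
      · have hf1 := Nat.floor_le h0
        have hf2 := Nat.lt_floor_add_one ((m : ℝ) * ‖ξ‖)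
        rw [mem_closedBall, dist_eq_norm]
        have e1 : ξ - ((⌊(m : ℝ) * ‖ξ‖⌋₊ : ℝ) / m) • e
            = ‖ξ‖ • (dir ξ - e) + (‖ξ‖ - (⌊(m : ℝ) * ‖ξ‖⌋₊ : ℝ) / m) • e := by
          rw [smul_sub, sub_smul, norm_smul_dir]; abel
        have h5 : (⌊(m : ℝ) * ‖ξ‖⌋₊ : ℝ) / m ≤ ‖ξ‖ := by
          rw [div_le_iff₀ hm0]; linarith
        have h6 : ‖ξ‖ - (⌊(m : ℝ) * ‖ξ‖⌋₊ : ℝ) / m ≤ 1 / m := by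
          rw [sub_le_iff_le_add, ← add_div, le_div_iff₀ hm0]; linarith
        rw [e1]
        refine (norm_add_le _ _).trans ?_
        rw [norm_smul, norm_smul, he, mul_one, norm_norm, Real.norm_of_nonneg (by linarith)]
        have h7 : ‖ξ‖ * ‖dir ξ - e‖ ≤ 1 * ρ :=
          mul_le_mul hξ1.le hξ2 (norm_nonneg _) (by norm_num)
        linarith
    calc volume (ball (0 : Space n) 1 ∩ {ξ | ‖dir ξ - e‖ ≤ ρ})
        ≤ ∑ i ∈ Finset.range (m + 1), volume (closedBall (((i : ℝ) / m) • e) (2 * ρ)) :=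
          (measure_mono hcov).trans (measure_biUnion_finset_le _ _)
      _ = ENNReal.ofReal ((m + 1) * (2 * ρ) ^ n) * volume (ball (0 : Space n) 1) := by
          rw [Finset.sum_congr rfl fun i _ => Measure.addHaar_closedBall volume _ (by positivity)]
          rw [Finset.sum_const, Finset.card_range, nsmul_eq_mul, finrank_euclideanSpace_fin,
            ← mul_assoc, ENNReal.ofReal_mul (by positivity)]
          congr 2
          rw [← Nat.cast_one (R := ℝ), ← Nat.cast_add, ENNReal.ofReal_natCast]
      _ ≤ _ := by
          gcongr ENNReal.ofReal ?_ * _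
          have e2 : (2 * ρ) ^ n = 2 ^ n * ρ ^ (n - 1) * ρ := by
            rw [mul_pow, mul_assoc, ← pow_succ, Nat.sub_add_cancel (by omega)]
          rw [e2]
          have h8 : ((m : ℝ) + 1) * ρ ≤ 3 := by
            have : (ρ⁻¹ + 1 + 1) * ρ = 1 + 2 * ρ := by field_simp; ring
            nlinarith
          have h9 : (0 : ℝ) ≤ 2 ^ n * ρ ^ (n - 1) := by positivity
          nlinarith

/-- Polarization for two unit vectors. It shows that T - ⟨x,θ⟩ is as small as T - |x| only when θ
lies in a cap of small aperture about the direction of x. -/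
theorem sub_inner_dir_eq {x ξ : Space n} (hx : x ≠ 0) (hξ : ξ ≠ 0) (T : ℝ) :
    T - inner ℝ x (dir ξ) = (T - ‖x‖) + ‖x‖ * ‖dir ξ - dir x‖ ^ 2 / 2 := by
  rw [norm_sub_sq_real, norm_dir hx, norm_dir hξ]
  have : inner ℝ x (dir ξ) = ‖x‖ * inner ℝ (dir ξ) (dir x) := by
    rw [real_inner_comm, ← inner_smul_right, norm_smul_dir]
  rw [this]; ring

/-- The average over all directions of `(T - ⟨x, θ⟩)^{-a-1}`, for `x` away from the origin. -/
theorem lintegral_sub_inner_dir_rpow_le (hn : 2 ≤ n) {a : ℝ} (ha : ((n : ℝ) - 1) / 2 - 1 < a) :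
    ∃ C : ℝ, 0 < C ∧ ∀ (T : ℝ) (x : Space n), x ≠ 0 → ‖x‖ < T →
      ∫⁻ ξ in ball (0 : Space n) 1, ENNReal.ofReal ((T - inner ℝ x (dir ξ)) ^ (-(a + 1)))
        ≤ ENNReal.ofReal (C * ‖x‖ ^ (-(((n : ℝ) - 1) / 2))
            * (T - ‖x‖) ^ (((n : ℝ) - 1) / 2 - 1 - a)) := by
  have hn' : (2 : ℝ) ≤ n := by exact_mod_cast hn
  set N : ℝ := ((n : ℝ) - 1) / 2 with hN
  have ha1 : 0 < a + 1 := by linarith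
  have hc : 0 < a + 1 - N := by linarith
  have hvol : volume (ball (0 : Space n) 1) ≠ ⊤ := measure_ball_lt_top.ne
  have hvol0 : 0 < volume.real (ball (0 : Space n) 1) :=
    ENNReal.toReal_pos (measure_ball_pos _ _ one_pos).ne' hvol
  set C₁ : ℝ := 3 * 2 ^ n * volume.real (ball (0 : Space n) 1) with hC₁
  have hC₁0 : 0 < C₁ := by positivity
  refine ⟨(a + 1) * C₁ * 2 ^ N / (a + 1 - N), by positivity, ?_⟩
  intro T x hx hxT
  have hr : 0 < ‖x‖ := norm_pos_iff.2 hx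
  set r := ‖x‖ with hr_def
  set k := T - r with hk_def
  have hk : 0 < k := by simp only [hk_def]; linarith
  set y : Space n → ℝ := fun ξ => r * ‖dir ξ - dir x‖ ^ 2 / 2 with hy
  have hym : Measurable y := by fun_prop
  have hy0 : ∀ ξ, 0 ≤ y ξ := fun ξ => by simp only [hy]; positivity
  -- Layer-cake formula: (k+y)^{-(a+1)} = ∫_y^∞ (a+1)(k+z)^{-a-2} dz. After exchanging the
  -- integrals, only the volume of {y < z} matters.
  have step1 : ∫⁻ ξ in ball (0 : Space n) 1,
        ENNReal.ofReal ((T - inner ℝ x (dir ξ)) ^ (-(a + 1)))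
      = ∫⁻ ξ in ball (0 : Space n) 1, ∫⁻ z in Ioi (0 : ℝ),
        (Ioi (y ξ)).indicator (fun z => ENNReal.ofReal ((a + 1) * (k + z) ^ (-a - 2))) z := by
    refine lintegral_congr_ae ?_
    filter_upwards [ae_ne_zero hn] with ξ hξ
    rw [lintegral_indicator measurableSet_Ioi, Measure.restrict_restrict measurableSet_Ioi,
      Ioi_inter_Ioi, sup_eq_left.2 (hy0 ξ)]
    simp_rw [ENNReal.ofReal_mul ha1.le]
    rw [lintegral_const_mul _ (by fun_prop),
      lintegral_Ioi_add_rpow (by linarith) (by linarith [hy0 ξ]), ← ENNReal.ofReal_mul ha1.le,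
      sub_inner_dir_eq hx hξ]
    congr 1
    rw [show -a - 2 + 1 = -(a + 1) by ring]
    field_simp
    simp only [hy, hk_def, hr_def]
    ring_nf
  have hmeas : Measurable (fun q : Space n × ℝ =>
      (Ioi (y q.1)).indicator (fun z => ENNReal.ofReal ((a + 1) * (k + z) ^ (-a - 2))) q.2) := by
    have : (fun q : Space n × ℝ =>
        (Ioi (y q.1)).indicator (fun z => ENNReal.ofReal ((a + 1) * (k + z) ^ (-a - 2))) q.2)
        = {q : Space n × ℝ | y q.1 < q.2}.indicator
          (fun q => ENNReal.ofReal ((a + 1) * (k + q.2) ^ (-a - 2))) := by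
      ext q; simp [indicator]
    rw [this]
    exact Measurable.indicator (by fun_prop)
      (measurableSet_lt (hym.comp measurable_fst) measurable_snd)
  rw [step1, lintegral_lintegral_swap hmeas.aemeasurable]
  have step2 : ∀ z ∈ Ioi (0 : ℝ), ∫⁻ ξ in ball (0 : Space n) 1,
        (Ioi (y ξ)).indicator (fun z => ENNReal.ofReal ((a + 1) * (k + z) ^ (-a - 2))) z
      ≤ ENNReal.ofReal ((a + 1) * C₁ * 2 ^ N * r ^ (-N))
          * ENNReal.ofReal ((k + z) ^ (N - a - 2)) := by
    intro z hz
    have hz0 : 0 < z := hz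
    have e1 : ∀ ξ, (Ioi (y ξ)).indicator
          (fun z => ENNReal.ofReal ((a + 1) * (k + z) ^ (-a - 2))) z
        = {ξ | y ξ < z}.indicator
          (fun _ => ENNReal.ofReal ((a + 1) * (k + z) ^ (-a - 2))) ξ := by
      intro ξ; simp [indicator]
    simp_rw [e1]
    rw [lintegral_indicator_const (measurableSet_lt hym measurable_const)]
    -- The condition r‖θ-ω‖²/2 < z puts θ within √(2z/r) of ω, the direction of x. The cap estimate
    -- has exponent n-1, so the volume is O((z/r)^N). What remains is ∫ (k+z)^{N-a-2} dz, convergent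
    -- because a > N-1.
    set ρ : ℝ := Real.sqrt (2 * z / r) with hρ
    have hρ0 : 0 < ρ := Real.sqrt_pos.2 (by positivity)
    have h1 : volume.restrict (ball (0 : Space n) 1) {ξ | y ξ < z}
        ≤ ENNReal.ofReal (C₁ * (2 * z / r) ^ N) := by
      rw [Measure.restrict_apply (measurableSet_lt hym measurable_const), inter_comm]
      refine (measure_mono (inter_subset_inter_right _ fun ξ hξ => ?_)).trans
        ((volume_cap_le hn (norm_dir hx) hρ0).trans (le_of_eq ?_))
      · have hξ' : r * ‖dir ξ - dir x‖ ^ 2 / 2 < z := hξ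
        refine Real.le_sqrt_of_sq_le ?_
        rw [le_div_iff₀ hr]; linarith
      · have h2 : ρ ^ (n - 1) = (2 * z / r) ^ N := by
          rw [hρ, Real.sqrt_eq_rpow, ← Real.rpow_natCast, ← Real.rpow_mul (by positivity),
            Nat.cast_sub (by omega), hN]
          congr 1; push_cast; ring
        rw [h2, ← ENNReal.ofReal_toReal hvol, ← ENNReal.ofReal_mul (by positivity)]
        congr 1
        simp only [hC₁, Measure.real]; ring
    refine (mul_le_mul_right h1 _).trans ?_
    rw [← ENNReal.ofReal_mul (by positivity), ← ENNReal.ofReal_mul (by positivity)]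
    refine ENNReal.ofReal_le_ofReal ?_
    have hN0 : 0 ≤ N := by simp only [hN]; linarith
    have h3 : (2 * z / r) ^ N ≤ 2 ^ N * r ^ (-N) * (k + z) ^ N := by
      rw [Real.div_rpow (by positivity) hr.le, Real.mul_rpow (by norm_num) hz0.le,
        Real.rpow_neg hr.le, div_eq_mul_inv, mul_right_comm]
      gcongr
      linarith
    have h4 : (k + z) ^ (N - a - 2) = (k + z) ^ (-a - 2) * (k + z) ^ N := by
      rw [← Real.rpow_add (by linarith)]; congr 1; ring
    rw [h4]
    have h5 : 0 ≤ (a + 1) * (k + z) ^ (-a - 2) * C₁ := by positivity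
    nlinarith [mul_le_mul_of_nonneg_left h3 h5]
  refine (setLIntegral_mono' measurableSet_Ioi step2).trans ?_
  rw [lintegral_const_mul _ (by fun_prop), lintegral_Ioi_add_rpow (by linarith) (by simpa using hk),
    ← ENNReal.ofReal_mul (by positivity)]
  refine ENNReal.ofReal_le_ofReal (le_of_eq ?_)
  rw [add_zero, show N - a - 2 + 1 = N - 1 - a by ring, show -(N - 1 - a) = a + 1 - N by ring]
  ring

/-- Superposition of the plane waves `e^{l⟨x, θ⟩}` over all directions and frequencies, with
weight `l^a e^{-lT}`. -/
noncomputable def waveKernel (a T : ℝ) (x : Space n) : ENNReal :=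
  ∫⁻ ξ in ball (0 : Space n) 1, ∫⁻ l in Ioi (0 : ℝ),
    ENNReal.ofReal (l ^ a * Real.exp (-(T * l))) * ENNReal.ofReal (Real.exp (l * inner ℝ x (dir ξ)))

/-- The frequency integral is a Gamma integral with rate T - ⟨x, dir ξ⟩, which is positive since |x|
< T. -/
theorem waveKernel_eq {a : ℝ} (ha : -1 < a) {T : ℝ} {x : Space n} (hx : ‖x‖ < T) :
    waveKernel a T x = ∫⁻ ξ in ball (0 : Space n) 1,
      ENNReal.ofReal (Real.Gamma (a + 1) * (T - inner ℝ x (dir ξ)) ^ (-(a + 1))) := by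
  refine lintegral_congr fun ξ => ?_
  have h1 : inner ℝ x (dir ξ) ≤ ‖x‖ :=
    (real_inner_le_norm _ _).trans (mul_le_of_le_one_right (norm_nonneg _) (norm_dir_le ξ))
  rw [← lintegral_rpow_mul_exp_neg ha (show 0 < T - inner ℝ x (dir ξ) by linarith)]
  refine lintegral_congr fun l => ?_
  rw [← ENNReal.ofReal_mul' (Real.exp_pos _).le, mul_assoc, ← Real.exp_add]
  congr 3; ring

theorem div_two_rpow_neg {T : ℝ} (hT : 0 < T) (s : ℝ) : (T / 2) ^ (-s) = 2 ^ s * T ^ (-s) := by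
  rw [Real.div_rpow hT.le (by norm_num), Real.rpow_neg (by norm_num : (0 : ℝ) ≤ 2) s, div_inv_eq_mul,
    mul_comm]

/-- For |x| ≤ T/2 every T - ⟨x,θ⟩ is at least T/2, and T^{-(a+1)} = T^{-N} T^{N-1-a}. For |x| > T/2
the directional average applies and |x|^{-N} is comparable to T^{-N}. -/
theorem waveKernel_le (hn : 2 ≤ n) {a : ℝ} (ha : ((n : ℝ) - 1) / 2 - 1 < a) :
    ∃ C : ℝ, 0 < C ∧ ∀ (T : ℝ) (x : Space n), ‖x‖ < T →
      waveKernel a T x ≤ ENNReal.ofReal (C * T ^ (-(((n : ℝ) - 1) / 2))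
            * (T - ‖x‖) ^ (((n : ℝ) - 1) / 2 - 1 - a)) := by
  have hn' : (2 : ℝ) ≤ n := by exact_mod_cast hn
  obtain ⟨C, hC, hCle⟩ := lintegral_sub_inner_dir_rpow_le hn ha
  set N : ℝ := ((n : ℝ) - 1) / 2 with hN
  have ha1 : 0 < a + 1 := by linarith
  have hN0 : 0 ≤ N := by simp only [hN]; linarith
  have hvol : volume (ball (0 : Space n) 1) ≠ ⊤ := measure_ball_lt_top.ne
  have hG : 0 < Real.Gamma (a + 1) := Real.Gamma_pos_of_pos ha1
  set C₂ : ℝ := Real.Gamma (a + 1) * 2 ^ (a + 1) * volume.real (ball (0 : Space n) 1) with hC₂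
  set C₃ : ℝ := Real.Gamma (a + 1) * C * 2 ^ N with hC₃
  have hC₂0 : 0 ≤ C₂ := by positivity
  have hC₃0 : 0 < C₃ := by positivity
  refine ⟨C₂ + C₃, by positivity, ?_⟩
  intro T x hx
  have hT : 0 < T := (norm_nonneg x).trans_lt hx
  have hk : 0 < T - ‖x‖ := by linarith
  rw [waveKernel_eq (by linarith) hx]
  rcases le_or_gt ‖x‖ (T / 2) with h1 | h1
  · have h2 : ∀ ξ : Space n, Real.Gamma (a + 1) * (T - inner ℝ x (dir ξ)) ^ (-(a + 1))
        ≤ Real.Gamma (a + 1) * (T / 2) ^ (-(a + 1)) := by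
      intro ξ
      have h3 : inner ℝ x (dir ξ) ≤ ‖x‖ :=
        (real_inner_le_norm _ _).trans (mul_le_of_le_one_right (norm_nonneg _) (norm_dir_le ξ))
      refine mul_le_mul_of_nonneg_left ?_ hG.le
      exact Real.rpow_le_rpow_of_nonpos (by linarith) (by linarith) (by linarith)
    refine (lintegral_mono fun ξ => ENNReal.ofReal_le_ofReal (h2 ξ)).trans ?_
    rw [lintegral_const, Measure.restrict_apply_univ, ← ENNReal.ofReal_toReal hvol,
      ← ENNReal.ofReal_mul (by positivity)]
    refine ENNReal.ofReal_le_ofReal ?_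
    have h4 : (T / 2) ^ (-(a + 1)) = 2 ^ (a + 1) * (T ^ (-N) * T ^ (N - 1 - a)) := by
      rw [← Real.rpow_add hT, div_two_rpow_neg hT]
      congr 2; ring
    have h5 : T ^ (N - 1 - a) ≤ (T - ‖x‖) ^ (N - 1 - a) :=
      Real.rpow_le_rpow_of_nonpos hk (by linarith [norm_nonneg x]) (by linarith)
    calc Real.Gamma (a + 1) * (T / 2) ^ (-(a + 1)) * (volume (ball (0 : Space n) 1)).toReal
        = C₂ * T ^ (-N) * T ^ (N - 1 - a) := by rw [h4, hC₂, Measure.real]; ring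
      _ ≤ C₂ * T ^ (-N) * (T - ‖x‖) ^ (N - 1 - a) := by gcongr
      _ ≤ (C₂ + C₃) * T ^ (-N) * (T - ‖x‖) ^ (N - 1 - a) := by
        gcongr; linarith
  · have hx0 : x ≠ 0 := by
      intro h; rw [h, norm_zero] at h1; linarith
    have hr : 0 < ‖x‖ := norm_pos_iff.2 hx0
    simp_rw [ENNReal.ofReal_mul hG.le]
    rw [lintegral_const_mul _ (by fun_prop)]
    refine (mul_le_mul_right (hCle T x hx0 hx) _).trans ?_
    rw [← ENNReal.ofReal_mul hG.le]
    refine ENNReal.ofReal_le_ofReal ?_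
    have h4 : ‖x‖ ^ (-N) ≤ 2 ^ N * T ^ (-N) := by
      rw [← div_two_rpow_neg hT]
      exact Real.rpow_le_rpow_of_nonpos (by linarith) h1.le (by linarith)
    calc Real.Gamma (a + 1) * (C * ‖x‖ ^ (-N) * (T - ‖x‖) ^ (N - 1 - a))
        ≤ Real.Gamma (a + 1) * (C * (2 ^ N * T ^ (-N)) * (T - ‖x‖) ^ (N - 1 - a)) := by gcongr
      _ = C₃ * T ^ (-N) * (T - ‖x‖) ^ (N - 1 - a) := by rw [hC₃]; ring
      _ ≤ (C₂ + C₃) * T ^ (-N) * (T - ‖x‖) ^ (N - 1 - a) := by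
        gcongr; linarith

/-- The mean of `e^{l⟨x, θ⟩}` over all directions is at least one. -/
theorem volume_ball_le_lintegral_exp_inner_dir (l : ℝ) (x : Space n) :
    volume (ball (0 : Space n) 1) ≤ ∫⁻ ξ in ball (0 : Space n) 1,
      ENNReal.ofReal (Real.exp (l * inner ℝ x (dir ξ))) := by
  set A := ∫⁻ ξ in ball (0 : Space n) 1, ENNReal.ofReal (Real.exp (l * inner ℝ x (dir ξ))) with hA
  have h1 : A = ∫⁻ ξ in ball (0 : Space n) 1,
      ENNReal.ofReal (Real.exp (-(l * inner ℝ x (dir ξ)))) := by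
    rw [hA, ← lintegral_indicator measurableSet_ball, ← lintegral_indicator measurableSet_ball,
      ← lintegral_neg_eq_self]
    refine lintegral_congr fun ξ => ?_
    simp [indicator, dir_neg]
  have h2 : 2 * volume (ball (0 : Space n) 1) ≤ 2 * A := by
    calc 2 * volume (ball (0 : Space n) 1) = ∫⁻ ξ in ball (0 : Space n) 1, 2 := by
          rw [lintegral_const, Measure.restrict_apply_univ]
      _ ≤ ∫⁻ ξ in ball (0 : Space n) 1, (ENNReal.ofReal (Real.exp (l * inner ℝ x (dir ξ)))
            + ENNReal.ofReal (Real.exp (-(l * inner ℝ x (dir ξ))))) := by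
          refine lintegral_mono fun ξ => ?_
          rw [← ENNReal.ofReal_add (Real.exp_pos _).le (Real.exp_pos _).le]
          refine (ENNReal.ofReal_ofNat 2).ge.trans (ENNReal.ofReal_le_ofReal ?_)
          linarith [Real.add_one_le_exp (l * inner ℝ x (dir ξ)),
            Real.add_one_le_exp (-(l * inner ℝ x (dir ξ)))]
      _ = 2 * A := by
          rw [lintegral_add_left (by fun_prop), ← h1, two_mul]
  rwa [ENNReal.mul_le_mul_iff_right (by norm_num) (by norm_num)] at h2

/-- The right side equals e^{-Sl}(1 - e^{-2lD})/2. For Sl in [1, 2] the exponential is bounded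
below, and 1 - e^{-y} ≥ y/(1+y) with y = 2lD gives D/(S+D). In the application S = s+2R and D = t-s,
so S+D = t+2R. -/
theorem le_exp_mul_sinh {S D l : ℝ} (hS : 0 < S) (hD : 0 ≤ D) (h1 : 1 / S ≤ l) (h2 : l ≤ 2 / S) :
    Real.exp (-2) / 2 * (D / (S + D)) ≤ Real.exp (-((S + D) * l)) * Real.sinh (l * D) := by
  have hl : 0 < l := lt_of_lt_of_le (by positivity) h1
  have e1 : Real.exp (-((S + D) * l)) * Real.sinh (l * D)
      = Real.exp (-(S * l)) / 2 * (1 - Real.exp (-(2 * l * D))) := by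
    rw [Real.sinh_eq, show -((S + D) * l) = -(S * l) + -(l * D) by ring, Real.exp_add,
      show -(2 * l * D) = -(l * D) + -(l * D) by ring, Real.exp_add]
    have : Real.exp (-(l * D)) * Real.exp (l * D) = 1 := by rw [← Real.exp_add]; simp
    linear_combination (Real.exp (-(S * l)) / 2) * this
  have h3 : S * l ≤ 2 := by
    rw [le_div_iff₀ hS] at h2; linarith
  have h3' : 1 ≤ S * l := by
    rw [div_le_iff₀ hS] at h1; linarith
  have h4 := one_sub_exp_neg_ge (y := 2 * l * D) (by positivity)
  have h5 : D / (S + D) ≤ 2 * l * D / (1 + 2 * l * D) := by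
    rw [div_le_div_iff₀ (by positivity) (by positivity)]
    nlinarith [mul_nonneg hD hl.le]
  rw [e1]
  have h6 : Real.exp (-2) ≤ Real.exp (-(S * l)) := Real.exp_le_exp.2 (by linarith)
  gcongr
  exact h5.trans h4

theorem rpow_ge_of_mem_Icc {S l : ℝ} (a : ℝ) (hS : 0 < S) (h1 : 1 / S ≤ l) (h2 : l ≤ 2 / S) :
    min 1 (2 ^ a) * S ^ (-a) ≤ l ^ a := by
  have hl : 0 < l := lt_of_lt_of_le (by positivity) h1
  have e1 : (1 / S) ^ a = S ^ (-a) := by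
    rw [one_div, Real.inv_rpow hS.le, Real.rpow_neg hS.le]
  have e2 : (2 / S) ^ a = 2 ^ a * S ^ (-a) := by
    rw [Real.div_rpow (by norm_num) hS.le, Real.rpow_neg hS.le, div_eq_mul_inv]
  rcases le_total 0 a with h | h
  · calc min 1 (2 ^ a) * S ^ (-a) ≤ 1 * S ^ (-a) := by gcongr; exact min_le_left _ _
      _ = (1 / S) ^ a := by rw [e1, one_mul]
      _ ≤ l ^ a := Real.rpow_le_rpow (by positivity) h1 h
  · calc min 1 (2 ^ a) * S ^ (-a) ≤ 2 ^ a * S ^ (-a) := by gcongr; exact min_le_right _ _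
      _ = (2 / S) ^ a := e2.symm
      _ ≤ l ^ a := Real.rpow_le_rpow_of_nonpos hl h2 h

/-- Lower bound for the kernel of the Duhamel term. -/
theorem duhamelKernel_ge (a : ℝ) : ∃ c : ℝ, 0 < c ∧ ∀ (S D : ℝ) (x : Space n), 0 < S → 0 ≤ D →
    ENNReal.ofReal (c * (D / (S + D)) * S ^ (-a)) ≤
      ∫⁻ ξ in ball (0 : Space n) 1, ∫⁻ l in Ioi (0 : ℝ),
        ENNReal.ofReal (l ^ a * Real.exp (-((S + D) * l)))
          * (ENNReal.ofReal (Real.exp (l * inner ℝ x (dir ξ)))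
            * ENNReal.ofReal (Real.sinh (l * D) / l)) := by
  have hvol : volume (ball (0 : Space n) 1) ≠ ⊤ := measure_ball_lt_top.ne
  have hvol0 : 0 < volume.real (ball (0 : Space n) 1) :=
    ENNReal.toReal_pos (measure_ball_pos _ _ one_pos).ne' hvol
  set β : ℝ := volume.real (ball (0 : Space n) 1) with hβ
  set c₀ : ℝ := Real.exp (-2) / 2 * min 1 (2 ^ (a - 1)) with hc₀
  have hc₀0 : 0 < c₀ := by positivity
  refine ⟨c₀ * β, by positivity, ?_⟩
  intro S D x hS hD
  rw [lintegral_lintegral_swap (by fun_prop)]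
  -- Only frequencies of order 1/S are kept. There l^{a-1} is of order S^{1-a}, the directional
  -- average of the exponential is at least the volume of the ball, and the frequency interval has
  -- length 1/S; together these give S^{-a}.
  have h1 : ∀ l ∈ Icc (1 / S) (2 / S),
      ENNReal.ofReal (c₀ * (D / (S + D)) * S ^ (1 - a) * β) ≤
      ∫⁻ ξ in ball (0 : Space n) 1, ENNReal.ofReal (l ^ a * Real.exp (-((S + D) * l)))
          * (ENNReal.ofReal (Real.exp (l * inner ℝ x (dir ξ)))
            * ENNReal.ofReal (Real.sinh (l * D) / l)) := by
    intro l hl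
    have hl0 : 0 < l := lt_of_lt_of_le (by positivity) hl.1
    rw [lintegral_const_mul _ (by fun_prop), lintegral_mul_const _ (by fun_prop)]
    calc ENNReal.ofReal (c₀ * (D / (S + D)) * S ^ (1 - a) * β)
        ≤ ENNReal.ofReal (l ^ a * Real.exp (-((S + D) * l)) * (β * (Real.sinh (l * D) / l))) := by
          refine ENNReal.ofReal_le_ofReal ?_
          have h2 := le_exp_mul_sinh hS hD hl.1 hl.2
          have h3 := rpow_ge_of_mem_Icc (a - 1) hS hl.1 hl.2
          rw [Real.rpow_sub_one hl0.ne', neg_sub] at h3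
          have h4 : 0 ≤ Real.exp (-2) / 2 * (D / (S + D)) := by positivity
          have h5 : 0 ≤ min 1 (2 ^ (a - 1)) * S ^ (1 - a) := by positivity
          have h6 := mul_le_mul h3 h2 h4 (h5.trans h3)
          calc c₀ * (D / (S + D)) * S ^ (1 - a) * β
              = β * (min 1 (2 ^ (a - 1)) * S ^ (1 - a)
                  * (Real.exp (-2) / 2 * (D / (S + D)))) := by rw [hc₀]; ring
            _ ≤ β * (l ^ a / l * (Real.exp (-((S + D) * l)) * Real.sinh (l * D))) := by gcongr
            _ = _ := by ring
      _ = ENNReal.ofReal (l ^ a * Real.exp (-((S + D) * l)))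
            * (volume (ball (0 : Space n) 1) * ENNReal.ofReal (Real.sinh (l * D) / l)) := by
          rw [ENNReal.ofReal_mul (by positivity), ENNReal.ofReal_mul hvol0.le, hβ, Measure.real,
            ENNReal.ofReal_toReal hvol]
      _ ≤ _ := by
          gcongr
          exact volume_ball_le_lintegral_exp_inner_dir l x
  have hsub : Icc (1 / S) (2 / S) ⊆ Ioi (0 : ℝ) := fun l hl =>
    lt_of_lt_of_le (by positivity) hl.1
  refine le_trans ?_ (lintegral_mono_set hsub)
  refine le_trans ?_ (setLIntegral_mono' measurableSet_Icc h1)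
  rw [setLIntegral_const, Real.volume_Icc, ← ENNReal.ofReal_mul (by positivity)]
  refine ENNReal.ofReal_le_ofReal (le_of_eq ?_)
  rw [show (1 : ℝ) - a = -a + 1 by ring, Real.rpow_add_one hS.ne']
  field_simp
  ring

theorem lintegral_rotate {α β γ : Type*} [MeasurableSpace α] [MeasurableSpace β]
    [MeasurableSpace γ] {μ : Measure α} {ν : Measure β} {σ : Measure γ} [SFinite μ] [SFinite ν]
    [SFinite σ] {g : α → β → γ → ENNReal}
    (hg : Measurable fun q : α × β × γ => g q.1 q.2.1 q.2.2) :
    ∫⁻ a, ∫⁻ b, ∫⁻ c, g a b c ∂σ ∂ν ∂μ = ∫⁻ c, ∫⁻ a, ∫⁻ b, g a b c ∂ν ∂μ ∂σ := by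
  have h1 : ∀ a, ∫⁻ b, ∫⁻ c, g a b c ∂σ ∂ν = ∫⁻ c, ∫⁻ b, g a b c ∂ν ∂σ := fun a =>
    lintegral_lintegral_swap (hg.comp (by fun_prop : Measurable fun q : β × γ => (a, q))).aemeasurable
  simp_rw [h1]
  refine lintegral_lintegral_swap ?_
  exact (Measurable.lintegral_prod_right' (f := fun q : (α × γ) × β => g q.1.1 q.2 q.1.2)
    (hg.comp (by fun_prop : Measurable fun q : (α × γ) × β => (q.1.1, q.2, q.1.2)))).aemeasurable

/-- Tonelli for the Duhamel term, with a = direction, b = frequency, c = time, d = space: the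
average over directions and frequencies moves innermost, where `duhamelKernel_ge` bounds it for each
fixed time and point. -/
theorem lintegral_source_swap {α β γ δ : Type*} [MeasurableSpace α] [MeasurableSpace β]
    [MeasurableSpace γ] [MeasurableSpace δ] {μ : Measure α} {ν : Measure β} {σ : Measure γ}
    {τ : Measure δ} [SFinite μ] [SFinite ν] [SFinite σ] [SFinite τ] {Φ : β → ENNReal}
    {W : γ → δ → ENNReal} {E : α → β → δ → ENNReal} {Y : β → γ → ENNReal} (hΦ : Measurable Φ)
    (hW : Measurable fun q : γ × δ => W q.1 q.2)
    (hE : Measurable fun q : α × β × δ => E q.1 q.2.1 q.2.2)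
    (hY : Measurable fun q : β × γ => Y q.1 q.2) :
    ∫⁻ a, ∫⁻ b, Φ b * ∫⁻ c, (∫⁻ d, W c d * E a b d ∂τ) * Y b c ∂σ ∂ν ∂μ
      = ∫⁻ c, ∫⁻ d, W c d * ∫⁻ a, ∫⁻ b, Φ b * (E a b d * Y b c) ∂ν ∂μ ∂τ ∂σ := by
  have hG : Measurable fun q : (α × β × γ) × δ =>
      W q.1.2.2 q.2 * (Φ q.1.2.1 * (E q.1.1 q.1.2.1 q.2 * Y q.1.2.1 q.1.2.2)) := by
    have h1 := hW.comp (by fun_prop : Measurable fun q : (α × β × γ) × δ => (q.1.2.2, q.2))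
    have h2 := hE.comp (by fun_prop : Measurable fun q : (α × β × γ) × δ => (q.1.1, q.1.2.1, q.2))
    have h3 := hY.comp (by fun_prop : Measurable fun q : (α × β × γ) × δ => (q.1.2.1, q.1.2.2))
    exact h1.mul ((hΦ.comp (by fun_prop)).mul (h2.mul h3))
  have e1 : ∀ a b, Φ b * ∫⁻ c, (∫⁻ d, W c d * E a b d ∂τ) * Y b c ∂σ
      = ∫⁻ c, ∫⁻ d, W c d * (Φ b * (E a b d * Y b c)) ∂τ ∂σ := by
    intro a b
    have hm : ∀ c, Measurable fun d => W c d * E a b d := fun c =>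
      (hW.comp (by fun_prop : Measurable fun d : δ => (c, d))).mul
        (hE.comp (by fun_prop : Measurable fun d : δ => (a, b, d)))
    have hm2 : Measurable fun c => ∫⁻ d, W c d * E a b d ∂τ :=
      Measurable.lintegral_prod_right' (f := fun q : γ × δ => W q.1 q.2 * E a b q.2)
        (hW.mul (hE.comp (by fun_prop : Measurable fun q : γ × δ => (a, b, q.2))))
    have hYb : Measurable fun c => Y b c :=
      hY.comp (by fun_prop : Measurable fun c : γ => (b, c))
    refine (lintegral_const_mul (Φ b) (hm2.mul hYb)).symm.trans (lintegral_congr fun c => ?_)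
    change Φ b * ((∫⁻ d, W c d * E a b d ∂τ) * Y b c) = _
    rw [← lintegral_mul_const _ (hm c), ← lintegral_const_mul _ ((hm c).mul_const _)]
    exact lintegral_congr fun d => by ring
  simp_rw [e1]
  rw [lintegral_rotate (Measurable.lintegral_prod_right' hG)]
  refine lintegral_congr fun c => ?_
  rw [lintegral_rotate (g := fun a b d => W c d * (Φ b * (E a b d * Y b c)))
    (hG.comp (by fun_prop : Measurable fun q : α × β × δ => ((q.1, q.2.1, c), q.2.2)))]
  refine lintegral_congr fun d => ?_
  have hE' : Measurable fun q : α × β => Φ q.2 * (E q.1 q.2 d * Y q.2 c) :=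
    (hΦ.comp measurable_snd).mul
      ((hE.comp (by fun_prop : Measurable fun q : α × β => (q.1, q.2, d))).mul
        (hY.comp (by fun_prop : Measurable fun q : α × β => (q.2, c))))
  rw [← lintegral_const_mul _ hE'.lintegral_prod_right']
  refine lintegral_congr fun a => ?_
  exact lintegral_const_mul _ (hE'.comp (by fun_prop : Measurable fun b : β => (a, b)))

theorem ofReal_inv_mul_le {M : ℝ} (hM : 0 < M) {X Y : ENNReal} (h : Y ≤ ENNReal.ofReal M * X) :
    ENNReal.ofReal M⁻¹ * Y ≤ X := by
  calc ENNReal.ofReal M⁻¹ * Y ≤ ENNReal.ofReal M⁻¹ * (ENNReal.ofReal M * X) := by gcongr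
    _ = X := by
      rw [← mul_assoc, ← ENNReal.ofReal_mul (inv_pos.2 hM).le, inv_mul_cancel₀ hM.ne',
        ENNReal.ofReal_one, one_mul]

/-- The weighted `L¹` norm `∫ |f| K_a(T, ·)`. -/
noncomputable def waveFunctional (a T : ℝ) (f : L2 n) : ENNReal :=
  ∫⁻ x, ‖f x‖ₑ * waveKernel a T x

theorem lintegral_planeWave_eq_waveFunctional (a T : ℝ) (f : L2 n) :
    ∫⁻ ξ in ball (0 : Space n) 1, ∫⁻ l in Ioi (0 : ℝ),
      ENNReal.ofReal (l ^ a * Real.exp (-(T * l)))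
        * ∫⁻ x, ‖f x‖ₑ * ENNReal.ofReal (Real.exp (l * inner ℝ x (dir ξ)))
      = waveFunctional a T f := by
  have hf : Measurable f := (Lp.stronglyMeasurable f).measurable
  have h1 : ∀ (ξ : Space n) (l : ℝ), ENNReal.ofReal (l ^ a * Real.exp (-(T * l)))
        * ∫⁻ x, ‖f x‖ₑ * ENNReal.ofReal (Real.exp (l * inner ℝ x (dir ξ)))
      = ∫⁻ x, ‖f x‖ₑ * (ENNReal.ofReal (l ^ a * Real.exp (-(T * l)))
        * ENNReal.ofReal (Real.exp (l * inner ℝ x (dir ξ)))) := by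
    intro ξ l
    rw [← lintegral_const_mul _ (by fun_prop)]
    exact lintegral_congr fun x => by ring
  simp_rw [h1]
  rw [lintegral_rotate (by fun_prop), waveFunctional]
  refine lintegral_congr fun x => ?_
  rw [waveKernel, ← lintegral_const_mul _ (by
    exact Measurable.lintegral_prod_right' (f := fun q : Space n × ℝ =>
      ENNReal.ofReal (q.2 ^ a * Real.exp (-(T * q.2)))
        * ENNReal.ofReal (Real.exp (q.2 * inner ℝ x (dir q.1)))) (by fun_prop))]
  refine lintegral_congr fun ξ => ?_
  rw [lintegral_const_mul _ (by fun_prop)]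

/-! ### Contribution of the data, and the iteration frame -/

section Data

theorem NonnegSupportedInBall.integrable {R : ℝ} {f : L2 n} (h : NonnegSupportedInBall R f) :
    Integrable f := by
  have h1 : IntegrableOn f (closedBall 0 R) := by
    have : IsFiniteMeasure (volume.restrict (closedBall (0 : Space n) R)) :=
      ⟨by simpa using measure_closedBall_lt_top⟩
    exact ((Lp.memLp f).restrict _).integrable (by norm_num)
  refine (integrableOn_iff_integrable_of_support_subset
    (f := (closedBall (0 : Space n) R).indicator f) support_indicator_subset).1
      (h1.congr_fun (fun x hx => (indicator_of_mem hx f).symm) measurableSet_closedBall)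
    |>.congr ?_
  filter_upwards [h.2] with x hx
  by_cases hxR : x ∈ closedBall (0 : Space n) R
  · rw [indicator_of_mem hxR]
  · rw [indicator_of_notMem hxR, hx (by simpa using hxR)]

theorem NonnegSupportedInBall.integral_pos {R : ℝ} {f : L2 n} (h : NonnegSupportedInBall R f)
    (hf : f ≠ 0) : 0 < ∫ x, f x := by
  refine (integral_nonneg_of_ae h.1).lt_of_ne fun h0 => hf ?_
  have := (integral_eq_zero_iff_of_nonneg_ae h.1 h.integrable).1 h0.symm
  exact (Lp.eq_zero_iff_ae_eq_zero).2 this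

/-- On the support l⟨x,θ⟩ ≥ -lR. This bound is uniform in θ, so the average over directions keeps
it. -/
theorem NonnegSupportedInBall.integral_exp_ge {R : ℝ} {f : L2 n} (h : NonnegSupportedInBall R f)
    {l : ℝ} (hl : 0 ≤ l) {θ : Space n} (hθ : ‖θ‖ ≤ 1) :
    Real.exp (-(l * R)) * (∫ x, f x) ≤ ∫ x, f x * Real.exp (l * inner ℝ x θ) := by
  have hb : ∀ x : Space n, |inner ℝ x θ| ≤ ‖x‖ := fun x =>
    (abs_real_inner_le_norm _ _).trans (mul_le_of_le_one_right (norm_nonneg _) hθ)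
  have hint : Integrable fun x => f x * Real.exp (l * inner ℝ x θ) := by
    refine (h.integrable.norm.mul_const (Real.exp (l * R))).mono'
      (h.integrable.aestronglyMeasurable.mul (by fun_prop)) ?_
    filter_upwards [h.2] with x hx
    rw [norm_mul, Real.norm_of_nonneg (Real.exp_pos _).le]
    rcases lt_or_ge R ‖x‖ with h1 | h1
    · simp [hx h1]
    · gcongr
      exact (le_abs_self _).trans ((hb x).trans h1)
  rw [← integral_const_mul]
  refine integral_mono_ae (h.integrable.const_mul _) hint ?_
  filter_upwards [h.1, h.2] with x hx0 hx
  rcases lt_or_ge R ‖x‖ with h1 | h1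
  · simp [hx h1]
  · rw [mul_comm]
    refine mul_le_mul_of_nonneg_left (Real.exp_le_exp.2 ?_) hx0
    have h2 := (abs_le.1 ((hb x).trans h1)).1
    nlinarith

end Data

/-- Lower bound for the contribution of the data. -/
theorem data_weight_ge {a R t l I₀ I₁ J₀ J₁ : ℝ} (hR : 0 < R) (ht : 1 ≤ t) (h1 : 1 ≤ l) (h2 : l ≤ 2)
    (hI₀ : 0 ≤ I₀) (hI₁ : 0 ≤ I₁) (hJ₀ : Real.exp (-(l * R)) * I₀ ≤ J₀)
    (hJ₁ : Real.exp (-(l * R)) * I₁ ≤ J₁) :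
    min 1 (2 ^ a) * Real.exp (-(6 * R)) * (I₀ + I₁) / 8
      ≤ l ^ a * Real.exp (-((t + 2 * R) * l))
        * (J₀ * Real.cosh (l * t) + J₁ * (Real.sinh (l * t) / l)) := by
  have hl : 0 < l := by linarith
  have hla : min 1 (2 ^ a) ≤ l ^ a := by
    have := rpow_ge_of_mem_Icc (S := 1) a one_pos (by simpa using h1) (by simpa using h2)
    simpa using this
  have hlt : 1 ≤ l * t := by nlinarith
  have hc : Real.exp (l * t) / 8 ≤ Real.cosh (l * t) := by
    rw [Real.cosh_eq]
    linarith [Real.exp_pos (l * t), Real.exp_pos (-(l * t))]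
  have hs : Real.exp (l * t) / 8 ≤ Real.sinh (l * t) / l := by
    have h3 : Real.exp (l * t) / 4 ≤ Real.sinh (l * t) := by
      rw [Real.sinh_eq]
      have h4 : Real.exp (-(l * t)) ≤ 1 := Real.exp_le_one_iff.2 (by linarith)
      have h5 : 2 ≤ Real.exp (l * t) := by linarith [Real.add_one_le_exp (l * t)]
      linarith
    rw [le_div_iff₀ hl]
    have := Real.exp_pos (l * t)
    nlinarith
  have hE := (Real.exp_pos (-(l * R))).le
  have hJ0 : 0 ≤ J₀ := (mul_nonneg hE hI₀).trans hJ₀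
  have hJ1 : 0 ≤ J₁ := (mul_nonneg hE hI₁).trans hJ₁
  have h6 : Real.exp (-(l * R)) * (I₀ + I₁) * (Real.exp (l * t) / 8)
      ≤ J₀ * Real.cosh (l * t) + J₁ * (Real.sinh (l * t) / l) := by
    have e1 := mul_le_mul hJ₀ hc (by positivity) hJ0
    have e2 := mul_le_mul hJ₁ hs (by positivity) hJ1
    linarith
  -- The exponents add up to -(t+2R)l - lR + lt = -3Rl, and l ≤ 2. The growth e^{lt} of cosh and
  -- sinh exactly compensates the weight, so the bound is uniform in t.
  have h7 : Real.exp (-(6 * R)) ≤ Real.exp (-((t + 2 * R) * l)) * (Real.exp (-(l * R))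
      * Real.exp (l * t)) := by
    rw [← Real.exp_add, ← Real.exp_add]
    refine Real.exp_le_exp.2 ?_
    nlinarith
  have hm : (0 : ℝ) ≤ min 1 (2 ^ a) := by positivity
  calc min 1 (2 ^ a) * Real.exp (-(6 * R)) * (I₀ + I₁) / 8
      = min 1 (2 ^ a) * (Real.exp (-(6 * R)) * ((I₀ + I₁) / 8)) := by ring
    _ ≤ l ^ a * ((Real.exp (-((t + 2 * R) * l)) * (Real.exp (-(l * R))
      * Real.exp (l * t))) * ((I₀ + I₁) / 8)) := by gcongr
    _ = l ^ a * Real.exp (-((t + 2 * R) * l)) * (Real.exp (-(l * R)) * (I₀ + I₁)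
          * (Real.exp (l * t) / 8)) := by ring
    _ ≤ _ := by gcongr

set_option maxHeartbeats 1000000 in
/-- The iteration frame: lower bounds for the functional of one component in terms of the data and
of the norm of the other component. -/
theorem exists_iteration_frame (hn : 2 ≤ n) (a : ℝ) {p q R : ℝ} {b : ℝ → ℝ} {u₀ : H1 n} {u₁ : L2 n}
    (hp : 0 < p) (hR : 0 < R)
    (hb : ContinuousOn b (Ici 0)) (hbi : IntegrableOn b (Ici 0)) (hb0 : ∀ t, 0 ≤ t → 0 ≤ b t)
    (hu₀ : NonnegSupportedInBall R (toL2 u₀)) (hu₁ : NonnegSupportedInBall R u₁)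
    (hne : toL2 u₀ ≠ 0 ∨ u₁ ≠ 0) :
    ∃ c : ℝ, 0 < c ∧ ∀ (T : EReal) (ε : ℝ) (u v : ℝ → H1 n), 0 < T → 0 ≤ ε →
      MemEnergyClass T q u → MemEnergyClass T p v → u 0 = ε • u₀ → WeakEquation T p ε b u₁ u v →
      SupportedInCone T R u → SupportedInCone T R v → ∀ t ∈ timeInterval T,
      (1 ≤ t → ENNReal.ofReal (c * ε) ≤ waveFunctional a (t + 2 * R) (toL2 (u t))) ∧
      ∫⁻ s in Icc 0 t, ENNReal.ofReal (c * ((t - s) / (t + 2 * R)) * (s + 2 * R) ^ (-a))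
          * ∫⁻ x, ‖toL2 (v s) x‖ₑ ^ p
        ≤ waveFunctional a (t + 2 * R) (toL2 (u t)) := by
  obtain ⟨c₁, hc₁, hker⟩ := duhamelKernel_ge (n := n) a
  have hvol : volume (ball (0 : Space n) 1) ≠ ⊤ := measure_ball_lt_top.ne
  have hvol0 : 0 < volume.real (ball (0 : Space n) 1) :=
    ENNReal.toReal_pos (measure_ball_pos _ _ one_pos).ne' hvol
  set β : ℝ := volume.real (ball (0 : Space n) 1) with hβ
  set M : ℝ := Real.exp (∫ s in Ici 0, b s) with hM
  have hM0 : 0 < M := Real.exp_pos _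
  have hI₀ : 0 ≤ ∫ x, toL2 u₀ x := integral_nonneg_of_ae hu₀.1
  have hI₁ : 0 ≤ ∫ x, u₁ x := integral_nonneg_of_ae hu₁.1
  have hI : 0 < (∫ x, toL2 u₀ x) + ∫ x, u₁ x := by
    rcases hne with h | h
    · linarith [hu₀.integral_pos h]
    · linarith [hu₁.integral_pos h]
  set κ : ℝ := min 1 (2 ^ a) * Real.exp (-(6 * R)) * ((∫ x, toL2 u₀ x) + ∫ x, u₁ x) / 8 with hκ
  have hκ0 : 0 < κ := by positivity
  -- M = e^{∫b} is the price of the damping. The first entry comes from the data at frequencies in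
  -- [1, 2], averaged over a ball of volume β; the second comes from the source kernel.
  refine ⟨min (M⁻¹ * (β * κ)) (M⁻¹ * c₁), by positivity, ?_⟩
  intro T ε u v hT hε hmu hmv h0 heq hsu hsv t ht
  have ht0 := ht.1
  obtain ⟨w, hw⟩ := hmv.exists_isRepresentative
  let J : Space n → ℝ → ℝ := fun ξ l =>
    ε * ((∫ x, toL2 u₀ x * Real.exp (l * inner ℝ x (dir ξ))) * Real.cosh (l * t)
        + (∫ x, u₁ x * Real.exp (l * inner ℝ x (dir ξ))) * (Real.sinh (l * t) / l))
  let S : Space n → ℝ → ENNReal := fun ξ l =>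
    ∫⁻ s in Icc 0 t, (∫⁻ x, ENNReal.ofReal (|w (s, x)| ^ p * Real.exp (l * inner ℝ x (dir ξ))))
      * ENNReal.ofReal (Real.sinh (l * (t - s)) / l)
  let Φ : ℝ → ENNReal := fun l => ENNReal.ofReal (l ^ a * Real.exp (-((t + 2 * R) * l)))
  have key : ∫⁻ ξ in ball (0 : Space n) 1, ∫⁻ l in Ioi (0 : ℝ),
        Φ l * (ENNReal.ofReal (J ξ l) + S ξ l)
      ≤ ENNReal.ofReal M * waveFunctional a (t + 2 * R) (toL2 (u t)) := by
    have e1 : ENNReal.ofReal M * waveFunctional a (t + 2 * R) (toL2 (u t))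
        = ∫⁻ ξ in ball (0 : Space n) 1, ∫⁻ l in Ioi (0 : ℝ), ENNReal.ofReal M * (Φ l
          * ∫⁻ x, ‖toL2 (u t) x‖ₑ * ENNReal.ofReal (Real.exp (l * inner ℝ x (dir ξ)))) := by
      simp_rw [lintegral_const_mul' (ENNReal.ofReal M) _ ENNReal.ofReal_ne_top]
      rw [← lintegral_planeWave_eq_waveFunctional]
    rw [e1]
    refine lintegral_mono_ae ?_
    filter_upwards [ae_ne_zero hn] with ξ hξ
    refine setLIntegral_mono' measurableSet_Ioi fun l hl => ?_
    refine (mul_le_mul_right (planeWave_lower_bound hp hε hR hT hb hbi hb0 hu₀ hu₁ hmu h0 heq hsu hsv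
      hw ht (norm_dir hξ) hl) (Φ l)).trans (le_of_eq ?_)
    ring
  have key' := ofReal_inv_mul_le hM0 key
  constructor
  · intro ht1
    refine le_trans ?_ key'
    have h1 : ∀ ξ : Space n, ENNReal.ofReal (κ * ε)
        ≤ ∫⁻ l in Ioi (0 : ℝ), Φ l * (ENNReal.ofReal (J ξ l) + S ξ l) := by
      intro ξ
      have hsub : Icc (1 : ℝ) 2 ⊆ Ioi 0 := fun l hl => lt_of_lt_of_le one_pos hl.1
      refine le_trans ?_ (lintegral_mono_set hsub)
      have h2 : ∀ l ∈ Icc (1 : ℝ) 2, ENNReal.ofReal (κ * ε)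
          ≤ Φ l * (ENNReal.ofReal (J ξ l) + S ξ l) := by
        intro l hl
        have hl0 : 0 ≤ l := by linarith [hl.1]
        calc ENNReal.ofReal (κ * ε) ≤ ENNReal.ofReal (l ^ a * Real.exp (-((t + 2 * R) * l)) * J ξ l) := by
              refine ENNReal.ofReal_le_ofReal ?_
              have := data_weight_ge (a := a) hR ht1 hl.1 hl.2 hI₀ hI₁
                (hu₀.integral_exp_ge hl0 (norm_dir_le ξ)) (hu₁.integral_exp_ge hl0 (norm_dir_le ξ))
              have h3 := mul_le_mul_of_nonneg_right this hε
              refine h3.trans (le_of_eq ?_)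
              simp only [J]; ring
          _ = Φ l * ENNReal.ofReal (J ξ l) := by
              rw [ENNReal.ofReal_mul (by positivity)]
          _ ≤ _ := by gcongr; exact le_self_add
      refine le_trans ?_ (setLIntegral_mono' measurableSet_Icc h2)
      rw [setLIntegral_const, Real.volume_Icc]
      norm_num
    calc ENNReal.ofReal (min (M⁻¹ * (β * κ)) (M⁻¹ * c₁) * ε)
        ≤ ENNReal.ofReal (M⁻¹ * (β * (κ * ε))) := by
          refine ENNReal.ofReal_le_ofReal ?_
          have := mul_le_mul_of_nonneg_right (min_le_left (M⁻¹ * (β * κ)) (M⁻¹ * c₁)) hε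
          refine this.trans (le_of_eq ?_)
          ring
      _ = ENNReal.ofReal M⁻¹ * ∫⁻ ξ in ball (0 : Space n) 1, ENNReal.ofReal (κ * ε) := by
          rw [setLIntegral_const, ENNReal.ofReal_mul (by positivity), ENNReal.ofReal_mul hvol0.le, hβ,
            Measure.real, ENNReal.ofReal_toReal hvol, mul_comm (volume _)]
      _ ≤ _ := by gcongr with ξ; exact h1 ξ
  · refine le_trans ?_ key'
    have hwm := hw.measurable
    have h1 : ∫⁻ ξ in ball (0 : Space n) 1, ∫⁻ l in Ioi (0 : ℝ), Φ l * S ξ l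
        = ∫⁻ s in Icc 0 t, ∫⁻ x, ENNReal.ofReal (|w (s, x)| ^ p) *
          ∫⁻ ξ in ball (0 : Space n) 1, ∫⁻ l in Ioi (0 : ℝ),
          Φ l * (ENNReal.ofReal (Real.exp (l * inner ℝ x (dir ξ)))
            * ENNReal.ofReal (Real.sinh (l * (t - s)) / l)) := by
      rw [← lintegral_source_swap (by fun_prop) (by fun_prop) (by fun_prop) (by fun_prop)]
      simp only [S]
      simp_rw [fun (s l : ℝ) (ξ x : Space n) => ENNReal.ofReal_mul
        (p := |w (s, x)| ^ p) (q := Real.exp (l * inner ℝ x (dir ξ))) (by positivity)]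
    have h2 : ∫⁻ ξ in ball (0 : Space n) 1, ∫⁻ l in Ioi (0 : ℝ), Φ l * S ξ l
        ≤ ∫⁻ ξ in ball (0 : Space n) 1, ∫⁻ l in Ioi (0 : ℝ),
          Φ l * (ENNReal.ofReal (J ξ l) + S ξ l) := by
      refine lintegral_mono fun ξ => lintegral_mono fun l => ?_
      exact mul_le_mul_right le_add_self _
    refine le_trans ?_ (mul_le_mul_right h2 _)
    rw [h1, ← lintegral_const_mul' (ENNReal.ofReal M⁻¹) _ ENNReal.ofReal_ne_top]
    have hwv : ∀ᵐ s ∂(volume.restrict (Icc 0 t)), ∀ᵐ x, w (s, x) = toL2 (v s) x :=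
      ae_mono (Measure.restrict_mono (Icc_subset_timeInterval ht) le_rfl) hw.ae_eq
    refine lintegral_mono_ae ?_
    filter_upwards [hwv, ae_restrict_mem measurableSet_Icc] with s hs hsI
    have h3 : ∫⁻ x, ‖toL2 (v s) x‖ₑ ^ p = ∫⁻ x, ENNReal.ofReal (|w (s, x)| ^ p) := by
      refine lintegral_congr_ae ?_
      filter_upwards [hs] with x hx
      rw [← hx, ← ENNReal.ofReal_rpow_of_nonneg (abs_nonneg _) hp.le, ← Real.norm_eq_abs,
        ofReal_norm]
    have hsR : 0 < s + 2 * R := by linarith [hsI.1]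
    have hts : 0 ≤ t - s := by linarith [hsI.2]
    rw [h3, ← lintegral_const_mul' (ENNReal.ofReal M⁻¹) _ ENNReal.ofReal_ne_top,
      ← lintegral_const_mul' (ENNReal.ofReal _) _ ENNReal.ofReal_ne_top]
    refine lintegral_mono fun x => ?_
    have h4 := hker (s + 2 * R) (t - s) x hsR hts
    rw [show s + 2 * R + (t - s) = t + 2 * R by ring] at h4
    calc ENNReal.ofReal (min (M⁻¹ * (β * κ)) (M⁻¹ * c₁) * ((t - s) / (t + 2 * R))
            * (s + 2 * R) ^ (-a)) * ENNReal.ofReal (|w (s, x)| ^ p)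
        ≤ ENNReal.ofReal (M⁻¹ * (c₁ * ((t - s) / (t + 2 * R)) * (s + 2 * R) ^ (-a)))
            * ENNReal.ofReal (|w (s, x)| ^ p) := by
          gcongr ENNReal.ofReal ?_ * _
          have h5 : 0 ≤ (t - s) / (t + 2 * R) * (s + 2 * R) ^ (-a) := by positivity
          have := mul_le_mul_of_nonneg_right (min_le_right (M⁻¹ * (β * κ)) (M⁻¹ * c₁)) h5
          refine (le_of_eq ?_).trans (this.trans (le_of_eq ?_)) <;> ring
      _ = ENNReal.ofReal M⁻¹ * (ENNReal.ofReal (|w (s, x)| ^ p) *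
            ENNReal.ofReal (c₁ * ((t - s) / (t + 2 * R)) * (s + 2 * R) ^ (-a))) := by
          rw [ENNReal.ofReal_mul (by positivity)]; ring
      _ ≤ _ := by
          gcongr

/-! ### Hölder's inequality against the kernel -/

theorem integral_comp_norm_sub_le (hn : 2 ≤ n) {R ρ κ : ℝ} (hR : 0 < R) (hρ : 0 ≤ ρ) :
    ∫⁻ x in closedBall (0 : Space n) ρ, ENNReal.ofReal ((ρ + R - ‖x‖) ^ (-κ))
      ≤ ENNReal.ofReal (n * volume.real (ball (0 : Space n) 1) * (ρ + R) ^ ((n : ℝ) - 1)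
          * ∫ z in R..(ρ + R), z ^ (-κ)) := by
  have hne : Nonempty (Fin n) := ⟨⟨0, by omega⟩⟩
  let G : ℝ → ℝ := (Iic ρ).indicator fun y => (ρ + R - y) ^ (-κ)
  have hcont : ContinuousOn (fun y : ℝ => (ρ + R - y) ^ (-κ)) (Iic ρ) := by
    intro y hy
    refine (ContinuousAt.rpow_const (by fun_prop) (Or.inl ?_)).continuousWithinAt
    have : y ≤ ρ := hy
    linarith
  have hGind : (fun x : Space n => G ‖x‖)
      = (closedBall (0 : Space n) ρ).indicator fun x => (ρ + R - ‖x‖) ^ (-κ) := by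
    ext x; simp [G, indicator]
  have hGint : Integrable fun x : Space n => G ‖x‖ := by
    rw [hGind, integrable_indicator_iff measurableSet_closedBall]
    exact (hcont.comp continuous_norm.continuousOn fun x hx => by simpa using hx).integrableOn_compact
      (isCompact_closedBall _ _)
  have hG0 : ∀ y, 0 ≤ G y := fun y => indicator_nonneg (fun y hy => Real.rpow_nonneg (by
    have : y ≤ ρ := hy
    linarith) _) y
  have e1 : ∫⁻ x in closedBall (0 : Space n) ρ, ENNReal.ofReal ((ρ + R - ‖x‖) ^ (-κ))
      = ENNReal.ofReal (∫ x : Space n, G ‖x‖) := by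
    rw [ofReal_integral_eq_lintegral_ofReal hGint (Eventually.of_forall fun x => hG0 _),
      ← lintegral_indicator measurableSet_closedBall]
    refine lintegral_congr fun x => ?_
    rw [congrFun hGind x]
    by_cases hx : x ∈ closedBall (0 : Space n) ρ <;> simp [indicator, hx]
  rw [e1]
  refine ENNReal.ofReal_le_ofReal ?_
  rw [integral_fun_norm_addHaar volume G, finrank_euclideanSpace_fin, nsmul_eq_mul, smul_eq_mul,
    ← mul_assoc, mul_assoc (_ * _) ((ρ + R) ^ _)]
  refine mul_le_mul_of_nonneg_left ?_ (by positivity)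
  -- Polar coordinates. The factor y^{n-1} will be bounded by its size at the edge of the ball,
  -- which leaves the integral of z^{-κ} with z = ρ + R - y.
  have e2 : ∫ y in Ioi (0 : ℝ), y ^ (n - 1) • G y
      = ∫ y in (0 : ℝ)..ρ, y ^ (n - 1) * (ρ + R - y) ^ (-κ) := by
    rw [intervalIntegral.integral_of_le hρ, ← integral_indicator measurableSet_Ioi,
      ← integral_indicator measurableSet_Ioc]
    refine integral_congr_ae (Eventually.of_forall fun y => ?_)
    by_cases h1 : 0 < y <;> by_cases h2 : y ≤ ρ <;> simp [indicator, G, h1, h2]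
  have hc' : ContinuousOn (fun y : ℝ => (ρ + R - y) ^ (-κ)) (Icc 0 ρ) :=
    hcont.mono fun y hy => hy.2
  have e3 : ∫ y in (0 : ℝ)..ρ, (ρ + R - y) ^ (-κ) = ∫ z in R..(ρ + R), z ^ (-κ) := by
    rw [intervalIntegral.integral_comp_sub_left (fun z => z ^ (-κ)) (ρ + R)]
    congr 1 <;> ring
  rw [e2, ← e3, ← intervalIntegral.integral_const_mul]
  refine intervalIntegral.integral_mono_on hρ
    (((continuousOn_id.pow _).mul hc').intervalIntegrable_of_Icc hρ)
    ((continuousOn_const.mul hc').intervalIntegrable_of_Icc hρ) fun y hy => ?_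
  have h1 : y ^ (n - 1) ≤ (ρ + R) ^ ((n : ℝ) - 1) := by
    rw [show (n : ℝ) - 1 = ((n - 1 : ℕ) : ℝ) by rw [Nat.cast_sub (by omega)]; simp,
      Real.rpow_natCast]
    exact pow_le_pow_left₀ hy.1 (by linarith [hy.2]) _
  exact mul_le_mul_of_nonneg_right h1 (Real.rpow_nonneg (by linarith [hy.2]) _)

/-- Hölder's inequality for the functional of a function supported in a ball. -/
theorem waveFunctional_rpow_le (hn : 2 ≤ n) {a p R : ℝ} (ha : ((n : ℝ) - 1) / 2 - 1 < a) (hp : 1 < p)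
    (hR : 0 < R) : ∃ C : ℝ, 0 < C ∧ ∀ (s : ℝ) (f : L2 n), 0 ≤ s →
      (∀ᵐ x, s + R < ‖x‖ → f x = 0) →
      waveFunctional a (s + 2 * R) f ^ p ≤
        ENNReal.ofReal (C * (s + 2 * R) ^ (((n : ℝ) - 1) / 2 * (p - 2))
          * (∫ z in R..(s + 2 * R), z ^ (-((1 + a - ((n : ℝ) - 1) / 2) * (p / (p - 1))))) ^ (p - 1))
          * ∫⁻ x, ‖f x‖ₑ ^ p := by
  obtain ⟨C, hC, hker⟩ := waveKernel_le hn ha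
  let N : ℝ := ((n : ℝ) - 1) / 2
  let p' : ℝ := p / (p - 1)
  have hpq : p.HolderConjugate p' := Real.HolderConjugate.conjExponent hp
  have hp0 : 0 < p := by linarith
  have hp1 : 0 < p - 1 := by linarith
  have hp'0 : 0 < p' := by positivity
  have hn0 : (0 : ℝ) < n := by positivity
  let β : ℝ := volume.real (ball (0 : Space n) 1)
  have hβ : 0 < β := ENNReal.toReal_pos (measure_ball_pos _ _ one_pos).ne' measure_ball_lt_top.ne
  refine ⟨C ^ p * (n * β) ^ (p - 1), by positivity, ?_⟩
  intro s f hs hf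
  have hT : 0 < s + 2 * R := by linarith
  have hTe : s + R + R = s + 2 * R := by ring
  let I : ℝ := ∫ z in R..(s + 2 * R), z ^ (-((1 + a - N) * p'))
  have hI : 0 ≤ I := intervalIntegral.integral_nonneg (by linarith) fun z hz =>
    Real.rpow_nonneg (by linarith [hz.1]) _
  -- Inside the support cone s + 2R - |x| ≥ R, so the kernel bound stays away from its singularity;
  -- this is the reason for the shift 2R instead of R.
  let g : Space n → ENNReal := (closedBall (0 : Space n) (s + R)).indicator fun x =>
    ENNReal.ofReal (C * (s + 2 * R) ^ (-N) * (s + 2 * R - ‖x‖) ^ (N - 1 - a))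
  have hgm : Measurable g := Measurable.indicator (by fun_prop) measurableSet_closedBall
  have hfm : Measurable f := (Lp.stronglyMeasurable f).measurable
  have h1 : waveFunctional a (s + 2 * R) f ≤ ∫⁻ x, (fun x => ‖f x‖ₑ) x * g x := by
    refine lintegral_mono_ae ?_
    filter_upwards [hf] with x hx
    rcases lt_or_ge (s + R) ‖x‖ with h | h
    · simp [hx h]
    · have : x ∈ closedBall (0 : Space n) (s + R) := by simpa using h
      simp only [g, indicator_of_mem this]
      gcongr
      exact hker _ x (by linarith)
  have h2 := h1.trans (ENNReal.lintegral_mul_le_Lp_mul_Lq volume hpq hfm.enorm.aemeasurable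
    hgm.aemeasurable)
  have h3 : waveFunctional a (s + 2 * R) f ^ p
      ≤ (∫⁻ x, ‖f x‖ₑ ^ p) * (∫⁻ x, g x ^ p') ^ (p - 1) := by
    refine (ENNReal.rpow_le_rpow h2 hp0.le).trans (le_of_eq ?_)
    rw [ENNReal.mul_rpow_of_nonneg _ _ hp0.le, ← ENNReal.rpow_mul, ← ENNReal.rpow_mul,
      one_div_mul_cancel hp0.ne', ENNReal.rpow_one]
    congr 2
    simp only [p']; field_simp
  have h4 : ∫⁻ x, g x ^ p' ≤ ENNReal.ofReal (C ^ p' * (s + 2 * R) ^ (-N * p')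
      * (n * β * (s + 2 * R) ^ ((n : ℝ) - 1) * I)) := by
    have e1 : ∀ x, g x ^ p' = (closedBall (0 : Space n) (s + R)).indicator (fun x =>
        ENNReal.ofReal (C ^ p' * (s + 2 * R) ^ (-N * p'))
          * ENNReal.ofReal ((s + R + R - ‖x‖) ^ (-((1 + a - N) * p')))) x := by
      intro x
      by_cases hx : x ∈ closedBall (0 : Space n) (s + R)
      · have hx' : ‖x‖ ≤ s + R := by simpa using hx
        have hk : 0 < s + 2 * R - ‖x‖ := by linarith
        simp only [g, indicator_of_mem hx]
        rw [ENNReal.ofReal_rpow_of_nonneg (by positivity) hp'0.le,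
          ← ENNReal.ofReal_mul (by positivity), hTe,
          Real.mul_rpow (by positivity) (by positivity), Real.mul_rpow hC.le (by positivity),
          ← Real.rpow_mul hT.le, ← Real.rpow_mul hk.le]
        congr 3; ring
      · simp only [g, indicator_of_notMem hx]
        exact ENNReal.zero_rpow_of_pos hp'0
    simp_rw [e1]
    rw [lintegral_indicator measurableSet_closedBall, lintegral_const_mul _ (by fun_prop),
      ENNReal.ofReal_mul (p := C ^ p' * (s + 2 * R) ^ (-N * p')) (by positivity)]
    have := integral_comp_norm_sub_le hn (κ := (1 + a - N) * p') hR (show 0 ≤ s + R by linarith)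
    rw [hTe] at this ⊢
    exact mul_le_mul_right this _
  refine h3.trans ?_
  rw [mul_comm]
  suffices h5 : (∫⁻ x, g x ^ p') ^ (p - 1) ≤ ENNReal.ofReal (C ^ p * (n * β) ^ (p - 1)
      * (s + 2 * R) ^ (N * (p - 2)) * I ^ (p - 1)) from mul_le_mul_left h5 _
  refine (ENNReal.rpow_le_rpow h4 hp1.le).trans ?_
  rw [ENNReal.ofReal_rpow_of_nonneg (by positivity) hp1.le]
  refine ENNReal.ofReal_le_ofReal (le_of_eq ?_)
  rw [Real.mul_rpow (by positivity) (by positivity), Real.mul_rpow (by positivity) (by positivity),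
    Real.mul_rpow (by positivity) hI, Real.mul_rpow (by positivity) (by positivity),
    ← Real.rpow_mul hC.le, ← Real.rpow_mul hT.le, ← Real.rpow_mul hT.le]
  have e5 : p' * (p - 1) = p := by simp only [p']; field_simp
  -- The kernel contributes (s+2R)^{-Np} and the volume factor (s+2R)^{2N(p-1)}; the sum of the
  -- exponents is N(p-2).
  have e6 : (s + 2 * R) ^ (N * (p - 2))
      = (s + 2 * R) ^ (-N * p' * (p - 1)) * (s + 2 * R) ^ (((n : ℝ) - 1) * (p - 1)) := by
    rw [← Real.rpow_add hT, mul_assoc, e5]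
    congr 1; simp only [N]; ring
  rw [e5, e6]
  ring

/-- The Hölder estimate with exponent 2 controls the functional by the L² norm. This finiteness is
what blow-up of the iteration contradicts. -/
theorem waveFunctional_lt_top (hn : 2 ≤ n) {a R s : ℝ} (ha : ((n : ℝ) - 1) / 2 - 1 < a)
    (hR : 0 < R) (hs : 0 ≤ s) {f : L2 n} (hf : ∀ᵐ x, s + R < ‖x‖ → f x = 0) :
    waveFunctional a (s + 2 * R) f < ⊤ := by
  obtain ⟨C, -, h⟩ := waveFunctional_rpow_le hn ha (one_lt_two) hR
  have h1 := h s f hs hf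
  have h2 : ∫⁻ x, ‖f x‖ₑ ^ (2 : ℝ) < ⊤ := by
    have := lintegral_rpow_enorm_lt_top_of_eLpNorm_lt_top (p := 2) (by norm_num) (by norm_num)
      (Lp.memLp f).2
    simpa using this
  have h3 := h1.trans_lt (ENNReal.mul_lt_top ENNReal.ofReal_lt_top h2)
  exact (ENNReal.rpow_lt_top_iff_of_pos two_pos).1 h3

/-! ### The three regimes of the radial integral -/

section PowerIntegrals

variable {R T κ : ℝ}

theorem integral_rpow_neg_one (hR : 0 < R) (hRT : R ≤ T) :
    ∫ z in R..T, z ^ (-1 : ℝ) = Real.log (T / R) := by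
  rw [← integral_inv_of_pos hR (hR.trans_le hRT)]
  refine intervalIntegral.integral_congr fun z _ => ?_
  simp only [Real.rpow_neg_one]

theorem integral_rpow_neg_le_of_one_lt (hR : 0 < R) (hRT : R ≤ T) (hκ : 1 < κ) :
    ∫ z in R..T, z ^ (-κ) ≤ R ^ (1 - κ) / (κ - 1) := by
  rw [integral_rpow (Or.inr ⟨by linarith, by
    rw [uIcc_of_le hRT]; exact fun h => absurd h.1 (by linarith)⟩)]
  have h1 : 0 ≤ T ^ (-κ + 1) := Real.rpow_nonneg (hR.le.trans hRT) _
  rw [show -κ + 1 = -(κ - 1) by ring] at *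
  rw [div_neg, ← neg_div, show 1 - κ = -(κ - 1) by ring]
  exact div_le_div_of_nonneg_right (by linarith) (by linarith)

theorem integral_rpow_neg_le_of_lt_one (hR : 0 < R) (hκ : κ < 1) :
    ∫ z in R..T, z ^ (-κ) ≤ (1 - κ)⁻¹ * T ^ (1 - κ) := by
  rw [integral_rpow (Or.inl (by linarith))]
  have h1 : 0 ≤ R ^ (-κ + 1) := Real.rpow_nonneg hR.le _
  rw [show -κ + 1 = 1 - κ by ring] at *
  rw [div_eq_inv_mul]
  exact mul_le_mul_of_nonneg_left (by linarith) (inv_nonneg.2 (by linarith))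

end PowerIntegrals

/-- A lower bound for the `L^p` norm by the functional, given a bound for the radial integral. -/
theorem lintegral_rpow_ge_of_integral_le (hn : 2 ≤ n) {a p R : ℝ}
    (ha : ((n : ℝ) - 1) / 2 - 1 < a) (hp : 1 < p) (hR : 0 < R) {Λ : ℝ → ℝ} {A : ℝ} (hA : 0 < A)
    (hΛ0 : ∀ s, 0 ≤ s → 0 < Λ s)
    (hΛ : ∀ s, 0 ≤ s → ∫ z in R..(s + 2 * R),
      z ^ (-((1 + a - ((n : ℝ) - 1) / 2) * (p / (p - 1)))) ≤ A * Λ s) :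
    ∃ c : ℝ, 0 < c ∧ ∀ (s : ℝ) (f : L2 n), 0 ≤ s → (∀ᵐ x, s + R < ‖x‖ → f x = 0) →
      ENNReal.ofReal (c * (s + 2 * R) ^ (-(((n : ℝ) - 1) / 2 * (p - 2))) * Λ s ^ (-(p - 1)))
          * waveFunctional a (s + 2 * R) f ^ p ≤ ∫⁻ x, ‖f x‖ₑ ^ p := by
  obtain ⟨C, hC, h⟩ := waveFunctional_rpow_le hn ha hp hR
  refine ⟨(C * A ^ (p - 1))⁻¹, by positivity, ?_⟩
  intro s f hs hf
  have hT : 0 < s + 2 * R := by linarith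
  have hL := hΛ0 s hs
  have h1 := h s f hs hf
  have h2 : ENNReal.ofReal (C * (s + 2 * R) ^ (((n : ℝ) - 1) / 2 * (p - 2))
      * (∫ z in R..(s + 2 * R), z ^ (-((1 + a - ((n : ℝ) - 1) / 2) * (p / (p - 1))))) ^ (p - 1))
      ≤ ENNReal.ofReal (C * A ^ (p - 1) * (s + 2 * R) ^ (((n : ℝ) - 1) / 2 * (p - 2))
        * Λ s ^ (p - 1)) := by
    refine ENNReal.ofReal_le_ofReal ?_
    have hI : 0 ≤ ∫ z in R..(s + 2 * R),
        z ^ (-((1 + a - ((n : ℝ) - 1) / 2) * (p / (p - 1)))) :=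
      intervalIntegral.integral_nonneg (by linarith) fun z hz =>
        Real.rpow_nonneg (by linarith [hz.1]) _
    have h3 := Real.rpow_le_rpow hI (hΛ s hs) (show 0 ≤ p - 1 by linarith)
    rw [Real.mul_rpow hA.le hL.le] at h3
    calc _ ≤ C * (s + 2 * R) ^ (((n : ℝ) - 1) / 2 * (p - 2)) * (A ^ (p - 1) * Λ s ^ (p - 1)) := by
          gcongr
      _ = _ := by ring
  have h4 : 0 < C * A ^ (p - 1) * (s + 2 * R) ^ (((n : ℝ) - 1) / 2 * (p - 2)) * Λ s ^ (p - 1) := by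
    positivity
  refine le_trans (le_of_eq ?_) (ofReal_inv_mul_le h4 (h1.trans (mul_le_mul_left h2 _)))
  congr 2
  rw [Real.rpow_neg hT.le, Real.rpow_neg hL.le]
  simp only [mul_inv]

/-! ### Iteration in logarithmic time -/

/-- The logarithmic time `log ((s + 2R) / R)`. -/
noncomputable def logTime (R s : ℝ) : ℝ := Real.log ((s + 2 * R) / R)

/-- The integral inequality `X(t) ≥ c ∫₀ᵗ (t-s)/(t+2R) (s+2R)^e log^{-μ}((s+2R)/R) Y(s)^r ds` on
`[0, t₁]`. -/
def IterationBound (R c e μ r t₁ : ℝ) (X Y : ℝ → ENNReal) : Prop :=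
  ∀ t ∈ Icc 0 t₁, ∫⁻ s in Icc 0 t, ENNReal.ofReal (c * ((t - s) / (t + 2 * R)) * (s + 2 * R) ^ e
    * logTime R s ^ (-μ)) * Y s ^ r ≤ X t

theorem exp_logTime {R s : ℝ} (hR : 0 < R) (hs : 0 ≤ s) :
    R * Real.exp (logTime R s) = s + 2 * R := by
  rw [logTime, Real.exp_log (by positivity), mul_div_cancel₀ _ hR.ne']

theorem logTime_exp {R τ : ℝ} (hR : 0 < R) : logTime R (R * Real.exp τ - 2 * R) = τ := by
  rw [logTime, sub_add_cancel, mul_div_cancel_left₀ _ hR.ne', Real.log_exp]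

theorem log_two_le_logTime {R s : ℝ} (hR : 0 < R) (hs : 0 ≤ s) : Real.log 2 ≤ logTime R s := by
  refine Real.log_le_log two_pos ?_
  rw [le_div_iff₀ hR]; linarith

theorem logTime_le_logTime {R s t : ℝ} (hR : 0 < R) (hs : 0 ≤ s) (hst : s ≤ t) :
    logTime R s ≤ logTime R t :=
  Real.log_le_log (by positivity) (by gcongr)

theorem le_of_logTime_le {R s t : ℝ} (hR : 0 < R) (hs : 0 ≤ s) (ht : 0 ≤ t)
    (h : logTime R s ≤ logTime R t) : s ≤ t := by
  have := mul_le_mul_of_nonneg_left (Real.exp_le_exp.2 h) hR.le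
  rw [exp_logTime hR hs, exp_logTime hR ht] at this
  linarith

/-- For d = 2R the measure ds/(s+d) is Lebesgue measure in logarithmic time, so the integral is K
times the logarithmic length of the interval. -/
theorem setLIntegral_inv_add {a b d K : ℝ} (hK : 0 ≤ K) (ha : 0 < a + d) (hab : a ≤ b) :
    ∫⁻ s in Icc a b, ENNReal.ofReal (K * (s + d)⁻¹)
      = ENNReal.ofReal (K * Real.log ((b + d) / (a + d))) := by
  have hpos : ∀ s ∈ Icc a b, 0 < s + d := fun s hs => by linarith [hs.1]
  have hc : ContinuousOn (fun s : ℝ => K * (s + d)⁻¹) (Icc a b) :=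
    continuousOn_const.mul ((by fun_prop : ContinuousOn (fun s : ℝ => s + d) _).inv₀
      fun s hs => (hpos s hs).ne')
  rw [← ofReal_integral_eq_lintegral_ofReal hc.integrableOn_Icc]
  · congr 1
    rw [integral_Icc_eq_integral_Ioc, ← intervalIntegral.integral_of_le hab,
      intervalIntegral.integral_const_mul,
      intervalIntegral.integral_comp_add_right (fun s => s⁻¹) d,
      integral_inv_of_pos ha (by linarith)]
  · exact (ae_restrict_iff' measurableSet_Icc).2 (Eventually.of_forall fun s hs =>
      mul_nonneg hK (inv_nonneg.2 (hpos s hs).le))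

/-- Propagation of a lower bound of power type through an iteration bound, with an arbitrarily short
delay `δ` in logarithmic time. -/
theorem IterationBound.lower_bound {R c e μ r t₁ : ℝ} {X Y : ℝ → ENNReal}
    (h : IterationBound R c e μ r t₁ X Y) (hR : 0 < R) (hc : 0 ≤ c) (hμ : 0 ≤ μ) (hr : 0 ≤ r)
    {t τ₁ δ w Λ M β : ℝ} (ht : t ∈ Icc 0 t₁) (hδ : 0 < δ) (hδ1 : δ ≤ 1) (hτ₁ : Real.log 2 ≤ τ₁)
    (hw : 0 ≤ w) (hwt : τ₁ + w + δ ≤ logTime R t) (hΛ : logTime R t ≤ Λ) (hM : 0 ≤ M)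
    (hY : ∀ s ∈ Icc 0 t, τ₁ ≤ logTime R s → ENNReal.ofReal (M * (s + 2 * R) ^ β) ≤ Y s) :
    ENNReal.ofReal (c * (δ / 2) * w * Λ ^ (-μ) * M ^ r
      * Real.exp (-(|e + 1 + β * r| * (logTime R t - τ₁))) * (t + 2 * R) ^ (e + 1 + β * r)) ≤ X t := by
  have ht0 := ht.1
  have hTt : 0 < t + 2 * R := by linarith
  have hlog2 : 0 < Real.log 2 := Real.log_pos one_lt_two
  have hΛ0 : 0 < Λ := by linarith [log_two_le_logTime hR ht0]
  -- The integral is restricted to logarithmic times in [τ₁, τ₁+w], at distance at least δ before t.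
  -- On this window the integrand will be bounded below by K/(s+2R), whose integral is Kw.
  obtain ⟨s₁, hs₁⟩ : ∃ s₁, s₁ = R * Real.exp τ₁ - 2 * R := ⟨_, rfl⟩
  obtain ⟨s₂, hs₂⟩ : ∃ s₂, s₂ = R * Real.exp (τ₁ + w) - 2 * R := ⟨_, rfl⟩
  have hs₁0 : 0 ≤ s₁ := by
    have := Real.exp_le_exp.2 hτ₁
    rw [Real.exp_log two_pos] at this
    rw [hs₁]; nlinarith
  have hs₁₂ : s₁ ≤ s₂ := by
    have := Real.exp_le_exp.2 (show τ₁ ≤ τ₁ + w by linarith)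
    rw [hs₁, hs₂]; nlinarith
  have hl₁ : logTime R s₁ = τ₁ := by rw [hs₁, logTime_exp hR]
  have hl₂ : logTime R s₂ = τ₁ + w := by rw [hs₂, logTime_exp hR]
  have hs₂t : s₂ ≤ t := le_of_logTime_le hR (hs₁0.trans hs₁₂) ht0 (by linarith)
  obtain ⟨K, hK⟩ : ∃ K, K = c * (δ / 2) * Λ ^ (-μ) * M ^ r
      * Real.exp (-(|e + 1 + β * r| * (logTime R t - τ₁))) * (t + 2 * R) ^ (e + 1 + β * r) :=
    ⟨_, rfl⟩
  have hK0 : 0 ≤ K := by rw [hK]; positivity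
  have hint := setLIntegral_inv_add (d := 2 * R) hK0 (show 0 < s₁ + 2 * R by linarith) hs₁₂
  have hlog : Real.log ((s₂ + 2 * R) / (s₁ + 2 * R)) = w := by
    rw [hs₁, hs₂, sub_add_cancel, sub_add_cancel, mul_div_mul_left _ _ hR.ne', ← Real.exp_sub,
      Real.log_exp]
    ring
  rw [hlog] at hint
  refine le_trans ?_ ((lintegral_mono_set (Icc_subset_Icc hs₁0 hs₂t)).trans (h t ht))
  refine le_trans (le_of_eq ?_) (setLIntegral_mono' (f := fun s =>
    ENNReal.ofReal (K * (s + 2 * R)⁻¹)) measurableSet_Icc fun s hs => ?_)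
  · rw [hint, hK]; congr 1; ring
  · have hs0 : 0 ≤ s := hs₁0.trans hs.1
    have hst : s ≤ t := hs.2.trans hs₂t
    have hTs : 0 < s + 2 * R := by linarith
    have hσ1 : τ₁ ≤ logTime R s := by rw [← hl₁]; exact logTime_le_logTime hR hs₁0 hs.1
    have hσ2 : logTime R s ≤ τ₁ + w := by rw [← hl₂]; exact logTime_le_logTime hR hs0 hs.2
    have hσ0 : 0 < logTime R s := by linarith
    have hYs := hY s ⟨hs0, hst⟩ hσ1
    -- The quotient is 1 - e^{-(τ(t)-τ(s))} ≥ 1 - e^{-δ} ≥ δ/(1+δ), and δ ≤ 1.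
    have e1 : δ / 2 ≤ (t - s) / (t + 2 * R) := by
      have h1 : s + 2 * R = (t + 2 * R) * Real.exp (logTime R s - logTime R t) := by
        rw [← exp_logTime hR hs0, ← exp_logTime hR ht0, mul_assoc, ← Real.exp_add]
        congr 2; ring
      have h2 : Real.exp (logTime R s - logTime R t) ≤ Real.exp (-δ) :=
        Real.exp_le_exp.2 (by linarith)
      have h3 := one_sub_exp_neg_ge hδ.le
      have h4 : δ / 2 ≤ δ / (1 + δ) := div_le_div_of_nonneg_left hδ.le (by linarith) (by linarith)
      have h5 : (t - s) / (t + 2 * R) = 1 - Real.exp (logTime R s - logTime R t) := by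
        rw [div_eq_iff hTt.ne']; linarith
      rw [h5]; linarith
    have e2 : Λ ^ (-μ) ≤ logTime R s ^ (-μ) :=
      Real.rpow_le_rpow_of_nonpos hσ0 (by linarith) (by linarith)
    -- The remaining power of s+2R is moved to t+2R. Its exponent may have either sign, hence the
    -- absolute value; there is no loss when it vanishes.
    have e3 : Real.exp (-(|e + 1 + β * r| * (logTime R t - τ₁))) * (t + 2 * R) ^ (e + 1 + β * r)
        ≤ (s + 2 * R) ^ (e + 1 + β * r) := by
      have h1 : s + 2 * R = Real.exp (logTime R s - logTime R t) * (t + 2 * R) := by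
        rw [← exp_logTime hR hs0, ← exp_logTime hR ht0, mul_left_comm, ← Real.exp_add]
        congr 2; ring
      rw [h1, Real.mul_rpow (Real.exp_pos _).le hTt.le, ← Real.exp_mul]
      refine mul_le_mul_of_nonneg_right (Real.exp_le_exp.2 ?_) (by positivity)
      have h2 : logTime R s ≤ logTime R t := by linarith
      have h3 := neg_abs_le (e + 1 + β * r)
      have h4 := le_abs_self (e + 1 + β * r)
      nlinarith [abs_nonneg (e + 1 + β * r)]
    have e4 : (s + 2 * R) ^ e * ((s + 2 * R) ^ β) ^ r
        = (s + 2 * R) ^ (e + 1 + β * r) * (s + 2 * R)⁻¹ := by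
      rw [← Real.rpow_mul hTs.le, ← Real.rpow_add hTs, ← Real.rpow_neg_one (s + 2 * R),
        ← Real.rpow_add hTs]
      congr 1; ring
    calc ENNReal.ofReal (K * (s + 2 * R)⁻¹)
        ≤ ENNReal.ofReal (c * ((t - s) / (t + 2 * R)) * (s + 2 * R) ^ e * logTime R s ^ (-μ)
            * (M * (s + 2 * R) ^ β) ^ r) := by
          refine ENNReal.ofReal_le_ofReal ?_
          rw [Real.mul_rpow hM (by positivity)]
          calc K * (s + 2 * R)⁻¹ = c * (δ / 2) * Λ ^ (-μ) * M ^ r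
                * ((Real.exp (-(|e + 1 + β * r| * (logTime R t - τ₁)))
                  * (t + 2 * R) ^ (e + 1 + β * r)) * (s + 2 * R)⁻¹) := by rw [hK]; ring
            _ ≤ c * ((t - s) / (t + 2 * R)) * logTime R s ^ (-μ) * M ^ r
                * ((s + 2 * R) ^ (e + 1 + β * r) * (s + 2 * R)⁻¹) := by gcongr
            _ = _ := by rw [← e4]; ring
      _ = ENNReal.ofReal (c * ((t - s) / (t + 2 * R)) * (s + 2 * R) ^ e * logTime R s ^ (-μ))
            * ENNReal.ofReal (M * (s + 2 * R) ^ β) ^ r := by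
          have h0 : 0 ≤ (t - s) / (t + 2 * R) := (by linarith : 0 ≤ δ / 2).trans e1
          rw [ENNReal.ofReal_mul (by positivity), ENNReal.ofReal_rpow_of_nonneg (by positivity) hr]
      _ ≤ _ := by gcongr

/-- Growth of the constants in a superlinear recursion with geometric losses. -/
theorem superlinear_iteration {P : ℕ → ℝ → Prop} {K B ρ M₀ : ℝ} (hB : 1 < B)
    (hρ : 1 < ρ) (hM₀ : 0 < M₀) (hmono : ∀ j M M', M' ≤ M → P j M → P j M')
    (hstep : ∀ j M, 0 < M → P j M → P (j + 1) (K * (B ^ j)⁻¹ * M ^ ρ)) (h0 : P 0 M₀)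
    (hbig : B ^ (1 / (ρ - 1)) ≤ K * M₀ ^ (ρ - 1)) :
    ∀ j : ℕ, P j (M₀ * (B ^ (1 / (ρ - 1))) ^ j) := by
  have hB0 : 0 < B := by linarith
  have hρ1 : 0 < ρ - 1 := by linarith
  obtain ⟨A, hA⟩ : ∃ A, A = B ^ (1 / (ρ - 1)) := ⟨_, rfl⟩
  have hA0 : 0 < A := by rw [hA]; positivity
  have hAB : A ^ (ρ - 1) = B := by
    rw [hA, ← Real.rpow_mul hB0.le, one_div_mul_cancel hρ1.ne', Real.rpow_one]
  rw [← hA] at hbig ⊢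
  intro j
  induction j with
  | zero => simpa using h0
  | succ j ih =>
    have hMj : 0 < M₀ * A ^ j := by positivity
    refine hmono _ _ _ ?_ (hstep j _ hMj ih)
    -- A = B^{1/(ρ-1)} is chosen so that (A^j)^{ρ-1} = B^j cancels the loss of step j exactly; what
    -- remains is the factor K M₀^{ρ-1} ≥ A.
    have e1 : (M₀ * A ^ j) ^ ρ = M₀ ^ (ρ - 1) * B ^ j * (M₀ * A ^ j) := by
      rw [show ρ = (ρ - 1) + 1 by ring, Real.rpow_add_one hMj.ne', add_sub_cancel_right,
        Real.mul_rpow hM₀.le (by positivity), ← Real.rpow_natCast A j, ← Real.rpow_mul hA0.le,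
        mul_comm (j : ℝ), Real.rpow_mul hA0.le, hAB, Real.rpow_natCast]
    rw [e1]
    calc M₀ * A ^ (j + 1) = A * (M₀ * A ^ j) := by ring
      _ ≤ K * M₀ ^ (ρ - 1) * (M₀ * A ^ j) := by gcongr
      _ = _ := by field_simp

theorem eq_top_of_geometric_le {X : ENNReal} {M A : ℝ} (hM : 0 < M) (hA : 1 < A)
    (h : ∀ j : ℕ, ENNReal.ofReal (M * A ^ j) ≤ X) : X = ⊤ := by
  by_contra hX
  obtain ⟨j, hj⟩ := pow_unbounded_of_one_lt (X.toReal / M) hA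
  rw [div_lt_iff₀ hM] at hj
  have h1 := h j
  rw [ENNReal.ofReal_le_iff_le_toReal hX] at h1
  linarith

/-- The scale-invariant case of `IterationBound.lower_bound`. -/
theorem IterationBound.lower_bound_of_eq_zero {R c e μ r t₁ : ℝ} {X Y : ℝ → ENNReal}
    (h : IterationBound R c e μ r t₁ X Y) (hR : 0 < R) (hc : 0 ≤ c) (hμ : 0 ≤ μ) (hr : 0 ≤ r)
    {t τ₁ δ w Λ M β : ℝ} (hθ : e + 1 + β * r = 0) (ht : t ∈ Icc 0 t₁) (hδ : 0 < δ) (hδ1 : δ ≤ 1)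
    (hτ₁ : Real.log 2 ≤ τ₁)
    (hw : 0 ≤ w) (hwt : τ₁ + w + δ ≤ logTime R t) (hΛ : logTime R t ≤ Λ) (hM : 0 ≤ M)
    (hY : ∀ s ∈ Icc 0 t, τ₁ ≤ logTime R s → ENNReal.ofReal (M * (s + 2 * R) ^ β) ≤ Y s) :
    ENNReal.ofReal (c * (δ / 2) * w * Λ ^ (-μ) * M ^ r) ≤ X t := by
  have := h.lower_bound hR hc hμ hr ht hδ hδ1 hτ₁ hw hwt hΛ hM hY
  simpa [hθ] using this

/-- A lower bound for short delays, with the power `(t + 2R)^θ`, `θ = e + 1 + β r`. -/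
theorem IterationBound.lower_bound_short {R c e μ r t₁ : ℝ} {X Y : ℝ → ENNReal}
    (h : IterationBound R c e μ r t₁ X Y) (hR : 0 < R) (hc : 0 ≤ c) (hμ : 0 ≤ μ) (hr : 0 ≤ r)
    {t τ₀ δ Λ M β : ℝ} (ht : t ∈ Icc 0 t₁) (hδ : 0 < δ) (hδ1 : δ ≤ 1)
    (hτ₀ : Real.log 2 ≤ τ₀) (hwt : τ₀ + 2 * δ ≤ logTime R t) (hΛ : logTime R t ≤ Λ) (hM : 0 ≤ M)
    (hY : ∀ s ∈ Icc 0 t, τ₀ ≤ logTime R s → ENNReal.ofReal (M * (s + 2 * R) ^ β) ≤ Y s) :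
    ENNReal.ofReal (c * (δ ^ 2 / 2) * Λ ^ (-μ) * M ^ r * Real.exp (-(2 * |e + 1 + β * r|))
      * (t + 2 * R) ^ (e + 1 + β * r)) ≤ X t := by
  have hlog2 : 0 < Real.log 2 := Real.log_pos one_lt_two
  have hΛ0 : 0 < Λ := by linarith
  have hT : 0 < t + 2 * R := by linarith [ht.1]
  refine le_trans (ENNReal.ofReal_le_ofReal ?_) (h.lower_bound hR hc hμ hr ht hδ hδ1
    (τ₁ := logTime R t - 2 * δ) (w := δ) (by linarith) hδ.le (by linarith) hΛ hM
    fun s hs hσ => hY s hs (by linarith))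
  have h1 : Real.exp (-(2 * |e + 1 + β * r|))
      ≤ Real.exp (-(|e + 1 + β * r| * (logTime R t - (logTime R t - 2 * δ)))) := by
    refine Real.exp_le_exp.2 ?_
    have := abs_nonneg (e + 1 + β * r)
    nlinarith
  calc _ = c * (δ / 2) * δ * Λ ^ (-μ) * M ^ r * Real.exp (-(2 * |e + 1 + β * r|))
        * (t + 2 * R) ^ (e + 1 + β * r) := by ring
    _ ≤ _ := by gcongr

/-- Blow-up of a symmetric critical iteration. -/
theorem exists_blowup_symmetric {R p c : ℝ} (hR : 0 < R) (hp : 1 < p) (hc : 0 < c) :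
    ∃ C : ℝ, 1 ≤ C ∧ ∀ ε : ℝ, 0 < ε → ε ≤ 1 → ∀ (F G F₁ G₁ : ℝ → ENNReal) (t₁ : ℝ),
      t₁ = R * Real.exp (2 * (C * ε ^ (-(p * (p - 1))))) - 2 * R → 0 ≤ t₁ →
      IterationBound R c (-1) (p - 1) p t₁ F G → IterationBound R c (-1) (p - 1) p t₁ G F →
      IterationBound R c (-1) 0 p t₁ F G₁ → IterationBound R c (-1) 0 p t₁ G F₁ →
      (∀ t ∈ Icc 0 t₁, 1 ≤ t → ENNReal.ofReal (c * ε) ≤ F₁ t) →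
      (∀ t ∈ Icc 0 t₁, 1 ≤ t → ENNReal.ofReal (c * ε) ≤ G₁ t) → F t₁ = ⊤ := by
  have hp0 : 0 < p := by linarith
  have hp1 : 0 < p - 1 := by linarith
  have hlog2 : 0 < Real.log 2 := Real.log_pos one_lt_two
  obtain ⟨τs, hτs⟩ : ∃ τs, τs = logTime R 1 := ⟨_, rfl⟩
  have hτs2 : Real.log 2 ≤ τs := by rw [hτs]; exact log_two_le_logTime hR zero_le_one
  have hτs0 : 0 < τs := by linarith
  -- k collects the constants in K M₀^{p-1} = k L ε^{p(p-1)}, where L^{-(p-1)} from the logarithm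
  -- cancels against L^{p-1} from M₀. The term A/k in C makes this at least A.
  obtain ⟨k, hk⟩ : ∃ k : ℝ, k = c / 32 * 2 ^ (-(p - 1)) * (c / 4 * c ^ p) ^ (p - 1) := ⟨_, rfl⟩
  have hk0 : 0 < k := by rw [hk]; positivity
  obtain ⟨A, hA⟩ : ∃ A : ℝ, A = 4 ^ (1 / (p - 1)) := ⟨_, rfl⟩
  have hA1 : 1 < A := by rw [hA]; exact Real.one_lt_rpow (by norm_num) (by positivity)
  have hAk : 0 < A / k := by positivity
  refine ⟨2 * (τs + 1) + 1 + A / k, by linarith, ?_⟩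
  intro ε hε hε1 F G F₁ G₁ t₁ ht₁ ht₁0 hFG hGF hFG₁ hGF₁ hF₁ hG₁
  obtain ⟨L, hL⟩ : ∃ L : ℝ, L = (2 * (τs + 1) + 1 + A / k) * ε ^ (-(p * (p - 1))) := ⟨_, rfl⟩
  rw [← hL] at ht₁
  have hεpow : 1 ≤ ε ^ (-(p * (p - 1))) :=
    Real.one_le_rpow_of_pos_of_le_one_of_nonpos hε hε1 (by nlinarith)
  have hLbig : 2 * (τs + 1) + 1 ≤ L := by rw [hL]; nlinarith
  have hL1 : 1 ≤ L := by linarith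
  have hL0 : 0 < L := by linarith
  have hlt₁ : logTime R t₁ = 2 * L := by rw [ht₁, logTime_exp hR]
  have hle : ∀ t ∈ Icc 0 t₁, logTime R t ≤ 2 * L := fun t ht => by
    rw [← hlt₁]; exact logTime_le_logTime hR ht.1 ht.2
  -- Value of the first step with delay 1 and window L/2: the factors 1/2 and L/2 give L/4.
  obtain ⟨M₀, hM₀⟩ : ∃ M₀ : ℝ, M₀ = c / 4 * L * (c * ε) ^ p := ⟨_, rfl⟩
  have hM₀0 : 0 < M₀ := by rw [hM₀]; positivity
  -- Step j has delay δ = 2^{-j}/4 and window w = L 2^{-j}/4, so that δw/2 = L 4^{-j}/32. Since L ≥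
  -- 1, δ + w fits into the gap L/2^{j+1} between consecutive thresholds.
  obtain ⟨K, hK⟩ : ∃ K : ℝ, K = c / 32 * L * (2 * L) ^ (-(p - 1)) := ⟨_, rfl⟩
  -- the first step
  have hstart : ∀ X Y : ℝ → ENNReal, IterationBound R c (-1) 0 p t₁ X Y →
      (∀ t ∈ Icc 0 t₁, 1 ≤ t → ENNReal.ofReal (c * ε) ≤ Y t) →
      ∀ t ∈ Icc 0 t₁, L ≤ logTime R t → ENNReal.ofReal M₀ ≤ X t := by
    intro X Y hXY hY t ht hLt
    refine le_trans (ENNReal.ofReal_le_ofReal ?_) (hXY.lower_bound_of_eq_zero hR hc.le le_rfl hp0.le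
      (β := 0) (M := c * ε) (τ₁ := τs) (δ := 1) (w := L / 2) (by ring) ht one_pos le_rfl hτs2
      (by positivity) (by linarith) (hle t ht) (by positivity) ?_)
    · rw [hM₀, neg_zero, Real.rpow_zero]
      refine le_of_eq ?_; ring
    · intro s hs hσ
      rw [Real.rpow_zero, mul_one]
      exact hY s ⟨hs.1, hs.2.trans ht.2⟩
        (le_of_logTime_le hR zero_le_one hs.1 (by rwa [← hτs]))
  -- the induction step
  have hind : ∀ X Y : ℝ → ENNReal, IterationBound R c (-1) (p - 1) p t₁ X Y → ∀ (j : ℕ) (M : ℝ),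
      0 < M → (∀ t ∈ Icc 0 t₁, 2 * L - L / 2 ^ j ≤ logTime R t → ENNReal.ofReal M ≤ Y t) →
      ∀ t ∈ Icc 0 t₁, 2 * L - L / 2 ^ (j + 1) ≤ logTime R t →
        ENNReal.ofReal (K * (4 ^ j)⁻¹ * M ^ p) ≤ X t := by
    intro X Y hXY j M hM hY t ht hLt
    have h2j : (1 : ℝ) ≤ 2 ^ j := one_le_pow₀ (by norm_num)
    have hLj : L / 2 ^ j ≤ L := div_le_self hL0.le h2j
    have e1 : L / 2 ^ (j + 1) = L / 2 ^ j / 2 := by rw [pow_succ, div_div]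
    have e2 : (1 : ℝ) / 2 ^ j ≤ L / 2 ^ j := by gcongr
    have e3 : (1 : ℝ) / 2 ^ j ≤ 1 := div_le_self zero_le_one h2j
    refine le_trans (ENNReal.ofReal_le_ofReal ?_) (hXY.lower_bound_of_eq_zero hR hc.le hp1.le hp0.le
      (β := 0) (M := M) (τ₁ := 2 * L - L / 2 ^ j) (δ := 1 / 2 ^ j / 4) (w := L / 2 ^ j / 4)
      (by ring) ht (by positivity) (by linarith) (by linarith) (by positivity)
      (by linarith) (hle t ht) hM.le ?_)
    · rw [hK]
      have e4 : (4 : ℝ) ^ j = 2 ^ j * 2 ^ j := by rw [← mul_pow]; norm_num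
      rw [e4]
      refine le_of_eq ?_
      field_simp
      ring
    · intro s hs hσ
      rw [Real.rpow_zero, mul_one]
      exact hY s ⟨hs.1, hs.2.trans ht.2⟩ hσ
  have hbig : (4 : ℝ) ^ (1 / (p - 1)) ≤ K * M₀ ^ (p - 1) := by
    have e1 : ε ^ (-(p * (p - 1))) * ε ^ (p * (p - 1)) = 1 := by
      rw [← Real.rpow_add hε, neg_add_cancel, Real.rpow_zero]
    have e2 : K * M₀ ^ (p - 1) = k * (L * ε ^ (p * (p - 1))) := by
      rw [hK, hM₀, hk, Real.mul_rpow hc.le hε.le, Real.mul_rpow (by norm_num) hL0.le,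
        show c / 4 * L * (c ^ p * ε ^ p) = (c / 4 * c ^ p) * (L * ε ^ p) by ring,
        Real.mul_rpow (by positivity) (by positivity), Real.mul_rpow hL0.le (by positivity),
        ← Real.rpow_mul hε.le]
      have e3 : L ^ (-(p - 1)) * L ^ (p - 1) = 1 := by
        rw [← Real.rpow_add hL0, neg_add_cancel, Real.rpow_zero]
      linear_combination (c / 32 * 2 ^ (-(p - 1)) * (c / 4 * c ^ p) ^ (p - 1) * L
        * ε ^ (p * (p - 1))) * e3
    rw [e2, hL, mul_assoc, e1, mul_one, ← hA, mul_add, mul_div_cancel₀ _ hk0.ne']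
    have : 0 ≤ k * (2 * (τs + 1) + 1) := by positivity
    linarith
  have hall := superlinear_iteration (P := fun j M => ∀ t ∈ Icc 0 t₁,
      2 * L - L / 2 ^ j ≤ logTime R t → ENNReal.ofReal M ≤ F t ∧ ENNReal.ofReal M ≤ G t)
    (K := K) (by norm_num : (1 : ℝ) < 4) hp hM₀0
    (fun j M M' hMM h t ht hLt => ⟨(ENNReal.ofReal_le_ofReal hMM).trans (h t ht hLt).1,
      (ENNReal.ofReal_le_ofReal hMM).trans (h t ht hLt).2⟩)
    (fun j M hM h t ht hLt => ⟨hind F G hFG j M hM (fun s hs hσ => (h s hs hσ).2) t ht hLt,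
      hind G F hGF j M hM (fun s hs hσ => (h s hs hσ).1) t ht hLt⟩)
    (fun t ht hLt => by
      rw [pow_zero, div_one] at hLt
      exact ⟨hstart F G₁ hFG₁ hG₁ t ht (by linarith), hstart G F₁ hGF₁ hF₁ t ht (by linarith)⟩)
    hbig
  rw [← hA] at hall
  refine eq_top_of_geometric_le hM₀0 hA1 fun j => (hall j t₁ ⟨ht₁0, le_rfl⟩ ?_).1
  rw [hlt₁]
  have : 0 < L / 2 ^ j := by positivity
  linarith

/-- Blow-up of a critical iteration for which only one of the two bounds carries a logarithm. -/
theorem exists_blowup_asymmetric {R p q c γ : ℝ} (hR : 0 < R) (hp : 1 < p) (hq : 1 < q)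
    (hc : 0 < c) :
    ∃ C : ℝ, 1 ≤ C ∧ ∀ ε : ℝ, 0 < ε → ε ≤ 1 → ∀ (F G F₁ : ℝ → ENNReal) (t₁ : ℝ),
      t₁ = R * Real.exp (2 * (C * ε ^ (-(q * (p * q - 1))))) - 2 * R → 0 ≤ t₁ →
      IterationBound R c (γ - 1) (q - 1) q t₁ G F → IterationBound R c (-1 - γ * p) 0 p t₁ F G →
      IterationBound R c (γ - 1) 0 q t₁ G F₁ →
      (∀ t ∈ Icc 0 t₁, 1 ≤ t → ENNReal.ofReal (c * ε) ≤ F₁ t) → F t₁ = ⊤ := by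
  have hp0 : 0 < p := by linarith
  have hq0 : 0 < q := by linarith
  have hq1 : 0 < q - 1 := by linarith
  have hpq : 1 < p * q := by nlinarith
  have hpq1 : 0 < p * q - 1 := by linarith
  have hlog2 : 0 < Real.log 2 := Real.log_pos one_lt_two
  obtain ⟨τs, hτs⟩ : ∃ τs, τs = logTime R 1 := ⟨_, rfl⟩
  have hτs2 : Real.log 2 ≤ τs := by rw [hτs]; exact log_two_le_logTime hR zero_le_one
  have hτs0 : 0 < τs := by linarith
  -- The price of carrying (t+2R)^γ across a window of total logarithmic length 2δ with δ ≤ 1. Only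
  -- short windows are used for G, so this price does not depend on L.
  obtain ⟨η, hη⟩ : ∃ η : ℝ, η = Real.exp (-(2 * |γ|)) := ⟨_, rfl⟩
  have hη0 : 0 < η := by rw [hη]; positivity
  obtain ⟨k₁, hk₁⟩ : ∃ k₁ : ℝ, k₁ = c / 128 * (c / 128 * 2 ^ (-(q - 1)) * η) ^ p := ⟨_, rfl⟩
  obtain ⟨k₂, hk₂⟩ : ∃ k₂ : ℝ, k₂ = c / 4 * (c / 2 * c ^ q * η) ^ p := ⟨_, rfl⟩
  have hk₁0 : 0 < k₁ := by rw [hk₁]; positivity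
  have hk₂0 : 0 < k₂ := by rw [hk₂]; positivity
  obtain ⟨k, hk⟩ : ∃ k : ℝ, k = k₁ * k₂ ^ (p * q - 1) := ⟨_, rfl⟩
  have hk0 : 0 < k := by rw [hk]; positivity
  have hB : (1 : ℝ) < 4 ^ (1 + p) := Real.one_lt_rpow (by norm_num) (by linarith)
  obtain ⟨A, hA⟩ : ∃ A : ℝ, A = ((4 : ℝ) ^ (1 + p)) ^ (1 / (p * q - 1)) := ⟨_, rfl⟩
  have hA1 : 1 < A := by rw [hA]; exact Real.one_lt_rpow hB (by positivity)
  have hA0 : 0 < A := by linarith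
  obtain ⟨C, hC⟩ : ∃ C : ℝ, C = 2 * (τs + 3) + 1 + (A / k) ^ (1 / p) := ⟨_, rfl⟩
  have hAk : 0 < (A / k) ^ (1 / p) := by positivity
  have hC0 : 0 < C := by rw [hC]; positivity
  refine ⟨C, by rw [hC]; linarith, ?_⟩
  intro ε hε hε1 F G F₁ t₁ ht₁ ht₁0 hGF hFG hGF₁ hF₁
  obtain ⟨L, hL⟩ : ∃ L : ℝ, L = C * ε ^ (-(q * (p * q - 1))) := ⟨_, rfl⟩
  rw [← hL] at ht₁
  have hεpow : 1 ≤ ε ^ (-(q * (p * q - 1))) :=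
    Real.one_le_rpow_of_pos_of_le_one_of_nonpos hε hε1 (by nlinarith)
  have hLbig : 2 * (τs + 3) + 1 ≤ L := by rw [hL]; nlinarith
  have hL1 : 1 ≤ L := by linarith
  have hL0 : 0 < L := by linarith
  have hlt₁ : logTime R t₁ = 2 * L := by rw [ht₁, logTime_exp hR]
  have hle : ∀ t ∈ Icc 0 t₁, logTime R t ≤ 2 * L := fun t ht => by
    rw [← hlt₁]; exact logTime_le_logTime hR ht.1 ht.2
  have hθG : γ - 1 + 1 + 0 * q = γ := by ring
  have hθF : -1 - γ * p + 1 + γ * p = 0 := by ring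
  obtain ⟨M₀, hM₀⟩ : ∃ M₀ : ℝ, M₀ = c / 4 * L * (c / 2 * (c * ε) ^ q * η) ^ p := ⟨_, rfl⟩
  have hM₀0 : 0 < M₀ := by rw [hM₀]; positivity
  -- With δ = 2^{-j}/8, the bound for G has the factor δ²/2 = 4^{-j}/128. The bound for F has window
  -- L 2^{-j}/8 and the factor L 4^{-j}/128. Composing them loses (4^{1+p})^j.
  obtain ⟨K, hK⟩ : ∃ K : ℝ, K = c / 128 * L * (c / 128 * (2 * L) ^ (-(q - 1)) * η) ^ p := ⟨_, rfl⟩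
  -- the first step
  have hstartG : ∀ t ∈ Icc 0 t₁, τs + 2 ≤ logTime R t →
      ENNReal.ofReal (c / 2 * (c * ε) ^ q * η * (t + 2 * R) ^ γ) ≤ G t := by
    intro t ht hLt
    have := hGF₁.lower_bound_short hR hc.le le_rfl hq0.le (β := 0) (M := c * ε) (τ₀ := τs) (δ := 1)
      ht one_pos le_rfl hτs2 (by linarith) (hle t ht) (by positivity) (fun s hs hσ => by
        rw [Real.rpow_zero, mul_one]
        exact hF₁ s ⟨hs.1, hs.2.trans ht.2⟩
          (le_of_logTime_le hR zero_le_one hs.1 (by rwa [← hτs])))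
    rw [hθG, ← hη, neg_zero, Real.rpow_zero] at this
    refine le_trans (ENNReal.ofReal_le_ofReal (le_of_eq ?_)) this
    ring
  have hstart : ∀ t ∈ Icc 0 t₁, L ≤ logTime R t → ENNReal.ofReal M₀ ≤ F t := by
    intro t ht hLt
    refine le_trans (ENNReal.ofReal_le_ofReal ?_) (hFG.lower_bound_of_eq_zero hR hc.le le_rfl hp0.le
      (β := γ) (M := c / 2 * (c * ε) ^ q * η) (τ₁ := τs + 2) (δ := 1) (w := L / 2) hθF ht one_pos
      le_rfl (by linarith) (by positivity) (by linarith) (hle t ht) (by positivity)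
      fun s hs hσ => hstartG s ⟨hs.1, hs.2.trans ht.2⟩ hσ)
    rw [hM₀, neg_zero, Real.rpow_zero]
    refine le_of_eq ?_; ring
  -- the induction step
  have hind : ∀ (j : ℕ) (M : ℝ), 0 < M →
      (∀ t ∈ Icc 0 t₁, 2 * L - L / 2 ^ j ≤ logTime R t → ENNReal.ofReal M ≤ F t) →
      ∀ t ∈ Icc 0 t₁, 2 * L - L / 2 ^ (j + 1) ≤ logTime R t →
        ENNReal.ofReal (K * (((4 : ℝ) ^ (1 + p)) ^ j)⁻¹ * M ^ (p * q)) ≤ F t := by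
    intro j M hM hF t ht hLt
    have h2j : (1 : ℝ) ≤ 2 ^ j := one_le_pow₀ (by norm_num)
    have hLj : L / 2 ^ j ≤ L := div_le_self hL0.le h2j
    have e1 : L / 2 ^ (j + 1) = L / 2 ^ j / 2 := by rw [pow_succ, div_div]
    have e2 : (1 : ℝ) / 2 ^ j ≤ L / 2 ^ j := by gcongr
    have e3 : (1 : ℝ) / 2 ^ j ≤ 1 := div_le_self zero_le_one h2j
    obtain ⟨δ, hδ⟩ : ∃ δ : ℝ, δ = 1 / 2 ^ j / 8 := ⟨_, rfl⟩
    have hδ0 : 0 < δ := by rw [hδ]; positivity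
    have hδ1 : δ ≤ 1 := by rw [hδ]; linarith
    obtain ⟨M', hM'⟩ : ∃ M' : ℝ, M' = c * (δ ^ 2 / 2) * (2 * L) ^ (-(q - 1)) * M ^ q * η :=
      ⟨_, rfl⟩
    have hM'0 : 0 < M' := by rw [hM']; positivity
    have hG : ∀ s ∈ Icc 0 t, 2 * L - L / 2 ^ j + 2 * δ ≤ logTime R s →
        ENNReal.ofReal (M' * (s + 2 * R) ^ γ) ≤ G s := by
      intro s hs hσ
      have hs' : s ∈ Icc 0 t₁ := ⟨hs.1, hs.2.trans ht.2⟩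
      have := hGF.lower_bound_short hR hc.le hq1.le hq0.le (β := 0) (M := M)
        (τ₀ := 2 * L - L / 2 ^ j) (δ := δ) hs' hδ0 hδ1 (by linarith) hσ (hle s hs') hM.le
        (fun r hr hρ => by
          rw [Real.rpow_zero, mul_one]
          exact hF r ⟨hr.1, hr.2.trans hs'.2⟩ hρ)
      rwa [hθG, ← hη, ← hM'] at this
    refine le_trans (ENNReal.ofReal_le_ofReal ?_) (hFG.lower_bound_of_eq_zero hR hc.le le_rfl hp0.le
      (β := γ) (M := M') (τ₁ := 2 * L - L / 2 ^ j + 2 * δ) (δ := δ) (w := L / 2 ^ j / 8) hθF ht hδ0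
      hδ1 (by linarith) (by positivity) (by linarith) (hle t ht) hM'0.le hG)
    have e4 : (4 : ℝ) ^ j = 2 ^ j * 2 ^ j := by rw [← mul_pow]; norm_num
    have e5 : M' = (c / 128 * (2 * L) ^ (-(q - 1)) * η) * ((4 ^ j)⁻¹ * M ^ q) := by
      rw [hM', hδ, e4]; field_simp; ring
    have e6 : M' ^ p = (c / 128 * (2 * L) ^ (-(q - 1)) * η) ^ p
        * (((4 : ℝ) ^ j) ^ p)⁻¹ * M ^ (p * q) := by
      rw [e5, Real.mul_rpow (by positivity) (by positivity), Real.mul_rpow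
        (x := ((4 : ℝ) ^ j)⁻¹) (by positivity) (by positivity), Real.inv_rpow (by positivity),
        ← Real.rpow_mul hM.le, mul_comm q p]
      ring
    have e7 : ((4 : ℝ) ^ (1 + p)) ^ j = 4 ^ j * ((4 : ℝ) ^ j) ^ p := by
      rw [Real.rpow_add (by norm_num), Real.rpow_one, mul_pow, ← Real.rpow_natCast (4 ^ p) j,
        ← Real.rpow_natCast 4 j, ← Real.rpow_mul (by norm_num), ← Real.rpow_mul (by norm_num),
        mul_comm p]
    rw [neg_zero, Real.rpow_zero, e6, hK, e7, hδ]
    refine le_of_eq ?_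
    have e8 : (4 : ℝ) ^ j ≠ 0 := by positivity
    rw [mul_inv, show ((4 : ℝ) ^ j)⁻¹ = (2 ^ j)⁻¹ * (2 ^ j)⁻¹ by rw [e4, mul_inv]]
    ring
  -- K carries L^{1-(q-1)p} and M₀^{pq-1} carries L^{pq-1} ε^{pq(pq-1)}; the product is k L^p
  -- ε^{pq(pq-1)}. Taking p-th roots gives the lifespan exponent q(pq-1).
  have hbig : ((4 : ℝ) ^ (1 + p)) ^ (1 / (p * q - 1)) ≤ K * M₀ ^ (p * q - 1) := by
    have e1 : ε ^ (-(q * (p * q - 1)) * p) * ε ^ (q * p * (p * q - 1)) = 1 := by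
      rw [← Real.rpow_add hε, ← Real.rpow_zero ε]
      congr 1; ring
    have eK : K = k₁ * (L * L ^ (-(q - 1) * p)) := by
      rw [hK, hk₁, Real.mul_rpow (by norm_num) hL0.le,
        show c / 128 * (2 ^ (-(q - 1)) * L ^ (-(q - 1))) * η
          = (c / 128 * 2 ^ (-(q - 1)) * η) * L ^ (-(q - 1)) by ring,
        Real.mul_rpow (by positivity) (by positivity), ← Real.rpow_mul hL0.le]
      ring
    have eM : M₀ = k₂ * (L * ε ^ (q * p)) := by
      rw [hM₀, hk₂, Real.mul_rpow hc.le hε.le,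
        show c / 2 * (c ^ q * ε ^ q) * η = (c / 2 * c ^ q * η) * ε ^ q by ring,
        Real.mul_rpow (by positivity) (by positivity), ← Real.rpow_mul hε.le]
      ring
    have eL : L * L ^ (-(q - 1) * p) * L ^ (p * q - 1) = L ^ p := by
      nth_rewrite 1 [← Real.rpow_one L]
      rw [← Real.rpow_add hL0, ← Real.rpow_add hL0]
      congr 1; ring
    have e2 : K * M₀ ^ (p * q - 1) = k * (L ^ p * ε ^ (q * p * (p * q - 1))) := by
      rw [eK, eM, hk, Real.mul_rpow hk₂0.le (by positivity), Real.mul_rpow hL0.le (by positivity),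
        ← Real.rpow_mul hε.le, ← eL]
      ring
    have e3 : L ^ p * ε ^ (q * p * (p * q - 1)) = C ^ p := by
      rw [hL, Real.mul_rpow hC0.le (by positivity), ← Real.rpow_mul hε.le, mul_assoc, e1, mul_one]
    have e4 : A / k ≤ C ^ p := by
      have h1 : (A / k) ^ (1 / p) ≤ C := by rw [hC]; linarith
      have h2 := Real.rpow_le_rpow hAk.le h1 hp0.le
      rwa [← Real.rpow_mul (by positivity), one_div_mul_cancel hp0.ne', Real.rpow_one] at h2
    rw [e2, e3, ← hA]
    rw [div_le_iff₀ hk0] at e4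
    linarith
  have hall := superlinear_iteration (P := fun j M => ∀ t ∈ Icc 0 t₁,
      2 * L - L / 2 ^ j ≤ logTime R t → ENNReal.ofReal M ≤ F t) (K := K) hB hpq hM₀0
    (fun j M M' hMM h t ht hLt => (ENNReal.ofReal_le_ofReal hMM).trans (h t ht hLt)) hind
    (fun t ht hLt => by
      rw [pow_zero, div_one] at hLt
      exact hstart t ht (by linarith)) hbig
  rw [← hA] at hall
  refine eq_top_of_geometric_le hM₀0 hA1 fun j => hall j t₁ ⟨ht₁0, le_rfl⟩ ?_
  rw [hlt₁]
  have : 0 < L / 2 ^ j := by positivity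
  linarith

/-! ### Iteration bounds for solutions, and lifespan estimates -/

/-- `u` solves `u_tt - Δu + b(t) u_t = |v|^p` with data `ε (u₀, u₁)` in the energy sense, and `u`,
`v` have support in the light cone. -/
structure IsConeSolution (T : EReal) (R p q ε : ℝ) (b : ℝ → ℝ) (u₀ : H1 n) (u₁ : L2 n)
    (u v : ℝ → H1 n) : Prop where
  pos : 0 < T
  mem_u : MemEnergyClass T q u
  mem_v : MemEnergyClass T p v
  init : u 0 = ε • u₀
  eq : WeakEquation T p ε b u₁ u v
  supp_u : SupportedInCone T R u
  supp_v : SupportedInCone T R v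

/-- The assumptions on the dissipation and on the data. -/
structure IsAdmissible (R : ℝ) (b : ℝ → ℝ) (u₀ : H1 n) (u₁ : L2 n) : Prop where
  continuousOn : ContinuousOn b (Ici 0)
  integrableOn : IntegrableOn b (Ici 0)
  nonneg : ∀ t, 0 ≤ t → 0 ≤ b t
  pos_data : NonnegSupportedInBall R (toL2 u₀)
  pos_velocity : NonnegSupportedInBall R u₁
  ne_zero : toL2 u₀ ≠ 0 ∨ u₁ ≠ 0

/-- The functional of a curve along the cone. -/
noncomputable def coneFunctional (R a : ℝ) (u : ℝ → H1 n) (t : ℝ) : ENNReal :=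
  waveFunctional a (t + 2 * R) (toL2 (u t))

/-- The constant may be lowered to any c' ≤ c, so that finitely many such bounds can share a single
constant. -/
theorem IsAdmissible.exists_data_bound {R : ℝ} {b : ℝ → ℝ} {u₀ : H1 n} {u₁ : L2 n}
    (h : IsAdmissible R b u₀ u₁) (hn : 2 ≤ n) (hR : 0 < R) (a : ℝ) {p q : ℝ} (hp : 0 < p) :
    ∃ c : ℝ, 0 < c ∧ ∀ c' ≤ c, ∀ (T : EReal) (ε : ℝ) (u v : ℝ → H1 n), 0 ≤ ε →
      IsConeSolution T R p q ε b u₀ u₁ u v → ∀ t ∈ timeInterval T, 1 ≤ t →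
      ENNReal.ofReal (c' * ε) ≤ coneFunctional R a u t := by
  obtain ⟨c, hc, hfr⟩ := exists_iteration_frame (q := q) hn a hp hR h.continuousOn h.integrableOn
    h.nonneg h.pos_data h.pos_velocity h.ne_zero
  refine ⟨c, hc, fun c' hc' T ε u v hε hu t ht h1 => ?_⟩
  refine (ENNReal.ofReal_le_ofReal ?_).trans
    ((hfr T ε u v hu.pos hε hu.mem_u hu.mem_v hu.init hu.eq hu.supp_u hu.supp_v t ht).1 h1)
  exact mul_le_mul_of_nonneg_right hc' hε

/-- The frame for u followed by Hölder for v: the exponent of s+2R collects -a from the source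
kernel, -N(p-2) from Hölder and -θ(p-1) from the radial integral, whose logarithm contributes
ν(p-1). -/
theorem IsAdmissible.exists_iterationBound {R : ℝ} {b : ℝ → ℝ} {u₀ : H1 n} {u₁ : L2 n}
    (h : IsAdmissible R b u₀ u₁) (hn : 2 ≤ n) (hR : 0 < R) (a : ℝ) {a' p q A θ ν : ℝ} (hp : 1 < p)
    (ha' : ((n : ℝ) - 1) / 2 - 1 < a') (hA : 0 < A)
    (hint : ∀ s, 0 ≤ s → ∫ z in R..(s + 2 * R),
      z ^ (-((1 + a' - ((n : ℝ) - 1) / 2) * (p / (p - 1))))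
        ≤ A * ((s + 2 * R) ^ θ * logTime R s ^ ν)) :
    ∃ c : ℝ, 0 < c ∧ ∀ c' ≤ c, ∀ (T : EReal) (ε : ℝ) (u v : ℝ → H1 n), 0 ≤ ε →
      IsConeSolution T R p q ε b u₀ u₁ u v → ∀ t₁ ∈ timeInterval T,
      IterationBound R c' (-a - ((n : ℝ) - 1) / 2 * (p - 2) - θ * (p - 1)) (ν * (p - 1)) p t₁
        (coneFunctional R a u) (coneFunctional R a' v) := by
  have hlog : ∀ s, 0 ≤ s → 0 < logTime R s := fun s hs =>
    (Real.log_pos one_lt_two).trans_le (log_two_le_logTime hR hs)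
  obtain ⟨c₁, hc₁, hfr⟩ := exists_iteration_frame (q := q) hn a (zero_lt_one.trans hp) hR
    h.continuousOn h.integrableOn h.nonneg h.pos_data h.pos_velocity h.ne_zero
  obtain ⟨c₂, hc₂, hlow⟩ := lintegral_rpow_ge_of_integral_le hn ha' hp hR
    (Λ := fun s => (s + 2 * R) ^ θ * logTime R s ^ ν) hA (fun s hs => by
      have := hlog s hs
      positivity) hint
  refine ⟨c₁ * c₂, by positivity, fun c' hc' T ε u v hε hu t₁ ht₁ t ht => ?_⟩
  have htT : t ∈ timeInterval T := Icc_subset_timeInterval ht₁ ht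
  refine le_trans (setLIntegral_mono' measurableSet_Icc fun s hs => ?_)
    (hfr T ε u v hu.pos hε hu.mem_u hu.mem_v hu.init hu.eq hu.supp_u hu.supp_v t htT).2
  have hT : 0 < s + 2 * R := by linarith [hs.1]
  have hτ := hlog s hs.1
  have hTt : 0 < t + 2 * R := by linarith [ht.1]
  have hts : 0 ≤ (t - s) / (t + 2 * R) := div_nonneg (by linarith [hs.2]) hTt.le
  refine le_trans ?_ (mul_le_mul_right (hlow s (toL2 (v s)) hs.1
    (hu.supp_v s (Icc_subset_timeInterval htT hs))) _)
  rw [← mul_assoc, ← ENNReal.ofReal_mul (by positivity)]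
  refine mul_le_mul_left (ENNReal.ofReal_le_ofReal ?_) _
  have e1 : (s + 2 * R) ^ (-a - ((n : ℝ) - 1) / 2 * (p - 2) - θ * (p - 1))
      = (s + 2 * R) ^ (-a) * (s + 2 * R) ^ (-(((n : ℝ) - 1) / 2 * (p - 2)))
        * (s + 2 * R) ^ (θ * -(p - 1)) := by
    rw [← Real.rpow_add hT, ← Real.rpow_add hT]
    congr 1; ring
  rw [Real.mul_rpow (by positivity) (by positivity), ← Real.rpow_mul hT.le, ← Real.rpow_mul hτ.le,
    e1, show -(ν * (p - 1)) = ν * -(p - 1) by ring]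
  calc _ = c' * ((t - s) / (t + 2 * R) * ((s + 2 * R) ^ (-a)
        * (s + 2 * R) ^ (-(((n : ℝ) - 1) / 2 * (p - 2))) * (s + 2 * R) ^ (θ * -(p - 1))
        * logTime R s ^ (ν * -(p - 1)))) := by ring
    _ ≤ c₁ * c₂ * ((t - s) / (t + 2 * R) * ((s + 2 * R) ^ (-a)
        * (s + 2 * R) ^ (-(((n : ℝ) - 1) / 2 * (p - 2))) * (s + 2 * R) ^ (θ * -(p - 1))
        * logTime R s ^ (ν * -(p - 1)))) := by gcongr
    _ = _ := by ring

/-- The iteration bound with a logarithm, for the critical weight. -/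
theorem IsAdmissible.exists_iterationBound_critical {R : ℝ} {b : ℝ → ℝ} {u₀ : H1 n} {u₁ : L2 n}
    (h : IsAdmissible R b u₀ u₁) (hn : 2 ≤ n) (hR : 0 < R) {a a' p q e : ℝ} (hp : 1 < p)
    (ha' : a' = ((n : ℝ) - 1) / 2 - 1 / p) (he : e = -a - ((n : ℝ) - 1) / 2 * (p - 2)) :
    ∃ c : ℝ, 0 < c ∧ ∀ c' ≤ c, ∀ (T : EReal) (ε : ℝ) (u v : ℝ → H1 n), 0 ≤ ε →
      IsConeSolution T R p q ε b u₀ u₁ u v → ∀ t₁ ∈ timeInterval T,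
      IterationBound R c' e (p - 1) p t₁ (coneFunctional R a u) (coneFunctional R a' v) := by
  have hp0 : 0 < p := by linarith
  have hp1 : p - 1 ≠ 0 := by linarith
  have h1 : 1 / p < 1 := (div_lt_one hp0).2 hp
  have := h.exists_iterationBound (q := q) hn hR a (a' := a') (A := 1) (θ := 0) (ν := 1) hp
    (by linarith) one_pos fun s hs => by
      have e1 : (1 + a' - ((n : ℝ) - 1) / 2) * (p / (p - 1)) = 1 := by
        rw [ha']; field_simp; ring
      rw [e1, integral_rpow_neg_one hR (by linarith), Real.rpow_zero, Real.rpow_one, one_mul,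
        one_mul, logTime]
  simpa only [zero_mul, sub_zero, one_mul, ← he] using this

/-- The iteration bound without loss, for weights above the critical one. -/
theorem IsAdmissible.exists_iterationBound_supercritical {R : ℝ} {b : ℝ → ℝ} {u₀ : H1 n}
    {u₁ : L2 n} (h : IsAdmissible R b u₀ u₁) (hn : 2 ≤ n) (hR : 0 < R) {a a' p q e : ℝ} (hp : 1 < p)
    (ha' : ((n : ℝ) - 1) / 2 - 1 / p < a') (he : e = -a - ((n : ℝ) - 1) / 2 * (p - 2)) :
    ∃ c : ℝ, 0 < c ∧ ∀ c' ≤ c, ∀ (T : EReal) (ε : ℝ) (u v : ℝ → H1 n), 0 ≤ ε →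
      IsConeSolution T R p q ε b u₀ u₁ u v → ∀ t₁ ∈ timeInterval T,
      IterationBound R c' e 0 p t₁ (coneFunctional R a u) (coneFunctional R a' v) := by
  have hp0 : 0 < p := by linarith
  have hp1 : 0 < p - 1 := by linarith
  have h1 : 1 / p < 1 := (div_lt_one hp0).2 hp
  obtain ⟨κ, hκ⟩ : ∃ κ, κ = (1 + a' - ((n : ℝ) - 1) / 2) * (p / (p - 1)) := ⟨_, rfl⟩
  have hκ1 : 1 < κ := by
    have e1 : (1 - 1 / p) * (p / (p - 1)) = 1 := by field_simp
    rw [hκ]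
    refine e1.symm.trans_lt (mul_lt_mul_of_pos_right ?_ (div_pos hp0 hp1))
    linarith
  have hκ0 : 0 < κ - 1 := by linarith
  have := h.exists_iterationBound (q := q) hn hR a (a' := a') (A := R ^ (1 - κ) / (κ - 1)) (θ := 0)
    (ν := 0) hp (by linarith) (by positivity) fun s hs => by
      rw [← hκ, Real.rpow_zero, Real.rpow_zero, mul_one, mul_one]
      exact integral_rpow_neg_le_of_one_lt hR (by linarith) hκ1
  simpa only [zero_mul, sub_zero, ← he] using this

/-- The iteration bound with a power loss, for weights below the critical one. -/
theorem IsAdmissible.exists_iterationBound_subcritical {R : ℝ} {b : ℝ → ℝ} {u₀ : H1 n}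
    {u₁ : L2 n} (h : IsAdmissible R b u₀ u₁) (hn : 2 ≤ n) (hR : 0 < R) {a a' p q e : ℝ} (hp : 1 < p)
    (ha0 : ((n : ℝ) - 1) / 2 - 1 < a') (ha' : a' < ((n : ℝ) - 1) / 2 - 1 / p)
    (he : e = -a - ((n : ℝ) - 1) / 2 * (p - 2) - ((((n : ℝ) - 1) / 2 - a') * p - 1)) :
    ∃ c : ℝ, 0 < c ∧ ∀ c' ≤ c, ∀ (T : EReal) (ε : ℝ) (u v : ℝ → H1 n), 0 ≤ ε →
      IsConeSolution T R p q ε b u₀ u₁ u v → ∀ t₁ ∈ timeInterval T,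
      IterationBound R c' e 0 p t₁ (coneFunctional R a u) (coneFunctional R a' v) := by
  have hp0 : 0 < p := by linarith
  have hp1 : 0 < p - 1 := by linarith
  obtain ⟨κ, hκ⟩ : ∃ κ, κ = (1 + a' - ((n : ℝ) - 1) / 2) * (p / (p - 1)) := ⟨_, rfl⟩
  have hκ1 : κ < 1 := by
    have e1 : (1 - 1 / p) * (p / (p - 1)) = 1 := by field_simp
    rw [hκ]
    refine (mul_lt_mul_of_pos_right ?_ (div_pos hp0 hp1)).trans_eq e1
    linarith
  have hκ0 : 0 < 1 - κ := by linarith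
  have := h.exists_iterationBound (q := q) hn hR a (a' := a') (A := (1 - κ)⁻¹) (θ := 1 - κ)
    (ν := 0) hp ha0 (by positivity) fun s hs => by
      rw [← hκ, Real.rpow_zero, mul_one]
      exact integral_rpow_neg_le_of_lt_one hR hκ1
  have e2 : (1 - κ) * (p - 1) = (((n : ℝ) - 1) / 2 - a') * p - 1 := by
    rw [hκ]; field_simp; ring
  simpa only [zero_mul, e2, ← he] using this

theorem IsConeSolution.coneFunctional_lt_top {T : EReal} {R p q ε : ℝ} {b : ℝ → ℝ} {u₀ : H1 n}
    {u₁ : L2 n} {u v : ℝ → H1 n} (h : IsConeSolution T R p q ε b u₀ u₁ u v) (hn : 2 ≤ n)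
    (hR : 0 < R) {a t : ℝ} (ha : ((n : ℝ) - 1) / 2 - 1 < a) (ht : t ∈ timeInterval T) :
    coneFunctional R a u t < ⊤ :=
  waveFunctional_lt_top hn ha hR ht.1 (h.supp_u t ht)

/-- If the critical time is not reached then the lifespan is at most exponential. -/
theorem le_exp_of_notMem_timeInterval {T : EReal} {R C x : ℝ} (hR : 0 < R) (hC : 1 ≤ C)
    (hx : 1 ≤ x)
    (h : R * Real.exp (2 * (C * x)) - 2 * R ∈ timeInterval T → False) :
    T ≤ ((Real.exp ((2 * C + |Real.log R|) * x) : ℝ) : EReal) := by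
  by_contra! hlt
  refine h ⟨?_, lt_of_le_of_lt (EReal.coe_le_coe_iff.2 ?_) hlt⟩
  · have h1 := Real.add_one_le_exp (2 * (C * x))
    have h2 : 1 ≤ C * x := one_le_mul_of_one_le_of_one_le hC hx
    nlinarith
  · have h2 : R * Real.exp (2 * (C * x)) ≤ Real.exp ((2 * C + |Real.log R|) * x) := by
      nth_rewrite 1 [← Real.exp_log hR]
      rw [← Real.exp_add]
      refine Real.exp_le_exp.2 ?_
      have := le_abs_self (Real.log R)
      have := abs_nonneg (Real.log R)
      nlinarith
    linarith

/-- The lifespan bound for equal exponents. -/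
theorem exists_lifespan_bound_of_eq (hn : 2 ≤ n) {p R : ℝ} (hp : 1 < p) (hR : 0 < R)
    (hcrit : (p + 1) / (p * (p - 1)) = ((n : ℝ) - 1) / 2) {b₁ b₂ : ℝ → ℝ}
    {u₀ v₀ : H1 n} {u₁ v₁ : L2 n} (hu : IsAdmissible R b₁ u₀ u₁) (hv : IsAdmissible R b₂ v₀ v₁) :
    ∃ C : ℝ, 0 < C ∧ ∀ ε : ℝ, 0 < ε → ε ≤ 1 → ∀ (T : EReal) (u v : ℝ → H1 n),
      IsConeSolution T R p p ε b₁ u₀ u₁ u v → IsConeSolution T R p p ε b₂ v₀ v₁ v u →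
      T ≤ ((Real.exp (C * ε ^ (-(p * (p - 1)))) : ℝ) : EReal) := by
  have hp0 : 0 < p := by linarith
  have hp1 : 0 < p - 1 := by linarith
  obtain ⟨a, ha⟩ : ∃ a : ℝ, a = ((n : ℝ) - 1) / 2 - 1 / p := ⟨_, rfl⟩
  have hpinv : 1 / p < 1 := (div_lt_one hp0).2 hp
  have ha0 : ((n : ℝ) - 1) / 2 - 1 < a := by linarith
  -- This is criticality: the powers of s+2R combine to exactly -1, the scale-invariant exponent.
  have he : (-1 : ℝ) = -a - ((n : ℝ) - 1) / 2 * (p - 2) := by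
    rw [ha, ← hcrit]; field_simp; ring
  obtain ⟨c₁, hc₁, h₁⟩ := hu.exists_iterationBound_critical (q := p) hn hR hp ha he
  obtain ⟨c₂, hc₂, h₂⟩ := hv.exists_iterationBound_critical (q := p) hn hR hp ha he
  -- The bounds with source weight a+1 serve only the first step: the data bound holds for every
  -- weight, and above the critical one the Hölder step loses no logarithm. The target weight
  -- remains a.
  obtain ⟨c₃, hc₃, h₃⟩ := hu.exists_iterationBound_supercritical (q := p) (a' := a + 1) hn hR hp
    (by linarith) he
  obtain ⟨c₄, hc₄, h₄⟩ := hv.exists_iterationBound_supercritical (q := p) (a' := a + 1) hn hR hp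
    (by linarith) he
  obtain ⟨c₅, hc₅, h₅⟩ := hu.exists_data_bound (q := p) hn hR (a + 1) hp0
  obtain ⟨c₆, hc₆, h₆⟩ := hv.exists_data_bound (q := p) hn hR (a + 1) hp0
  obtain ⟨c, hc, hcs⟩ : ∃ c : ℝ, 0 < c ∧ c ≤ c₁ ∧ c ≤ c₂ ∧ c ≤ c₃ ∧ c ≤ c₄ ∧ c ≤ c₅ ∧ c ≤ c₆ :=
    ⟨min c₁ (min c₂ (min c₃ (min c₄ (min c₅ c₆)))), by simp [*], by simp⟩
  obtain ⟨C, hC, hblow⟩ := exists_blowup_symmetric (c := c) hR hp hc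
  refine ⟨2 * C + |Real.log R|, by positivity, fun ε hε hε1 T u v hsu hsv => ?_⟩
  refine le_exp_of_notMem_timeInterval hR hC
    (Real.one_le_rpow_of_pos_of_le_one_of_nonpos hε hε1 (by nlinarith)) fun hmem => ?_
  refine (hsu.coneFunctional_lt_top hn hR ha0 hmem).ne (hblow ε hε hε1 _ (coneFunctional R a v)
    (coneFunctional R (a + 1) u) (coneFunctional R (a + 1) v) _ rfl hmem.1
    (h₁ c hcs.1 T ε u v hε.le hsu _ hmem) (h₂ c hcs.2.1 T ε v u hε.le hsv _ hmem)
    (h₃ c hcs.2.2.1 T ε u v hε.le hsu _ hmem) (h₄ c hcs.2.2.2.1 T ε v u hε.le hsv _ hmem)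
    (fun t ht => h₅ c hcs.2.2.2.2.1 T ε u v hε.le hsu t (Icc_subset_timeInterval hmem ht))
    (fun t ht => h₆ c hcs.2.2.2.2.2 T ε v u hε.le hsv t (Icc_subset_timeInterval hmem ht)))

/-- The lifespan bound for `q < p`. -/
theorem exists_lifespan_bound_of_lt (hn : 2 ≤ n) {p q R : ℝ} (hq : 1 < q) (hqp : q < p)
    (hR : 0 < R) (hcrit : (p + 2 + q⁻¹) / (p * q - 1) = ((n : ℝ) - 1) / 2) {b₁ b₂ : ℝ → ℝ}
    {u₀ v₀ : H1 n} {u₁ v₁ : L2 n} (hu : IsAdmissible R b₁ u₀ u₁) (hv : IsAdmissible R b₂ v₀ v₁) :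
    ∃ C : ℝ, 0 < C ∧ ∀ ε : ℝ, 0 < ε → ε ≤ 1 → ∀ (T : EReal) (u v : ℝ → H1 n),
      IsConeSolution T R p q ε b₁ u₀ u₁ u v → IsConeSolution T R q p ε b₂ v₀ v₁ v u →
      T ≤ ((Real.exp (C * ε ^ (-(q * (p * q - 1)))) : ℝ) : EReal) := by
  have hp : 1 < p := hq.trans hqp
  have hp0 : 0 < p := by linarith
  have hq0 : 0 < q := by linarith
  have hpq1 : 0 < p * q - 1 := by nlinarith
  have hpinv : 1 / p < 1 := (div_lt_one hp0).2 hp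
  have hqinv : 1 / q < 1 := (div_lt_one hq0).2 hq
  obtain ⟨N, hN⟩ : ∃ N : ℝ, N = ((n : ℝ) - 1) / 2 := ⟨_, rfl⟩
  obtain ⟨a, ha⟩ : ∃ a : ℝ, a = N - 1 / q := ⟨_, rfl⟩
  -- Midpoint of the admissible interval (N-1, N-1/p). The choice affects only γ, which cancels
  -- between the two inequalities.
  obtain ⟨a', ha'⟩ : ∃ a' : ℝ, a' = N - (1 + 1 / p) / 2 := ⟨_, rfl⟩
  obtain ⟨γ, hγ⟩ : ∃ γ : ℝ, γ = 1 + 2 * N - N * q - a' := ⟨_, rfl⟩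
  have hNeq : N * (p * q - 1) = p + 2 + 1 / q := by
    rw [hN, ← hcrit, div_mul_cancel₀ _ hpq1.ne', one_div]
  have heG : γ - 1 = -a' - N * (q - 2) := by rw [hγ]; ring
  -- Criticality again: after inserting G ≥ M(s+2R)^γ into the inequality for F, the power of s+2R
  -- is exactly -1.
  have heF : -1 - γ * p = -a - N * (p - 2) - ((N - a') * p - 1) := by
    rw [hγ, ha]; linear_combination hNeq
  rw [hN] at ha ha' heG heF
  obtain ⟨c₁, hc₁, h₁⟩ := hv.exists_iterationBound_critical (q := p) hn hR hq ha heG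
  obtain ⟨c₂, hc₂, h₂⟩ := hu.exists_iterationBound_subcritical (q := q) hn hR hp
    (by linarith) (by linarith) heF
  obtain ⟨c₃, hc₃, h₃⟩ := hv.exists_iterationBound_supercritical (q := p) (a' := a + 1) hn hR hq
    (by linarith) heG
  obtain ⟨c₄, hc₄, h₄⟩ := hu.exists_data_bound (q := q) hn hR (a + 1) hp0
  obtain ⟨c, hc, hcs⟩ : ∃ c : ℝ, 0 < c ∧ c ≤ c₁ ∧ c ≤ c₂ ∧ c ≤ c₃ ∧ c ≤ c₄ :=
    ⟨min c₁ (min c₂ (min c₃ c₄)), by simp [*], by simp⟩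
  obtain ⟨C, hC, hblow⟩ := exists_blowup_asymmetric (c := c) (γ := γ) hR hp hq hc
  refine ⟨2 * C + |Real.log R|, by positivity, fun ε hε hε1 T u v hsu hsv => ?_⟩
  refine le_exp_of_notMem_timeInterval hR hC
    (Real.one_le_rpow_of_pos_of_le_one_of_nonpos hε hε1 (by nlinarith)) fun hmem => ?_
  refine (hsu.coneFunctional_lt_top hn hR (a := a) (by linarith) hmem).ne
    (hblow ε hε hε1 _ (coneFunctional R a' v) (coneFunctional R (a + 1) u) _ rfl hmem.1
    (h₁ c hcs.1 T ε v u hε.le hsv _ hmem) (h₂ c hcs.2.1 T ε u v hε.le hsu _ hmem)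
    (h₃ c hcs.2.2.1 T ε v u hε.le hsv _ hmem)
    (fun t ht => h₄ c hcs.2.2.2 T ε u v hε.le hsu t (Icc_subset_timeInterval hmem ht)))

theorem add_inv_le_add_inv {x y : ℝ} (hx : 0 < x) (hxy : x ≤ y) : x + y⁻¹ ≤ y + x⁻¹ :=
  add_le_add hxy (inv_anti₀ hx hxy)

end DampedWave

/-! ### The lifespan theorem -/

theorem theorem1p2 (n : ℕ) (hn : 2 ≤ n) (p q : ℝ) (hp : 1 < p) (hq : 1 < q)
    (hcrit : max ((p + 2 + q⁻¹) / (p * q - 1)) ((q + 2 + p⁻¹) / (p * q - 1))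
      = ((n : ℝ) - 1) / 2)
    (b₁ b₂ : ℝ → ℝ)
    (hb₁ : ContDiffOn ℝ 1 b₁ (Set.Ici 0)) (hb₂ : ContDiffOn ℝ 1 b₂ (Set.Ici 0))
    (hb₁_int : MeasureTheory.IntegrableOn b₁ (Set.Ici 0))
    (hb₂_int : MeasureTheory.IntegrableOn b₂ (Set.Ici 0))
    (hb₁_nonneg : ∀ t, 0 ≤ t → 0 ≤ b₁ t) (hb₂_nonneg : ∀ t, 0 ≤ t → 0 ≤ b₂ t)
    (R : ℝ) (hR : 0 < R)
    (u₀ v₀ : DampedWave.H1 n) (u₁ v₁ : DampedWave.L2 n)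
    (hu₀ : DampedWave.NonnegSupportedInBall R (DampedWave.toL2 u₀))
    (hu₁ : DampedWave.NonnegSupportedInBall R u₁)
    (hv₀ : DampedWave.NonnegSupportedInBall R (DampedWave.toL2 v₀))
    (hv₁ : DampedWave.NonnegSupportedInBall R v₁)
    (hu_ne : DampedWave.toL2 u₀ ≠ 0 ∨ u₁ ≠ 0)
    (hv_ne : DampedWave.toL2 v₀ ≠ 0 ∨ v₁ ≠ 0) :
    ∃ ε₀ : ℝ, 0 < ε₀ ∧ ∃ C : ℝ, 0 < C ∧
      ∀ ε : ℝ, 0 < ε → ε ≤ ε₀ →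
      ∀ (T : EReal) (u v : ℝ → DampedWave.H1 n),
        DampedWave.IsEnergySolution T p q ε b₁ b₂ u₀ u₁ v₀ v₁ u v →
        DampedWave.SupportedInCone T R u → DampedWave.SupportedInCone T R v →
        T < ⊤ ∧
        (p ≠ q → T ≤ ((Real.exp
          (C * ε ^ (-(min (q * (p * q - 1)) (p * (p * q - 1))))) : ℝ) : EReal)) ∧
        (p = q → T ≤ ((Real.exp (C * ε ^ (-(p * (p - 1)))) : ℝ) : EReal)) := by
  have hu : DampedWave.IsAdmissible R b₁ u₀ u₁ :=
    ⟨hb₁.continuousOn, hb₁_int, hb₁_nonneg, hu₀, hu₁, hu_ne⟩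
  have hv : DampedWave.IsAdmissible R b₂ v₀ v₁ :=
    ⟨hb₂.continuousOn, hb₂_int, hb₂_nonneg, hv₀, hv₁, hv_ne⟩
  have hsol : ∀ {ε : ℝ} {T : EReal} {u v : ℝ → DampedWave.H1 n},
      DampedWave.IsEnergySolution T p q ε b₁ b₂ u₀ u₁ v₀ v₁ u v →
      DampedWave.SupportedInCone T R u → DampedWave.SupportedInCone T R v →
      DampedWave.IsConeSolution T R p q ε b₁ u₀ u₁ u v ∧
        DampedWave.IsConeSolution T R q p ε b₂ v₀ v₁ v u := fun h hu hv =>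
    ⟨⟨h.pos, h.mem_u, h.mem_v, h.init_u, h.eq_u, hu, hv⟩,
      ⟨h.pos, h.mem_v, h.mem_u, h.init_v, h.eq_v, hv, hu⟩⟩
  have hpq : 0 < p * q - 1 := by nlinarith
  -- The smallness of ε is used only to make its negative powers at least 1.
  refine ⟨1, one_pos, ?_⟩
  rcases lt_trichotomy p q with hlt | rfl | hlt
  · rw [max_eq_right (by gcongr ?_ / _; linarith [DampedWave.add_inv_le_add_inv (zero_lt_one.trans hp) hlt.le])]
      at hcrit
    -- For p < q the two components exchange roles, as the second entry attains the maximum.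
    obtain ⟨C, hC, h⟩ := DampedWave.exists_lifespan_bound_of_lt hn hp hlt hR
      (by rwa [mul_comm q p]) hv hu
    refine ⟨C, hC, fun ε hε hε1 T u v hs hsu hsv => ?_⟩
    have hT := h ε hε hε1 T v u (hsol hs hsu hsv).2 (hsol hs hsu hsv).1
    rw [mul_comm q p] at hT
    refine ⟨hT.trans_lt (EReal.coe_lt_top _), fun _ => ?_, fun h => absurd h hlt.ne⟩
    rwa [min_eq_right (by gcongr)]
  · rw [max_self] at hcrit
    have hcrit' : (p + 1) / (p * (p - 1)) = ((n : ℝ) - 1) / 2 := by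
      rw [← hcrit]
      have hp0 : p ≠ 0 := by linarith
      have hp1 : p - 1 ≠ 0 := by linarith
      have hp2 : p + 1 ≠ 0 := by linarith
      -- Since p + 2 + 1/p = (p+1)²/p, a factor p+1 cancels.
      rw [show p * p - 1 = (p - 1) * (p + 1) by ring]
      field_simp
      ring
    obtain ⟨C, hC, h⟩ := DampedWave.exists_lifespan_bound_of_eq hn hp hR hcrit' hu hv
    refine ⟨C, hC, fun ε hε hε1 T u v hs hsu hsv => ?_⟩
    have hT := h ε hε hε1 T u v (hsol hs hsu hsv).1 (hsol hs hsu hsv).2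
    exact ⟨hT.trans_lt (EReal.coe_lt_top _), fun h => absurd rfl h, fun _ => hT⟩
  · rw [max_eq_left (by gcongr ?_ / _; linarith [DampedWave.add_inv_le_add_inv (zero_lt_one.trans hq) hlt.le])]
      at hcrit
    obtain ⟨C, hC, h⟩ := DampedWave.exists_lifespan_bound_of_lt hn hq hlt hR hcrit hu hv
    refine ⟨C, hC, fun ε hε hε1 T u v hs hsu hsv => ?_⟩
    have hT := h ε hε hε1 T u v (hsol hs hsu hsv).1 (hsol hs hsu hsv).2
    refine ⟨hT.trans_lt (EReal.coe_lt_top _), fun _ => ?_, fun h => absurd h hlt.ne'⟩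
    rwa [min_eq_left (by gcongr)]
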